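/- Let the phase space be $M=\mathbb R\times J$ with coordinates $(\theta,\psi)$, where $J=\mathbb R$ or $J=[0,\infty)$ and $\theta$ is the lift of an angle of period $1$. Let $f(\psi',\theta)$ be of class $C^2$ (on a neighbourhood of $J$ times $\mathbb R$) and $1$-periodic in $\theta$, put $F(\psi',\theta)=\psi'\theta+f(\psi',\theta)$, and let $T:M\to M$ be a $C^1$ bijection generated by $F$: for $(\theta,\psi)\in M$, $T(\theta,\psi)=(\theta',\psi')$ is the unique solution in $M$ of $$\psi=\frac{\partial F}{\partial\theta}(\psi',\theta),\qquad \theta'=\frac{\partial F}{\partial\psi'}(\psi',\theta).$$ A point $z_0\in M$ is periodic of type $(n,m)$, $m\ge 1$, if $T^m(z_0)=z_0+(n,0)$; write $z_j=(\theta_j,\psi_j)=T^j(z_0)$. (I) Suppose that $T$ is a twist map, $\partial\theta'/\partial\psi\neq0$ on $M$. Let $F_a(\theta,\theta')=\psi'(\theta,\theta')\,\theta'-F(\psi'(\theta,\theta'),\theta)$, where $\psi'(\theta,\theta')\in J$ solves $\theta'=\frac{\partial F}{\partial\psi'}(\psi',\theta)$, and let $\mathcal A(\theta_0,\dots,\theta_{m-1})=\sum_{j=0}^{m-1}F_a(\theta_j,\theta_{j+1})$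 with $\theta_m=\theta_0+n$. Call an orbit of type $(n,m)$ extremizing if its angles are a local extremum of $\mathcal A$ (a minimum for right twist $\partial\theta'/\partial\psi>0$, a maximum for left twist), and maxmin if they are a saddle point of $\mathcal A$ (for $m=1$: a stationary point that is not an extremum of the former kind). Then: 1. $F_a$ generates $T$: $\psi=-\partial F_a/\partial\theta$ and $\psi'=\partial F_a/\partial\theta'$ at $(\theta,\theta')$ whenever $T(\theta,\psi)=(\theta',\psi')$ with $\psi$ in the interior of $J$. 2. If $T(\theta,\psi)=(\theta',\psi')$, then $$\psi'\,\frac{\partial f}{\partial\psi'}(\psi',\theta)-f(\psi',\theta)=\psi'\theta'-F(\psi',\theta)=F_a(\theta,\theta').$$ 3. If $(\theta^{(u)}_j,\psi^{(u)}_j)$ is an extremizing and $(\theta^{(s)}_j,\psi^{(s)}_j)$ a maxmin orbit of type $(n,m)$, then $\Delta\mathcal A_{n/m}:=\mathcal A_{\rm extremizing}-\mathcal A_{\rm maxmin}$ satisfies $$\Delta\mathcal A_{n/m}=\Sigma^{(u)}-\Sigma^{(s)}=\sum_{j=0}^{m-1}\Big(\psi^{(u)}_{j+1}\theta^{(u)}_{j+1}-F(\psi^{(u)}_{j+1},\theta^{(u)}_j)-\psi^{(s)}_{j+1}\theta^{(s)}_{j+1}+F(\psi^{(s)}_{j+1},\theta^{(s)}_j)\Big),$$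 $$\text{where}\quad \Sigma=\sum_{j=0}^{m-1}\Big(\psi_{j+1}\frac{\partial f}{\partial\psi'}(\psi_{j+1},\theta_j)-f(\psi_{j+1},\theta_j)\Big).$$ 4. Let $C$ be a simple closed piecewise $C^1$ regular curve that winds once around the cylinder $M/\mathbb Z$ and lies in its interior, and let $R_C$ be the domain bounded by $C$ on the side of small $\psi$. Suppose that $C\cap T(C)$ consists exactly of the $2m$ points of these two orbits, that $T(C)$ crosses $C$ at each of them, and that $C$ and $T(C)$ visit them in the same cyclic order (more precisely, $T$ preserves the cyclic order of these points along $C$). Then the escape area (flux) is $$\mathrm{Area}\big(T(R_C)\setminus R_C\big)=|\Delta\mathcal A_{n/m}|=\big|\Sigma^{(u)}-\Sigma^{(s)}\big|.$$ (II) Without the twist condition, for any two periodic orbits $u,s$ of type $(n,m)$ and any curve $C$ as in 4, one still has $\mathrm{Area}(T(R_C)\setminus R_C)=|\Sigma^{(u)}-\Sigma^{(s)}|$. -/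

import Mathlib

open Set Filter Topology MeasureTheory

noncomputable section

namespace EscapeArea

/-- The (lifted) phase space: points `(θ, ψ)` with `θ ∈ ℝ` and `ψ ∈ J`. -/
def phase (J : Set ℝ) : Set (ℝ × ℝ) := univ ×ˢ J

/-- The mixed generating function `F(ψ', θ) = ψ' θ + f(ψ', θ)`. -/
def mixedGen (f : ℝ → ℝ → ℝ) (ψ' θ : ℝ) : ℝ := ψ' * θ + f ψ' θ

/-- `∂F/∂θ (ψ', θ)`. -/
def mixedGenDθ (f : ℝ → ℝ → ℝ) (ψ' θ : ℝ) : ℝ := deriv (fun x => mixedGen f ψ' x) θ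

/-- `∂F/∂ψ' (ψ', θ)`. -/
def mixedGenDψ (f : ℝ → ℝ → ℝ) (ψ' θ : ℝ) : ℝ := deriv (fun p => mixedGen f p θ) ψ'

/-- `T` is the (lifted) `C¹` invertible map of the phase space generated by
`F(ψ', θ) = ψ' θ + f(ψ', θ)`, with `f` of class `C²` up to the boundary and `1`-periodic in `θ`:
`T (θ, ψ)` is the unique solution `(θ', ψ')` of `ψ = ∂F/∂θ (ψ', θ)`, `θ' = ∂F/∂ψ' (ψ', θ)`. -/
structure IsGeneratedBy (J : Set ℝ) (f : ℝ → ℝ → ℝ) (T : ℝ × ℝ → ℝ × ℝ) : Prop where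
  smooth : ∃ U : Set ℝ, IsOpen U ∧ J ⊆ U ∧
    ContDiffOn ℝ 2 (fun p : ℝ × ℝ => f p.1 p.2) (U ×ˢ univ)
  periodic : ∀ ψ' ∈ J, ∀ θ, f ψ' (θ + 1) = f ψ' θ
  contDiffOn : ContDiffOn ℝ 1 T (phase J)
  bijOn : BijOn T (phase J) (phase J)
  generated : ∀ θ, ∀ ψ ∈ J, ∀ θ', ∀ ψ' ∈ J,
    (T (θ, ψ) = (θ', ψ') ↔ ψ = mixedGenDθ f ψ' θ ∧ θ' = mixedGenDψ f ψ' θ)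

/-- Twist condition: `∂θ'/∂ψ ≠ 0` (a one-sided derivative on the boundary of the phase space). -/
def IsTwist (J : Set ℝ) (T : ℝ × ℝ → ℝ × ℝ) : Prop :=
  ∀ θ, ∀ ψ ∈ J, derivWithin (fun p => (T (θ, p)).1) J ψ ≠ 0

/-- Right twist: `∂θ'/∂ψ > 0`. -/
def IsRightTwist (J : Set ℝ) (T : ℝ × ℝ → ℝ × ℝ) : Prop :=
  ∀ θ, ∀ ψ ∈ J, 0 < derivWithin (fun p => (T (θ, p)).1) J ψ

/-- Left twist: `∂θ'/∂ψ < 0`. -/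
def IsLeftTwist (J : Set ℝ) (T : ℝ × ℝ → ℝ × ℝ) : Prop :=
  ∀ θ, ∀ ψ ∈ J, derivWithin (fun p => (T (θ, p)).1) J ψ < 0

/-- The pairs `(θ, θ')` on which the action generating function is defined. -/
def IsAdmissible (J : Set ℝ) (f : ℝ → ℝ → ℝ) (θ θ' : ℝ) : Prop :=
  ∃ ψ' ∈ J, θ' = mixedGenDψ f ψ' θ

open Classical in
/-- `ψ'(θ, θ')`: the solution in `J` of `θ' = ∂F/∂ψ' (ψ', θ)` (`0` if there is none). -/
def newMomentum (J : Set ℝ) (f : ℝ → ℝ → ℝ) (θ θ' : ℝ) : ℝ :=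
  if h : IsAdmissible J f θ θ' then h.choose else 0

/-- The action generating function `F_a(θ, θ') = ψ'(θ, θ') θ' - F(ψ'(θ, θ'), θ)`. -/
def actionGen (J : Set ℝ) (f : ℝ → ℝ → ℝ) (θ θ' : ℝ) : ℝ :=
  newMomentum J f θ θ' * θ' - mixedGen f (newMomentum J f θ θ') θ

/-- The angle after `θ_j` in a configuration `θ_0, …, θ_{m-1}` closed up by `θ_m = θ_0 + n`. -/
def nextAngle (n : ℤ) {m : ℕ} (θ : Fin m → ℝ) (j : Fin m) : ℝ :=
  if h : (j : ℕ) + 1 < m then θ ⟨j + 1, h⟩ else θ ⟨0, j.pos⟩ + n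

/-- The action `𝒜(θ_0, …, θ_{m-1}) = ∑_j F_a(θ_j, θ_{j+1})`, with `θ_m = θ_0 + n`. -/
def action (J : Set ℝ) (f : ℝ → ℝ → ℝ) (n : ℤ) {m : ℕ} (θ : Fin m → ℝ) : ℝ :=
  ∑ j, actionGen J f (θ j) (nextAngle n θ j)

/-- The configurations on which the action is defined. -/
def actionDomain (J : Set ℝ) (f : ℝ → ℝ → ℝ) (n : ℤ) (m : ℕ) : Set (Fin m → ℝ) :=
  {θ | ∀ j, IsAdmissible J f (θ j) (nextAngle n θ j)}

/-- Periodic points of type `(n, m)`. -/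
def IsPeriodicOfType (J : Set ℝ) (T : ℝ × ℝ → ℝ × ℝ) (n : ℤ) (m : ℕ) (z : ℝ × ℝ) : Prop :=
  z ∈ phase J ∧ T^[m] z = (z.1 + n, z.2)

/-- The angles `θ_0, …, θ_{m-1}` of the orbit of `z`. -/
def orbitAngles (T : ℝ × ℝ → ℝ × ℝ) (m : ℕ) (z : ℝ × ℝ) : Fin m → ℝ := fun j => (T^[j] z).1

/-- `θ` is a local extremum of the action, of the kind that the twist forces to exist: a minimum
for right twist, a maximum for left twist. -/
def IsTwistExtremum (J : Set ℝ) (f : ℝ → ℝ → ℝ) (T : ℝ × ℝ → ℝ × ℝ) (n : ℤ) {m : ℕ}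
    (θ : Fin m → ℝ) : Prop :=
  (IsRightTwist J T ∧ IsLocalMinOn (action J f n) (actionDomain J f n m) θ) ∨
  (IsLeftTwist J T ∧ IsLocalMaxOn (action J f n) (actionDomain J f n m) θ)

/-- The orbit of `z` is an extremizing orbit of type `(n, m)`. -/
def IsExtremizingOrbit (J : Set ℝ) (f : ℝ → ℝ → ℝ) (T : ℝ × ℝ → ℝ × ℝ) (n : ℤ) (m : ℕ)
    (z : ℝ × ℝ) : Prop :=
  IsPeriodicOfType J T n m z ∧ IsTwistExtremum J f T n (orbitAngles T m z)

/-- The orbit of `z` is a maxmin orbit of type `(n, m)`: a periodic orbit (thus a stationary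
configuration) that is a saddle point of the action. For `m = 1`, where the action depends on one
variable only and has no saddles, it is a stationary point which is not an extremum of the kind
of the extremizing orbits. -/
def IsMaxminOrbit (J : Set ℝ) (f : ℝ → ℝ → ℝ) (T : ℝ × ℝ → ℝ × ℝ) (n : ℤ) (m : ℕ)
    (z : ℝ × ℝ) : Prop :=
  IsPeriodicOfType J T n m z ∧ ¬ IsTwistExtremum J f T n (orbitAngles T m z) ∧
  (m ≠ 1 → ¬ IsLocalExtrOn (action J f n) (actionDomain J f n m) (orbitAngles T m z))

/-- `Δ𝒜_{n/m}`: the action of the orbit of `u` minus the action of the orbit of `s`. -/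
def actionDifference (J : Set ℝ) (f : ℝ → ℝ → ℝ) (T : ℝ × ℝ → ℝ × ℝ) (n : ℤ) (m : ℕ)
    (u s : ℝ × ℝ) : ℝ :=
  action J f n (orbitAngles T m u) - action J f n (orbitAngles T m s)

/-- `∑_j (ψ_{j+1} ∂f/∂ψ' (ψ_{j+1}, θ_j) - f (ψ_{j+1}, θ_j))` along the orbit of `z`. -/
def periodicSum (f : ℝ → ℝ → ℝ) (T : ℝ × ℝ → ℝ × ℝ) (m : ℕ) (z : ℝ × ℝ) : ℝ :=
  ∑ j ∈ Finset.range m,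
    ((T^[j + 1] z).2 * deriv (fun p => f p (T^[j] z).1) (T^[j + 1] z).2
      - f (T^[j + 1] z).2 (T^[j] z).1)

/-- `∑_j (ψ_{j+1} θ_{j+1} - F (ψ_{j+1}, θ_j))` along the orbit of `z`. -/
def mixedSum (f : ℝ → ℝ → ℝ) (T : ℝ × ℝ → ℝ × ℝ) (m : ℕ) (z : ℝ × ℝ) : ℝ :=
  ∑ j ∈ Finset.range m,
    ((T^[j + 1] z).2 * (T^[j + 1] z).1 - mixedGen f (T^[j + 1] z).2 (T^[j] z).1)

/-- `γ` is the lift of a simple closed curve winding once around the cylinder, inside the phase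
space, piecewise `C¹` and regular (finitely many break points per period). -/
structure IsClosedCurve (J : Set ℝ) (γ : ℝ → ℝ × ℝ) : Prop where
  shift : ∀ t, γ (t + 1) = ((γ t).1 + 1, (γ t).2)
  simple : ∀ (s t : ℝ) (k : ℤ), γ s = ((γ t).1 + k, (γ t).2) → s = t + k
  mem_interior : ∀ t, (γ t).2 ∈ interior J
  lipschitz : ∃ K, LipschitzWith K γ
  regular : ∃ S : Finset ℝ, ∀ t, (∀ b ∈ S, ∀ k : ℤ, t ≠ b + k) →
    ContDiffAt ℝ 1 γ t ∧ deriv γ t ≠ 0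

/-- `R` is (the lift of) the domain `R_C` bounded by the curve `C` with lift `γ`, on the side of
small `ψ`: `R` and its exterior are relatively open in the phase space and `C` is their common
boundary. -/
structure IsDomainBoundedBy (J : Set ℝ) (γ : ℝ → ℝ × ℝ) (R : Set (ℝ × ℝ)) : Prop where
  subset : R ⊆ phase J
  shift : ∀ θ ψ, (θ + 1, ψ) ∈ R ↔ (θ, ψ) ∈ R
  disjoint : Disjoint R (range γ)
  isOpen : ∃ U, IsOpen U ∧ R = U ∩ phase J
  isOpen_exterior : ∃ V, IsOpen V ∧ phase J \ (R ∪ range γ) = V ∩ phase J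
  subset_closure : range γ ⊆ closure R
  subset_closure_exterior : range γ ⊆ closure (phase J \ (R ∪ range γ))
  low : ∀ z ∈ phase J, (∀ t, z.2 < (γ t).2) → z ∈ R
  high : ∀ z ∈ phase J, (∀ t, (γ t).2 < z.2) → z ∉ R

/-- All lifts to the plane of the `m` points of the orbit of `z`. -/
def orbitLifts (T : ℝ × ℝ → ℝ × ℝ) (m : ℕ) (z : ℝ × ℝ) : Set (ℝ × ℝ) :=
  {w | ∃ j < m, ∃ k : ℤ, w = ((T^[j] z).1 + k, (T^[j] z).2)}

/-- The curve `C` (with lift `γ`, bounding `R`) and its image `T(C)` meet exactly in the `2m`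
points of the orbits of `u` and `s`, they cross at each of these points, and both curves visit
these points in the same cyclic order.
The points are numbered along `C` by `i ∈ ℤ`, `2m` of them for each turn. -/
structure IsTurnstile (T : ℝ × ℝ → ℝ × ℝ) (m : ℕ) (u s : ℝ × ℝ) (γ : ℝ → ℝ × ℝ)
    (R : Set (ℝ × ℝ)) (t : ℤ → ℝ) : Prop where
  strictMono : StrictMono t
  shift : ∀ i, t (i + 2 * m) = t i + 1
  inter : range γ ∩ T '' range γ = range (fun i => γ (t i))
  points : range (fun i => γ (t i)) = orbitLifts T m u ∪ orbitLifts T m s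
  order : ∃ k : ℤ, ∀ i, T (γ (t i)) = γ (t (i + k))
  crossing : ∀ i,
    ((∀ᶠ τ in 𝓝[<] (t i), T (γ τ) ∈ R) ∧ (∀ᶠ τ in 𝓝[>] (t i), T (γ τ) ∉ R)) ∨
    ((∀ᶠ τ in 𝓝[<] (t i), T (γ τ) ∉ R) ∧ (∀ᶠ τ in 𝓝[>] (t i), T (γ τ) ∈ R))

/-- The escape area (flux) `L(R_C, T) = Area (T(R_C) \ R_C)`, the area being taken on the cylinder,
that is, over one period in `θ`. -/
def escapeArea (T : ℝ × ℝ → ℝ × ℝ) (R : Set (ℝ × ℝ)) : ENNReal :=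
  volume ((T '' R \ R) ∩ (Ico (0 : ℝ) 1 ×ˢ univ))

end EscapeArea

end

/-! Along T put P = ψ'θ' - F(ψ', θ). The generating equations give dP = ψ'dθ' - ψdθ
(`hasFDerivAt_primitive`), so P is a primitive of T^*(ψ dθ) - ψ dθ. Green's formula writes the area
of T(R) \ R over one period as the integral of ψ dθ along the arcs of T(C) outside R minus the
integral along the arcs of C inside T(R). If both families consist of arcs with the same indices i,
the arc over [t i, t (i+1)] contributes P(γ(t (i+1))) - P(γ(t i)). Crossing makes these arcs
alternate, and the points of even and of odd index form the two orbits, so the total is, up to sign,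
the sum of P over one orbit minus the sum over the other (`abs_sum_alternating`). Both `periodicSum`
and `mixedSum` are sums of P along the orbit. Under twist F_a(θ, θ') is again the value of P
(`actionGen_map`), so the action of an orbit is the same sum.

The work lies in Green's formula, because R is given only topologically and C may have corners.
`GaussGreenAt E L z` says that near z the distributional gradient of the indicator of E is the
functional L. At a regular boundary point a curvilinear box shows that E lies on exactly one side
(`IsBoundedBy.regular_side`), so L is the flux through the curve with weight 1 or -1. Two facts
handle corners and intersection points. Isolated points are removable (`gaussGreenAt_of_punctured`),
because the gradients of shrinking cut-offs tend to zero in L¹ of the plane. Second derivatives are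
symmetric (`curl_eq_of_gaussGreen`), so a weighted curve that bounds a set has no boundary of its
own and its weight cannot jump. Hence the side is constant along the curve
(`IsBoundedBy.exists_gaussGreen`).

For R the sign is read off at the ends of the cylinder (`sign_eq_of_ends`); for T(R) it follows
because T preserves the area form (`cross_fderiv`). At a point of C ∩ T(C) the same curl argument
equates the jumps of the weights on the two curves. As T moves the numbering of the points by the
even number 2n, this forces the contributing arcs of C and of T(C) to have the same indices. -/

open scoped ContDiff Manifold

/-! ### Test functions and the local Gauss–Green property. -/

noncomputable section

namespace EscapeArea

/-- The planar cross product (the area form). -/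
def cross (a b : ℝ × ℝ) : ℝ := a.1 * b.2 - a.2 * b.1

/-- Smooth compactly supported functions on the plane. -/
structure IsTest (φ : ℝ × ℝ → ℝ) : Prop where
  smooth : ContDiff ℝ ∞ φ
  compact : HasCompactSupport φ

namespace IsTest

variable {φ χ : ℝ × ℝ → ℝ}

lemma add (hφ : IsTest φ) (hχ : IsTest χ) : IsTest (φ + χ) :=
  ⟨hφ.smooth.add hχ.smooth, hφ.compact.add hχ.compact⟩

lemma zero : IsTest 0 := ⟨contDiff_const, HasCompactSupport.zero⟩

lemma mul_left (hφ : IsTest φ) {g : ℝ × ℝ → ℝ} (hg : ContDiff ℝ ∞ g) :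
    IsTest (fun z => g z * φ z) :=
  ⟨hg.mul hφ.smooth, hφ.compact.mul_left⟩

lemma differentiable (hφ : IsTest φ) : Differentiable ℝ φ := hφ.smooth.differentiable (by simp)

lemma fderiv_apply (hφ : IsTest φ) (v : ℝ × ℝ) : IsTest (fun z => fderiv ℝ φ z v) :=
  ⟨(hφ.smooth.fderiv_right (m := ∞) (by simp)).clm_apply contDiff_const,
    hφ.compact.fderiv_apply ℝ v⟩

lemma integrable (hφ : IsTest φ) : Integrable φ :=
  hφ.smooth.continuous.integrable_of_hasCompactSupport hφ.compact

lemma integral_fderiv (hφ : IsTest φ) (v : ℝ × ℝ) : ∫ z, fderiv ℝ φ z v = 0 := by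
  have h := integral_mul_fderiv_eq_neg_fderiv_mul_of_integrable (μ := (volume : Measure (ℝ × ℝ)))
    (f := fun _ => (1 : ℝ)) (g := φ) (v := v) (by simp)
    (by simpa using (hφ.fderiv_apply v).integrable) (by simpa using hφ.integrable) (by fun_prop) (fun x _ => hφ.differentiable x)
  simpa using h

end IsTest

/-- A property of test functions that is additive and holds locally holds globally. -/
lemma test_of_local {P : (ℝ × ℝ → ℝ) → Prop}
    (hadd : ∀ φ χ, IsTest φ → IsTest χ → P φ → P χ → P (φ + χ)) (h0 : P 0)
    {φ : ℝ × ℝ → ℝ} (hφ : IsTest φ)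
    (hloc : ∀ z ∈ tsupport φ, ∃ U ∈ 𝓝 z, ∀ χ, IsTest χ → tsupport χ ⊆ U → P χ) : P φ := by
  choose! U hU hP using hloc
  obtain ⟨s, hs, hcov⟩ := hφ.compact.isCompact.elim_nhds_subcover (fun z => interior (U z))
    (fun z hz => interior_mem_nhds.2 (hU z hz))
  obtain ⟨ρ, hρ⟩ := SmoothPartitionOfUnity.exists_isSubordinate 𝓘(ℝ, ℝ × ℝ)
    (isClosed_tsupport φ) (fun z : s => interior (U z)) (fun z => isOpen_interior)
    (by intro x hx; simpa using hcov hx)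
  have hsm : ∀ i : s, ContDiff ℝ ∞ (ρ i) := fun i => (ρ i).contMDiff.contDiff
  have hsum : φ = ∑ i : s, fun z => ρ i z * φ z := by
    funext z
    rw [Finset.sum_apply]
    by_cases hz : z ∈ tsupport φ
    · rw [← Finset.sum_mul, ← finsum_eq_sum_of_fintype, ρ.sum_eq_one hz, one_mul]
    · simp [image_eq_zero_of_notMem_tsupport hz]
  have key : ∀ t : Finset s, IsTest (∑ i ∈ t, fun z => ρ i z * φ z) ∧
      P (∑ i ∈ t, fun z => ρ i z * φ z) := by
    intro t
    induction t using Finset.induction_on with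
    | empty => simpa using ⟨IsTest.zero, h0⟩
    | insert i t hi ih =>
      rw [Finset.sum_insert hi]
      have h1 := hφ.mul_left (hsm i)
      refine ⟨h1.add ih.1, hadd _ _ h1 ih.1 (hP i (hs i i.2) _ h1 ?_) ih.2⟩
      exact (tsupport_mul_subset_left).trans ((hρ i).trans interior_subset)
  rw [hsum]
  exact (key Finset.univ).2

/-- Additive functionals on test functions with a dominated convergence property,
such as integration along curves. -/
structure IsBoundaryFunctional (L : ℝ × ℝ → (ℝ × ℝ → ℝ) → ℝ) : Prop where
  add : ∀ v φ χ, IsTest φ → IsTest χ → L v (φ + χ) = L v φ + L v χ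
  tendsto : ∀ v φ, IsTest φ → ∀ p, ∀ Φ : ℕ → ℝ × ℝ → ℝ, (∀ n, IsTest (Φ n)) →
    (∀ n z, |Φ n z| ≤ |φ z|) → (∀ z ≠ p, Tendsto (fun n => Φ n z) atTop (𝓝 (φ z))) →
    Tendsto (fun n => L v (Φ n)) atTop (𝓝 (L v φ))

/-- Near `z`, the distributional derivative of the indicator of `E` is given by `L`. -/
def GaussGreenAt (E : Set (ℝ × ℝ)) (L : ℝ × ℝ → (ℝ × ℝ → ℝ) → ℝ) (z : ℝ × ℝ) : Prop :=
  ∃ U ∈ 𝓝 z, ∀ φ, IsTest φ → tsupport φ ⊆ U → ∀ v, ∫ x in E, fderiv ℝ φ x v = L v φ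

lemma GaussGreenAt.eventually {E : Set (ℝ × ℝ)} {L : ℝ × ℝ → (ℝ × ℝ → ℝ) → ℝ} {z : ℝ × ℝ}
    (h : GaussGreenAt E L z) : ∀ᶠ y in 𝓝 z, GaussGreenAt E L y := by
  obtain ⟨U, hU, h⟩ := h
  filter_upwards [eventually_mem_nhds_iff.2 hU] with y hy using ⟨U, hy, h⟩

variable {E : Set (ℝ × ℝ)} {L : ℝ × ℝ → (ℝ × ℝ → ℝ) → ℝ}

/-- Both sides are additive in φ, so a partition of unity on the support reduces the formula to the
local ones. -/
lemma gaussGreen_of_forall_tsupport (hL : IsBoundaryFunctional L) {φ : ℝ × ℝ → ℝ}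
    (hφ : IsTest φ) (h : ∀ z ∈ tsupport φ, GaussGreenAt E L z) (v : ℝ × ℝ) :
    ∫ x in E, fderiv ℝ φ x v = L v φ := by
  refine test_of_local (P := fun φ => ∫ x in E, fderiv ℝ φ x v = L v φ) ?_ ?_ hφ ?_
  · intro φ χ hφ hχ h1 h2
    rw [hL.add v φ χ hφ hχ, ← h1, ← h2,
      ← integral_add (hφ.fderiv_apply v).integrable.integrableOn
        (hχ.fderiv_apply v).integrable.integrableOn]
    refine integral_congr_ae (ae_of_all _ fun x => ?_)
    simp [fderiv_add (hφ.differentiable x) (hχ.differentiable x)]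
  · have := hL.add v 0 0 IsTest.zero IsTest.zero
    simp only [add_zero] at this
    have h0 : L v 0 = 0 := by linarith
    simp [h0]
  · intro z hz
    obtain ⟨U, hU, h⟩ := h z hz
    exact ⟨U, hU, fun χ h1 h2 => h χ h1 h2 v⟩

/-- Isolated points are removable for the Gauss–Green formula. -/
lemma gaussGreenAt_of_punctured (hL : IsBoundaryFunctional L) {p : ℝ × ℝ}
    (h : ∀ᶠ y in 𝓝[≠] p, GaussGreenAt E L y) : GaussGreenAt E L p := by
  rw [eventually_nhdsWithin_iff] at h
  obtain ⟨U, hU, hUo, hpU⟩ := mem_nhds_iff.1 h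
  refine ⟨U, hUo.mem_nhds hpU, fun φ hφ hsupp v => ?_⟩
  let η : ContDiffBump (0 : ℝ × ℝ) := ⟨1, 2, one_pos, one_lt_two⟩
  have hηs : ContDiff ℝ ∞ (η : ℝ × ℝ → ℝ) := η.contDiff
  let c : ℕ → ℝ := fun n => n + 1
  have hc : ∀ n, 0 < c n := fun n => by positivity
  -- The cut-off vanishes within distance 1 / c n of p and equals 1 beyond distance 2 / c n.
  let χ : ℕ → ℝ × ℝ → ℝ := fun n z => 1 - η (c n • (z - p))
  have hχs : ∀ n, ContDiff ℝ ∞ (χ n) := fun n => by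
    have : ContDiff ℝ ∞ (fun z : ℝ × ℝ => c n • (z - p)) := by fun_prop
    exact contDiff_const.sub (hηs.comp this)
  have hχ0 : ∀ n z, 0 ≤ χ n z := fun n z => sub_nonneg.2 η.le_one
  have hχ1 : ∀ n z, χ n z ≤ 1 := fun n z => sub_le_self _ η.nonneg
  have hctop : Tendsto c atTop atTop := tendsto_natCast_atTop_atTop.atTop_add tendsto_const_nhds
  have hχt : ∀ z ≠ p, ∀ᶠ n in atTop, χ n z = 1 := by
    intro z hz
    have hz' : 0 < ‖z - p‖ := norm_pos_iff.2 (sub_ne_zero.2 hz)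
    filter_upwards [hctop.eventually_ge_atTop (2 / ‖z - p‖)] with n hn
    have : η (c n • (z - p)) = 0 := by
      apply η.zero_of_le_dist
      rw [dist_zero_right, norm_smul, Real.norm_of_nonneg (hc n).le]
      exact (div_le_iff₀ hz').1 hn
    simp [χ, this]
  have hT : ∀ n, IsTest (fun z => χ n z * φ z) := fun n => hφ.mul_left (hχs n)
  have hid : ∀ n, ∫ x in E, fderiv ℝ (fun z => χ n z * φ z) x v = L v (fun z => χ n z * φ z) := by
    intro n
    refine gaussGreen_of_forall_tsupport hL (hT n) (fun z hz => ?_) v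
    refine hU (hsupp (tsupport_mul_subset_right hz)) ?_
    -- At p itself the product vanishes on a whole neighbourhood, so p is not in its support.
    rintro rfl
    have hnear : (fun x => χ n x * φ x) =ᶠ[𝓝 z] 0 := by
      have : Metric.ball z (1 / c n) ∈ 𝓝 z := Metric.ball_mem_nhds _ (by have := hc n; positivity)
      filter_upwards [this] with x hx
      have : η (c n • (x - z)) = 1 := by
        apply η.one_of_mem_closedBall
        rw [mem_closedBall_zero_iff, norm_smul, Real.norm_of_nonneg (hc n).le]
        rw [Metric.mem_ball, dist_eq_norm, lt_div_iff₀ (hc n), mul_comm] at hx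
        exact hx.le
      simp [χ, this]
    exact (notMem_tsupport_iff_eventuallyEq.2 hnear) hz
  have hR : Tendsto (fun n => L v (fun z => χ n z * φ z)) atTop (𝓝 (L v φ)) := by
    refine hL.tendsto v φ hφ p _ hT (fun n z => ?_) (fun z hz => ?_)
    · rw [abs_mul, abs_of_nonneg (hχ0 n z)]
      exact mul_le_of_le_one_left (abs_nonneg _) (hχ1 n z)
    · refine tendsto_const_nhds.congr' ?_
      filter_upwards [hχt z hz] with n hn
      simp [hn]
  have hfd : ∀ n x, fderiv ℝ (fun z => χ n z * φ z) x v
      = χ n x * fderiv ℝ φ x v + φ x * fderiv ℝ (χ n) x v := by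
    intro n x
    rw [fderiv_fun_mul ((hχs n).differentiable (by simp) x) (hφ.differentiable x)]
    simp
  have hi1 : ∀ n, Integrable (fun x => χ n x * fderiv ℝ φ x v) := fun n =>
    ((hφ.fderiv_apply v).mul_left (hχs n)).integrable
  have hi2 : ∀ n, Integrable (fun x => φ x * fderiv ℝ (χ n) x v) := fun n => by
    have := (hφ.mul_left (((hχs n).fderiv_right (m := ∞) (by simp)).clm_apply
      (contDiff_const (c := v)))).integrable
    simpa only [mul_comm] using this
  have hL1 : Tendsto (fun n => ∫ x in E, χ n x * fderiv ℝ φ x v) atTop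
      (𝓝 (∫ x in E, fderiv ℝ φ x v)) := by
    refine tendsto_integral_of_dominated_convergence (fun x => |fderiv ℝ φ x v|)
      (fun n => (hi1 n).integrableOn.aestronglyMeasurable)
      (hφ.fderiv_apply v).integrable.abs.integrableOn (fun n => ae_of_all _ fun x => ?_) ?_
    · rw [Real.norm_eq_abs, abs_mul, abs_of_nonneg (hχ0 n x)]
      exact mul_le_of_le_one_left (abs_nonneg _) (hχ1 n x)
    · have : ∀ᵐ x ∂(volume.restrict E), x ≠ p := ae_restrict_of_ae (by
        simp [ae_iff])
      filter_upwards [this] with x hx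
      refine tendsto_const_nhds.congr' ?_
      filter_upwards [hχt x hx] with n hn
      simp [hn]
  -- The gradient of the cut-off has size of order c n and lives on a set of area of order 1 / (c
  -- n)², so the error is of order 1 / c n.
  have hL2 : Tendsto (fun n => ∫ x in E, φ x * fderiv ℝ (χ n) x v) atTop (𝓝 0) := by
    obtain ⟨M, hM⟩ := hφ.compact.exists_bound_of_continuous hφ.smooth.continuous
    have hηc : HasCompactSupport (η : ℝ × ℝ → ℝ) := η.hasCompactSupport
    obtain ⟨D, hD⟩ := (hηc.fderiv ℝ).exists_bound_of_continuous
      ((hηs.continuous_fderiv (by simp)))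
    have hM0 : 0 ≤ M := (norm_nonneg _).trans (hM 0)
    have hD0 : 0 ≤ D := (norm_nonneg _).trans (hD 0)
    have hder : ∀ n x, fderiv ℝ (χ n) x v = - (c n * fderiv ℝ η (c n • (x - p)) v) := by
      intro n x
      have h1 : HasFDerivAt (fun z : ℝ × ℝ => c n • (z - p))
          (c n • ContinuousLinearMap.id ℝ (ℝ × ℝ)) x :=
        ((hasFDerivAt_id x).sub_const p).const_smul (c n)
      have h2 : HasFDerivAt (χ n) (-((fderiv ℝ η (c n • (x - p))).comp
          (c n • ContinuousLinearMap.id ℝ (ℝ × ℝ)))) x :=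
        (((hηs.differentiable (by simp) _).hasFDerivAt).comp x h1).const_sub 1
      rw [h2.fderiv]
      simp
    -- The plane carries the sup norm: this ball is a square of side 4 / c n.
    have hvol : ∀ n, (volume (Metric.closedBall p (2 / c n))).toReal = (4 / c n) ^ 2 := by
      intro n
      have h0 : 0 < c n := hc n
      rw [← Prod.mk.eta (p := p), ← closedBall_prod_same, Measure.volume_eq_prod, Measure.prod_prod,
        Real.volume_closedBall, Real.volume_closedBall, ENNReal.toReal_mul,
        ENNReal.toReal_ofReal (by positivity)]
      ring
    have hbd : ∀ n, ‖∫ x in E, φ x * fderiv ℝ (χ n) x v‖ ≤ 16 * M * D * ‖v‖ / c n := by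
      intro n
      have h0 : 0 < c n := hc n
      have hpt : ∀ x, ‖φ x * fderiv ℝ (χ n) x v‖
          ≤ (Metric.closedBall p (2 / c n)).indicator (fun _ => M * (c n * (D * ‖v‖))) x := by
        intro x
        by_cases hx : x ∈ Metric.closedBall p (2 / c n)
        · rw [indicator_of_mem hx, hder, norm_mul, norm_neg, norm_mul, Real.norm_of_nonneg h0.le]
          gcongr
          · exact hM x
          · exact (ContinuousLinearMap.le_opNorm _ _).trans (by gcongr; exact hD _)
        · have hz : fderiv ℝ η (c n • (x - p)) = 0 := by
            apply fderiv_of_notMem_tsupport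
            rw [η.tsupport_eq, mem_closedBall_zero_iff, norm_smul, Real.norm_of_nonneg h0.le]
            rw [Metric.mem_closedBall, dist_eq_norm, le_div_iff₀ h0, mul_comm] at hx
            exact hx
          simp [hder, hz, hx]
      calc ‖∫ x in E, φ x * fderiv ℝ (χ n) x v‖
          ≤ ∫ x in E, ‖φ x * fderiv ℝ (χ n) x v‖ := norm_integral_le_integral_norm _
        _ ≤ ∫ x, ‖φ x * fderiv ℝ (χ n) x v‖ :=
          setIntegral_le_integral (hi2 n).norm (ae_of_all _ fun x => norm_nonneg _)
        _ ≤ ∫ x, (Metric.closedBall p (2 / c n)).indicator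
              (fun _ => M * (c n * (D * ‖v‖))) x := by
          refine integral_mono (hi2 n).norm ?_ hpt
          exact (integrable_indicator_iff measurableSet_closedBall).2
            (integrableOn_const (measure_closedBall_lt_top.ne))
        _ = 16 * M * D * ‖v‖ / c n := by
          rw [integral_indicator measurableSet_closedBall, setIntegral_const, measureReal_def,
            hvol, smul_eq_mul]
          field_simp
          ring
    refine squeeze_zero_norm hbd ?_
    exact Tendsto.div_atTop tendsto_const_nhds hctop
  have hLim : Tendsto (fun n => ∫ x in E, fderiv ℝ (fun z => χ n z * φ z) x v) atTop
      (𝓝 (∫ x in E, fderiv ℝ φ x v)) := by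
    have := hL1.add hL2
    rw [add_zero] at this
    refine this.congr fun n => ?_
    rw [← integral_add (hi1 n).integrableOn (hi2 n).integrableOn]
    exact integral_congr_ae (ae_of_all _ fun x => (hfd n x).symm)
  exact tendsto_nhds_unique hLim (by simpa only [hid] using hR)

/-- Where the indicator of `E` is locally constant, its derivative vanishes. -/
lemma integral_fderiv_eq_zero_of_subset {U : Set (ℝ × ℝ)}
    (h : U ⊆ E ∨ Disjoint U E) {φ : ℝ × ℝ → ℝ} (hφ : IsTest φ) (hs : tsupport φ ⊆ U) (v : ℝ × ℝ) :
    ∫ x in E, fderiv ℝ φ x v = 0 := by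
  rcases h with h | h
  · rw [setIntegral_eq_integral_of_forall_compl_eq_zero, hφ.integral_fderiv]
    intro x hx
    rw [fderiv_of_notMem_tsupport ℝ (fun hx' => hx (h (hs hx')))]
    simp
  · refine setIntegral_eq_zero_of_forall_eq_zero fun x hx => ?_
    rw [fderiv_of_notMem_tsupport ℝ (fun hx' => h.le_bot ⟨hs hx', hx⟩)]
    simp

end EscapeArea

end

/-! ### Green's formula in curvilinear boxes; periodic curves. -/

noncomputable section

namespace EscapeArea

lemma continuous_cross_left (v : ℝ × ℝ) : Continuous (fun a : ℝ × ℝ => cross a v) := by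
  unfold cross; fun_prop

lemma abs_cross_le (a b : ℝ × ℝ) : |cross a b| ≤ 2 * (‖a‖ * ‖b‖) := by
  have h1 : |a.1 * b.2| ≤ ‖a‖ * ‖b‖ := by
    rw [abs_mul]; exact mul_le_mul (norm_fst_le a) (norm_snd_le b) (abs_nonneg _) (norm_nonneg _)
  have h2 : |a.2 * b.1| ≤ ‖a‖ * ‖b‖ := by
    rw [abs_mul]; exact mul_le_mul (norm_snd_le a) (norm_fst_le b) (abs_nonneg _) (norm_nonneg _)
  unfold cross
  linarith [abs_sub (a.1 * b.2) (a.2 * b.1)]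

/-- The linear map `(h, k) ↦ h a + k b`. -/
def frame (a b : ℝ × ℝ) : ℝ × ℝ →L[ℝ] ℝ × ℝ :=
  (ContinuousLinearMap.fst ℝ ℝ ℝ).smulRight a + (ContinuousLinearMap.snd ℝ ℝ ℝ).smulRight b

@[simp] lemma frame_apply (a b x : ℝ × ℝ) : frame a b x = x.1 • a + x.2 • b := by
  simp [frame]

lemma det_frame (a b : ℝ × ℝ) : (frame a b).det = cross a b := by
  rw [ContinuousLinearMap.det, ← LinearMap.det_toMatrix (Module.Basis.finTwoProd ℝ),
    Matrix.det_fin_two]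
  simp [LinearMap.toMatrix_apply, cross]
  ring

/-- Cramer's rule. It splits the Jacobian times a derivative along v into derivatives along the two
coordinate directions of a box, each of which can be integrated exactly. -/
lemma cross_frame_identity (a b v : ℝ × ℝ) :
    cross a b • v = cross v b • a + cross a v • b := by
  ext <;> simp [cross] <;> ring

lemma frame_injective {a b : ℝ × ℝ} (h : cross a b ≠ 0) : Function.Injective (frame a b) := by
  rw [injective_iff_map_eq_zero]
  intro x hx
  rw [frame_apply] at hx
  have h1 := congrArg Prod.fst hx
  have h2 := congrArg Prod.snd hx
  simp only [Prod.fst_add, Prod.smul_fst, smul_eq_mul, Prod.fst_zero, Prod.snd_add, Prod.smul_snd,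
    Prod.snd_zero] at h1 h2
  have e1 : x.1 * cross a b = 0 := by unfold cross; linear_combination b.2 * h1 - b.1 * h2
  have e2 : x.2 * cross a b = 0 := by unfold cross; linear_combination a.1 * h2 - a.2 * h1
  ext
  · simpa [h] using e1
  · simpa [h] using e2

lemma exists_equiv_of_injective {A : ℝ × ℝ →L[ℝ] ℝ × ℝ} (h : Function.Injective A) :
    ∃ e : (ℝ × ℝ) ≃L[ℝ] ℝ × ℝ, (e : ℝ × ℝ →L[ℝ] ℝ × ℝ) = A :=
  ⟨(LinearEquiv.ofInjectiveEndo (A : ℝ × ℝ →ₗ[ℝ] ℝ × ℝ) h).toContinuousLinearEquiv, by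
    ext <;> rfl⟩

lemma continuousAt_deriv {a : ℝ → ℝ × ℝ} {t : ℝ} (h : ContDiffAt ℝ 1 a t) :
    ContinuousAt (deriv a) t := by
  have h1 : ContinuousAt (fderiv ℝ a) t := (h.fderiv_right (m := 0) (by simp)).continuousAt
  have h2 : deriv a = fun t => fderiv ℝ a t 1 := by ext t <;> simp
  rw [h2]
  exact h1.clm_apply continuousAt_const

lemma hasFDerivAt_box {a : ℝ → ℝ × ℝ} (N : ℝ × ℝ) {x : ℝ × ℝ} (h : DifferentiableAt ℝ a x.1) :
    HasFDerivAt (fun y : ℝ × ℝ => a y.1 + y.2 • N) (frame (deriv a x.1) N) x := by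
  have h1 : HasFDerivAt (fun y : ℝ × ℝ => a y.1)
      ((ContinuousLinearMap.fst ℝ ℝ ℝ).smulRight (deriv a x.1)) x := by
    have := h.hasDerivAt.hasFDerivAt.comp x hasFDerivAt_fst
    refine this.congr_fderiv ?_
    ext <;> simp
  have h2 : HasFDerivAt (fun y : ℝ × ℝ => y.2 • N)
      ((ContinuousLinearMap.snd ℝ ℝ ℝ).smulRight N) x :=
    ((ContinuousLinearMap.snd ℝ ℝ ℝ).smulRight N).hasFDerivAt
  exact h1.add h2

/-- The Gauss–Green formula in a curvilinear rectangle bounded by two translates of a `C¹` arc. -/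
lemma integral_image_box {a : ℝ → ℝ × ℝ} {N : ℝ × ℝ} {t₁ t₂ l r : ℝ} (ht : t₁ ≤ t₂) (hlr : l ≤ r)
    (ha : ∀ t ∈ Icc t₁ t₂, ContDiffAt ℝ 1 a t)
    (hN : ∀ t ∈ Icc t₁ t₂, 0 < cross (deriv a t) N)
    (hinj : InjOn (fun y : ℝ × ℝ => a y.1 + y.2 • N) (Ioo t₁ t₂ ×ˢ Ioo l r))
    {φ : ℝ × ℝ → ℝ} (hφ : ContDiff ℝ 1 φ) (v : ℝ × ℝ) :
    ∫ x in (fun y : ℝ × ℝ => a y.1 + y.2 • N) '' (Ioo t₁ t₂ ×ˢ Ioo l r), fderiv ℝ φ x v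
      = (∫ t in t₁..t₂, (φ (a t + r • N) - φ (a t + l • N)) * cross (deriv a t) v)
        + cross v N * ∫ s in l..r, (φ (a t₂ + s • N) - φ (a t₁ + s • N)) := by
  set Φ : ℝ × ℝ → ℝ × ℝ := fun y => a y.1 + y.2 • N with hΦ
  have hac : ContinuousOn a (Icc t₁ t₂) := fun t h => (ha t h).continuousAt.continuousWithinAt
  have hdc : ContinuousOn (deriv a) (Icc t₁ t₂) :=
    fun t h => (continuousAt_deriv (ha t h)).continuousWithinAt
  have hdφ : Continuous (fderiv ℝ φ) := hφ.continuous_fderiv (by simp)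
  have hΦc : ContinuousOn Φ (Icc t₁ t₂ ×ˢ Icc l r) :=
    (hac.comp continuousOn_fst (fun x hx => hx.1)).add (by fun_prop)
  have hd1 : ContinuousOn (fun y : ℝ × ℝ => deriv a y.1) (Icc t₁ t₂ ×ˢ Icc l r) :=
    hdc.comp continuousOn_fst (fun x hx => hx.1)
  have hmeas : MeasurableSet (Ioo t₁ t₂ ×ˢ Ioo l r) := measurableSet_Ioo.prod measurableSet_Ioo
  have hsub : Ioo t₁ t₂ ×ˢ Ioo l r ⊆ Icc t₁ t₂ ×ˢ Icc l r :=
    prod_mono Ioo_subset_Icc_self Ioo_subset_Icc_self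
  rw [integral_image_eq_integral_abs_det_fderiv_smul volume hmeas
    (f' := fun x => frame (deriv a x.1) N) (fun x hx => (hasFDerivAt_box N
      ((ha x.1 (hsub hx).1).differentiableAt (by simp))).hasFDerivWithinAt) hinj]
  set g1 : ℝ × ℝ → ℝ := fun x => fderiv ℝ φ (Φ x) (deriv a x.1) with hg1
  set g2 : ℝ × ℝ → ℝ := fun x => cross (deriv a x.1) v * fderiv ℝ φ (Φ x) N with hg2
  have hc1 : ContinuousOn g1 (Icc t₁ t₂ ×ˢ Icc l r) :=
    (hdφ.comp_continuousOn hΦc).clm_apply hd1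
  have hc2 : ContinuousOn g2 (Icc t₁ t₂ ×ˢ Icc l r) :=
    ((continuous_cross_left v).comp_continuousOn hd1).mul
      ((hdφ.comp_continuousOn hΦc).clm_apply continuousOn_const)
  have hcomp : IsCompact (Icc t₁ t₂ ×ˢ Icc l r) := isCompact_Icc.prod isCompact_Icc
  have hi1 : IntegrableOn g1 (Ioo t₁ t₂ ×ˢ Ioo l r) := (hc1.integrableOn_compact hcomp).mono_set hsub
  have hi2 : IntegrableOn g2 (Ioo t₁ t₂ ×ˢ Ioo l r) := (hc2.integrableOn_compact hcomp).mono_set hsub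
  -- The Jacobian of the box is `cross (deriv a t) N`, positive by assumption; Cramer's rule
  -- separates the derivative across the arc (`g2`) from the one along it (`g1`).
  have hint : ∫ x in Ioo t₁ t₂ ×ˢ Ioo l r, |(frame (deriv a x.1) N).det| • fderiv ℝ φ (Φ x) v
      = (∫ x in Ioo t₁ t₂ ×ˢ Ioo l r, g2 x) + cross v N * ∫ x in Ioo t₁ t₂ ×ˢ Ioo l r, g1 x := by
    rw [← integral_const_mul, ← integral_add hi2 (hi1.const_mul _)]
    refine setIntegral_congr_fun hmeas fun x hx => ?_
    simp only [det_frame, abs_of_pos (hN x.1 (hsub hx).1), hg1, hg2]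
    rw [← map_smul, cross_frame_identity, map_add, map_smul, map_smul, smul_eq_mul, smul_eq_mul]
    ring
  rw [hint]
  congr 1
  · rw [Measure.volume_eq_prod, setIntegral_prod _ hi2, intervalIntegral.integral_of_le ht,
      ← integral_Ioc_eq_integral_Ioo]
    refine setIntegral_congr_fun measurableSet_Ioc fun t htt => ?_
    simp only [hg2]
    rw [integral_const_mul, mul_comm, ← integral_Ioc_eq_integral_Ioo,
      ← intervalIntegral.integral_of_le hlr]
    congr 1
    have hder : ∀ s ∈ uIcc l r, HasDerivAt (fun s => φ (a t + s • N))
        (fderiv ℝ φ (Φ (t, s)) N) s := by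
      intro s _
      have h1 : HasDerivAt (fun s : ℝ => a t + s • N) N s := by
        simpa using ((hasDerivAt_id s).smul_const N).const_add (a t)
      exact ((hφ.differentiable (by simp) (Φ (t, s))).hasFDerivAt).comp_hasDerivAt s h1
    rw [intervalIntegral.integral_eq_sub_of_hasDerivAt hder]
    refine ContinuousOn.intervalIntegrable ?_
    have : Continuous (fun s : ℝ => a t + s • N) := by fun_prop
    exact ((hdφ.comp this).clm_apply continuous_const).continuousOn
  · congr 1
    -- The derivative along the arc has to be integrated in t first, hence the exchange of the two
    -- coordinates.
    rw [Measure.volume_eq_prod, ← setIntegral_prod_swap, setIntegral_prod,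
      intervalIntegral.integral_of_le hlr, ← integral_Ioc_eq_integral_Ioo]
    · refine setIntegral_congr_fun measurableSet_Ioc fun s hs => ?_
      simp only [Prod.swap_prod_mk]
      rw [← integral_Ioc_eq_integral_Ioo, ← intervalIntegral.integral_of_le ht]
      have hder : ∀ t ∈ uIcc t₁ t₂, HasDerivAt (fun t => φ (a t + s • N)) (g1 (t, s)) t := by
        intro t htt
        rw [uIcc_of_le ht] at htt
        have h1 : HasDerivAt (fun t : ℝ => a t + s • N) (deriv a t) t :=
          ((ha t htt).differentiableAt (by simp)).hasDerivAt.add_const _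
        exact ((hφ.differentiable (by simp) (Φ (t, s))).hasFDerivAt).comp_hasDerivAt t h1
      rw [intervalIntegral.integral_eq_sub_of_hasDerivAt hder]
      refine ContinuousOn.intervalIntegrable ?_
      rw [uIcc_of_le ht]
      exact hc1.comp (f := fun t : ℝ => (t, s)) (by fun_prop) fun t htt => ⟨htt, Ioc_subset_Icc_self hs⟩
    · rw [← Measure.volume_eq_prod]
      have h1 : MeasurePreserving (Prod.swap : ℝ × ℝ → ℝ × ℝ) volume volume :=
        Measure.measurePreserving_swap
      have := (h1.integrableOn_comp_preimage (MeasurableEquiv.prodComm.measurableEmbedding)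
        (s := Ioo t₁ t₂ ×ˢ Ioo l r) (f := g1)).2 hi1
      rwa [preimage_swap_prod] at this

lemma exists_abs_sub_le_of_shift {c : ℝ → ℝ} (hc : Continuous c) (hs : ∀ t, c (t + 1) = c t + 1) :
    ∃ D, ∀ t, |c t - t| ≤ D := by
  have hp : Function.Periodic (fun t => c t - t) 1 := fun t => by simp [hs]
  obtain ⟨D, hD⟩ := isCompact_Icc.exists_bound_of_continuousOn (s := Icc (0 : ℝ) 1)
    (hc.sub continuous_id).continuousOn
  refine ⟨D, fun t => ?_⟩
  obtain ⟨s, hs, h⟩ := hp.exists_mem_Ico₀ one_pos t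
  have := hD s (Ico_subset_Icc_self hs)
  rw [Real.norm_eq_abs] at this
  simp only [Pi.sub_apply, id] at this
  rwa [h]

/-- The first coordinate differs from the parameter by a bounded amount, so the curve is proper. -/
lemma isClosedEmbedding_of_shift {a : ℝ → ℝ × ℝ} (hc : Continuous a)
    (hs : ∀ t, a (t + 1) = a t + (1, 0)) (hi : Function.Injective a) : IsClosedEmbedding a := by
  refine IsClosedEmbedding.of_continuous_injective_isClosedMap hc hi ?_
  refine (isProperMap_iff_tendsto_cocompact.2 ⟨hc, ?_⟩).isClosedMap
  obtain ⟨D, hD⟩ := exists_abs_sub_le_of_shift hc.fst (fun t => by simp [hs])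
  rw [← Metric.cobounded_eq_cocompact, ← Metric.cobounded_eq_cocompact,
    ← tendsto_norm_atTop_iff_cobounded]
  refine tendsto_atTop_mono (fun t => ?_)
    (tendsto_atTop_add_const_right _ (-D) tendsto_norm_cobounded_atTop)
  have h1 := hD t
  have h2 := norm_fst_le (a t)
  rw [Real.norm_eq_abs] at *
  have h3 := abs_sub_abs_le_abs_sub t (a t).1
  rw [abs_sub_comm] at h3
  linarith

/-- The lift of an injective closed curve on the cylinder, regular off a discrete set. -/
structure IsPeriodicCurve (a : ℝ → ℝ × ℝ) : Prop where
  cont : Continuous a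
  shift : ∀ t, a (t + 1) = a t + (1, 0)
  inj : Function.Injective a
  reg : ∀ t, ∀ᶠ τ in 𝓝[≠] t, ContDiffAt ℝ 1 a τ ∧ deriv a τ ≠ 0
  bdd : ∃ K, ∀ᵐ t, ‖deriv a t‖ ≤ K

/-- Integration of `φ` against the flux of `v` through the curve `a`, with weight `w`. -/
def lineFlux (a : ℝ → ℝ × ℝ) (w : ℝ → ℝ) (v : ℝ × ℝ) (φ : ℝ × ℝ → ℝ) : ℝ :=
  ∫ t, w t * (φ (a t) * cross (deriv a t) v)

namespace IsPeriodicCurve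

variable {a : ℝ → ℝ × ℝ}

lemma exists_bound_snd (ha : IsPeriodicCurve a) : ∃ B, ∀ t, |(a t).2| ≤ B := by
  have hp : Function.Periodic (fun t => (a t).2) 1 := fun t => by simp [ha.shift]
  obtain ⟨D, hD⟩ := isCompact_Icc.exists_bound_of_continuousOn (s := Icc (0 : ℝ) 1)
    ha.cont.snd.continuousOn
  refine ⟨D, fun t => ?_⟩
  obtain ⟨s, hs, h⟩ := hp.exists_mem_Ico₀ one_pos t
  have := hD s (Ico_subset_Icc_self hs)
  rw [Real.norm_eq_abs] at this
  rwa [h]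

lemma isClosedEmbedding (ha : IsPeriodicCurve a) : IsClosedEmbedding a :=
  isClosedEmbedding_of_shift ha.cont ha.shift ha.inj

/-- As the curve is an embedding, it does not come back near `a t`: localising in the plane
localises the parameter. -/
lemma exists_nhds (ha : IsPeriodicCurve a) (t : ℝ) {W : Set ℝ} (hW : W ∈ 𝓝 t) : ∃ U ∈ 𝓝 (a t), ∀ s, a s ∈ U → s ∈ W := by
  rw [ha.isClosedEmbedding.nhds_eq_comap, mem_comap] at hW
  obtain ⟨U, hU, h⟩ := hW
  exact ⟨U, hU, fun s hs => h hs⟩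

/-- The irregular parameters form a discrete subset of the line, hence a countable one. This is what
the fundamental theorem of calculus with exceptional points needs. -/
lemma countable_irregular (ha : IsPeriodicCurve a) : {t | ¬ (ContDiffAt ℝ 1 a t ∧ deriv a t ≠ 0)}.Countable := by
  set S := {t | ¬ (ContDiffAt ℝ 1 a t ∧ deriv a t ≠ 0)} with hS
  have hd : IsDiscrete S := by
    rw [isDiscrete_iff_nhdsNE]
    intro x _
    rw [← disjoint_iff, disjoint_principal_right]
    filter_upwards [ha.reg x] with t ht h using h ht
  have := hd.to_subtype
  exact countable_coe_iff.1 countable_of_Lindelof_of_discrete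

lemma ae_regular (ha : IsPeriodicCurve a) : ∀ᵐ t, ContDiffAt ℝ 1 a t ∧ deriv a t ≠ 0 := by
  rw [ae_iff]
  exact ha.countable_irregular.measure_zero _

end IsPeriodicCurve
end EscapeArea

end

/-! ### Flux functionals, and the side of a domain at a regular boundary point. -/

noncomputable section

namespace EscapeArea

lemma eventually_pos_of_hasDerivAt {g : ℝ → ℝ} {c : ℝ} (h : HasDerivAt g c 0) (h0 : g 0 = 0)
    (hc : 0 < c) : ∀ᶠ s in 𝓝[>] 0, 0 < g s := by
  have h1 := (hasDerivAt_iff_tendsto_slope.1 h).mono_left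
    (nhdsWithin_mono 0 (s := Ioi 0) (fun x hx => ne_of_gt hx))
  filter_upwards [h1.eventually (lt_mem_nhds hc), self_mem_nhdsWithin] with s hs hs'
  rw [slope_def_field, h0, sub_zero, sub_zero] at hs
  exact (div_pos_iff_of_pos_right hs').1 hs

namespace IsPeriodicCurve

variable {a : ℝ → ℝ × ℝ}

lemma integrable_comp (ha : IsPeriodicCurve a) {φ : ℝ × ℝ → ℝ} (hφ : IsTest φ) : Integrable (fun t => φ (a t)) :=
  (hφ.smooth.continuous.comp ha.cont).integrable_of_hasCompactSupport
    (hφ.compact.comp_isClosedEmbedding ha.isClosedEmbedding)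

lemma aestronglyMeasurable_cross (v : ℝ × ℝ) :
    AEStronglyMeasurable (fun t => cross (deriv a t) v) :=
  (continuous_cross_left v).comp_aestronglyMeasurable (measurable_deriv a).aestronglyMeasurable

lemma ae_abs_cross_le (ha : IsPeriodicCurve a) (v : ℝ × ℝ) : ∃ M, 0 ≤ M ∧ ∀ᵐ t, |cross (deriv a t) v| ≤ M := by
  obtain ⟨K, hK⟩ := ha.bdd
  refine ⟨2 * (max K 0 * ‖v‖), by positivity, ?_⟩
  filter_upwards [hK] with t ht
  refine (abs_cross_le _ _).trans ?_
  gcongr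
  exact ht.trans (le_max_left _ _)

lemma integrable_lineFlux (ha : IsPeriodicCurve a) {w : ℝ → ℝ} (hw : AEStronglyMeasurable w) {C : ℝ}
    (hC : ∀ t, |w t| ≤ C) {φ : ℝ × ℝ → ℝ} (hφ : IsTest φ) (v : ℝ × ℝ) :
    Integrable (fun t => w t * (φ (a t) * cross (deriv a t) v)) := by
  obtain ⟨M, hM0, hM⟩ := ha.ae_abs_cross_le v
  refine ((ha.integrable_comp hφ).abs.mul_const (C * M)).mono'
    (hw.mul ((ha.integrable_comp hφ).aestronglyMeasurable.mul (aestronglyMeasurable_cross v))) ?_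
  filter_upwards [hM] with t ht
  rw [Real.norm_eq_abs, abs_mul, abs_mul]
  calc |w t| * (|φ (a t)| * |cross (deriv a t) v|) ≤ C * (|φ (a t)| * M) := by
        gcongr
        · exact (abs_nonneg _).trans (hC t)
        · exact hC t
    _ = _ := by ring

lemma isBoundaryFunctional (ha : IsPeriodicCurve a) {w : ℝ → ℝ} (hw : AEStronglyMeasurable w) {C : ℝ}
    (hC : ∀ t, |w t| ≤ C) : IsBoundaryFunctional (lineFlux a w) where
  add v φ χ hφ hχ := by
    unfold lineFlux
    rw [← integral_add (ha.integrable_lineFlux hw hC hφ v) (ha.integrable_lineFlux hw hC hχ v)]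
    refine integral_congr_ae (ae_of_all _ fun t => ?_)
    simp only [Pi.add_apply]
    ring
  tendsto v φ hφ p Φ hΦ hle hlim := by
    refine tendsto_integral_of_dominated_convergence
      (fun t => |w t * (φ (a t) * cross (deriv a t) v)|)
      (fun n => (ha.integrable_lineFlux hw hC (hΦ n) v).aestronglyMeasurable)
      (ha.integrable_lineFlux hw hC hφ v).abs (fun n => ae_of_all _ fun t => ?_) ?_
    · rw [Real.norm_eq_abs, abs_mul, abs_mul, abs_mul, abs_mul]
      exact mul_le_mul_of_nonneg_left
        (mul_le_mul_of_nonneg_right (hle n _) (abs_nonneg _)) (abs_nonneg _)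
    -- An injective curve passes through p at most once, so p carries no flux.
    · have hp : ∀ᵐ t, a t ≠ p := by
        rw [ae_iff]
        simp only [not_not]
        have : {t | a t = p}.Subsingleton := fun x hx y hy => ha.inj (hx.trans hy.symm)
        exact this.measure_zero _
      filter_upwards [hp] with t ht
      exact ((hlim _ ht).mul_const _).const_mul _

end IsPeriodicCurve

lemma IsBoundaryFunctional.sub {L L' : ℝ × ℝ → (ℝ × ℝ → ℝ) → ℝ} (h : IsBoundaryFunctional L)
    (h' : IsBoundaryFunctional L') : IsBoundaryFunctional (fun v φ => L v φ - L' v φ) where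
  add v φ χ hφ hχ := by rw [h.add v φ χ hφ hχ, h'.add v φ χ hφ hχ]; ring
  tendsto v φ hφ p Φ h1 h2 h3 := (h.tendsto v φ hφ p Φ h1 h2 h3).sub (h'.tendsto v φ hφ p Φ h1 h2 h3)

/-- `E` and its exterior are open with common boundary the curve `a`. -/
structure IsBoundedBy (E : Set (ℝ × ℝ)) (a : ℝ → ℝ × ℝ) : Prop where
  isOpen : IsOpen E
  isOpen_ext : IsOpen (E ∪ range a)ᶜ
  disjoint : Disjoint E (range a)
  subset_closure : range a ⊆ closure E
  subset_closure_ext : range a ⊆ closure (E ∪ range a)ᶜ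

lemma IsBoundedBy.disjoint_ext {E : Set (ℝ × ℝ)} {a : ℝ → ℝ × ℝ} :
    Disjoint E (E ∪ range a)ᶜ := 
  disjoint_compl_right.mono_left subset_union_left

/-- Curvilinear boxes around regular points of a curve. -/
lemma IsPeriodicCurve.exists_box {a : ℝ → ℝ × ℝ} (ha : IsPeriodicCurve a) {t₀ : ℝ}
    (hreg : ContDiffAt ℝ 1 a t₀) (hne : deriv a t₀ ≠ 0) :
    ∃ N : ℝ × ℝ, ∃ δ > 0,
      (∀ t ∈ Icc (t₀ - δ) (t₀ + δ), ContDiffAt ℝ 1 a t ∧ 0 < cross (deriv a t) N) ∧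
      InjOn (fun y : ℝ × ℝ => a y.1 + y.2 • N) (Icc (t₀ - δ) (t₀ + δ) ×ˢ Icc (-δ) δ) ∧
      (∀ t, ∀ x ∈ Icc (t₀ - δ) (t₀ + δ) ×ˢ Icc (-δ) δ, a t = a x.1 + x.2 • N → x = (t, 0)) ∧
      IsOpen ((fun y : ℝ × ℝ => a y.1 + y.2 • N) '' (Ioo (t₀ - δ) (t₀ + δ) ×ˢ Ioo (-δ) δ)) ∧
      ∀ (q : ℝ → ℝ × ℝ) (w : ℝ × ℝ), HasDerivAt q w 0 → q 0 = a t₀ → 0 < cross (deriv a t₀) w →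
        ∀ᶠ s in 𝓝[>] (0 : ℝ), q s ∈
          (fun y : ℝ × ℝ => a y.1 + y.2 • N) '' (Ioo (t₀ - δ) (t₀ + δ) ×ˢ Ioo 0 δ) := by
  set c := deriv a t₀ with hc
  obtain ⟨N, hcN⟩ : ∃ N, 0 < cross c N := by
    refine ⟨(-c.2, c.1), ?_⟩
    have : c.1 ≠ 0 ∨ c.2 ≠ 0 := by
      by_contra! h
      exact hne (Prod.ext h.1 h.2)
    simp only [cross]
    rcases this with h | h
    · nlinarith [mul_self_pos.2 h, mul_self_nonneg c.2]
    · nlinarith [mul_self_pos.2 h, mul_self_nonneg c.1]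
  set Φ : ℝ × ℝ → ℝ × ℝ := fun y => a y.1 + y.2 • N with hΦ
  obtain ⟨e, he⟩ := exists_equiv_of_injective (frame_injective hcN.ne')
  have hΦ0 : Φ (t₀, 0) = a t₀ := by simp [hΦ]
  have hst : HasStrictFDerivAt Φ (e : ℝ × ℝ →L[ℝ] ℝ × ℝ) (t₀, 0) := by
    have h1 : ContDiffAt ℝ 1 Φ (t₀, 0) := by
      have : ContDiffAt ℝ 1 (fun y : ℝ × ℝ => a y.1) (t₀, 0) :=
        ContDiffAt.comp (g := a) (t₀, (0 : ℝ)) hreg contDiffAt_fst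
      exact this.add (by fun_prop)
    have h2 : HasFDerivAt Φ (frame c N) (t₀, 0) :=
      hasFDerivAt_box (x := (t₀, 0)) N (hreg.differentiableAt (by simp))
    rw [he]
    exact h1.hasStrictFDerivAt' h2 (by simp)
  set o := hst.toOpenPartialHomeomorph Φ with ho
  have hoc : ⇑o = Φ := hst.toOpenPartialHomeomorph_coe
  have hsrc : (t₀, (0 : ℝ)) ∈ o.source := hst.mem_toOpenPartialHomeomorph_source
  have hdc : ContinuousAt (deriv a) t₀ := continuousAt_deriv hreg
  have hgood : ∀ᶠ t in 𝓝 t₀, ContDiffAt ℝ 1 a t ∧ 0 < cross (deriv a t) N :=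
    (hreg.eventually (by simp)).and
      (((continuous_cross_left N).continuousAt.comp hdc).eventually (lt_mem_nhds hcN))
  obtain ⟨δ₁, hδ₁, hb₁⟩ := Metric.nhds_basis_closedBall.mem_iff.1 (o.open_source.mem_nhds hsrc)
  obtain ⟨U₀, hU₀, hloc⟩ := ha.exists_nhds t₀ (Metric.closedBall_mem_nhds t₀ hδ₁)
  have hΦat : ContinuousAt Φ (t₀, 0) := hst.continuousAt
  have hpre : Φ ⁻¹' U₀ ∈ 𝓝 (t₀, (0 : ℝ)) := hΦat (by rwa [hΦ0])
  obtain ⟨δ₂, hδ₂, hb₂⟩ := Metric.nhds_basis_closedBall.mem_iff.1 hpre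
  obtain ⟨δ₃, hδ₃, hb₃⟩ := Metric.nhds_basis_closedBall.mem_iff.1 hgood
  -- The three radii ensure, in turn, that the box is injectively parametrised, that a curve point
  -- in the box has its parameter in the same chart, and that the arc is C¹ and transverse to N.
  set δ := min δ₁ (min δ₂ δ₃) with hδdef
  have hδ : 0 < δ := by positivity
  have hbox : Icc (t₀ - δ) (t₀ + δ) ×ˢ Icc (-δ) δ = Metric.closedBall (t₀, (0 : ℝ)) δ := by
    rw [← closedBall_prod_same, Real.closedBall_eq_Icc, Real.closedBall_eq_Icc, zero_sub, zero_add]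
  have hobox : Ioo (t₀ - δ) (t₀ + δ) ×ˢ Ioo (-δ) δ = Metric.ball (t₀, (0 : ℝ)) δ := by
    rw [← ball_prod_same, Real.ball_eq_Ioo, Real.ball_eq_Ioo, zero_sub, zero_add]
  have hsub1 : Metric.closedBall (t₀, (0 : ℝ)) δ ⊆ o.source :=
    (Metric.closedBall_subset_closedBall (min_le_left _ _)).trans hb₁
  have hinjs : InjOn Φ o.source := hoc ▸ o.injOn
  refine ⟨N, δ, hδ, ?_, ?_, ?_, ?_, ?_⟩
  · intro t ht
    rw [← Real.closedBall_eq_Icc] at ht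
    exact hb₃ (Metric.closedBall_subset_closedBall
      ((min_le_right _ _).trans (min_le_right _ _)) ht)
  · rw [hbox]
    exact hinjs.mono hsub1
  · intro t x hx htx
    rw [hbox] at hx
    have h1 : a t ∈ U₀ := by
      rw [htx]
      exact hb₂ (Metric.closedBall_subset_closedBall
        ((min_le_right _ _).trans (min_le_left _ _)) hx)
    have h2 : (t, (0 : ℝ)) ∈ o.source := by
      apply hb₁
      rw [← closedBall_prod_same]
      exact ⟨hloc t h1, Metric.mem_closedBall_self hδ₁.le⟩
    refine hinjs (hsub1 hx) h2 ?_
    simp [hΦ, htx]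
  · rw [hobox]
    have := o.isOpen_image_of_subset_source Metric.isOpen_ball
      (Metric.ball_subset_closedBall.trans hsub1)
    rwa [hoc] at this
  · intro q w hq hq0 hw
    set Ψ := hst.localInverse Φ e (t₀, 0) with hΨ
    have hΨd : HasStrictFDerivAt Ψ (e.symm : ℝ × ℝ →L[ℝ] ℝ × ℝ) (a t₀) := by
      have := hst.to_localInverse
      rwa [hΦ0] at this
    have hΨ0 : Ψ (a t₀) = (t₀, 0) := by
      have := hst.localInverse_apply_image
      rwa [hΦ0] at this
    have hright : ∀ᶠ y in 𝓝 (a t₀), Φ (Ψ y) = y := by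
      have := hst.eventually_right_inverse
      rwa [hΦ0] at this
    have hqd : HasDerivAt (fun s => Ψ (q s)) (e.symm w) 0 := by
      have h1 : HasFDerivAt Ψ (e.symm : ℝ × ℝ →L[ℝ] ℝ × ℝ) (q 0) := by
        rw [hq0]; exact hΨd.hasFDerivAt
      exact h1.comp_hasDerivAt (0 : ℝ) hq
    have hpos : 0 < (e.symm w).2 := by
      have h1 : (e.symm w).1 • c + (e.symm w).2 • N = w := by
        have h2 : frame c N (e.symm w) = w := by
          rw [← he]; simp
        rwa [frame_apply] at h2
      have h3 : cross c w = (e.symm w).2 * cross c N := by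
        conv_lhs => rw [← h1]
        simp [cross]
        ring
      rw [h3] at hw
      exact (pos_iff_pos_of_mul_pos hw).2 hcN
    have h2 : ∀ᶠ s in 𝓝[>] (0 : ℝ), 0 < (Ψ (q s)).2 := by
      refine eventually_pos_of_hasDerivAt (g := fun s => (Ψ (q s)).2) ?_ ?_ hpos
      · exact hqd.snd
      · simp [hq0, hΨ0]
    have hqc : Tendsto q (𝓝[>] 0) (𝓝 (a t₀)) := by
      have := hq.continuousAt.tendsto
      rw [hq0] at this
      exact this.mono_left nhdsWithin_le_nhds
    have h3 : ∀ᶠ s in 𝓝[>] (0 : ℝ), Ψ (q s) ∈ Metric.ball (t₀, (0 : ℝ)) δ := by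
      have : Tendsto (fun s => Ψ (q s)) (𝓝[>] 0) (𝓝 (t₀, 0)) := by
        have h4 := hΨd.continuousAt.tendsto.comp hqc
        rwa [hΨ0] at h4
      exact this (Metric.ball_mem_nhds _ hδ)
    filter_upwards [h2, h3, hqc.eventually hright] with s h2 h3 h4
    rw [← hobox] at h3
    exact ⟨Ψ (q s), ⟨h3.1, h2, h3.2.2⟩, h4⟩

/-- At a regular point of its boundary curve, a domain lies on exactly one side. -/
lemma IsBoundedBy.regular_side {E : Set (ℝ × ℝ)} {a : ℝ → ℝ × ℝ} (hE : IsBoundedBy E a)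
    (ha : IsPeriodicCurve a) {t₀ : ℝ} (hreg : ContDiffAt ℝ 1 a t₀) (hne : deriv a t₀ ≠ 0) :
    (GaussGreenAt E (lineFlux a fun _ => 1) (a t₀) ∧
      ∀ (q : ℝ → ℝ × ℝ) (w : ℝ × ℝ), HasDerivAt q w 0 → q 0 = a t₀ → 0 < cross (deriv a t₀) w →
        ∀ᶠ s in 𝓝[>] (0 : ℝ), q s ∉ E) ∨
    (GaussGreenAt E (lineFlux a fun _ => -1) (a t₀) ∧
      ∀ (q : ℝ → ℝ × ℝ) (w : ℝ × ℝ), HasDerivAt q w 0 → q 0 = a t₀ → 0 < cross (deriv a t₀) w →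
        ∀ᶠ s in 𝓝[>] (0 : ℝ), q s ∈ E) := by
  obtain ⟨N, δ, hδ, hgood, hinj, hcurve, hopen, hpath⟩ := ha.exists_box hreg hne
  set Φ : ℝ × ℝ → ℝ × ℝ := fun y => a y.1 + y.2 • N with hΦ
  set I := Ioo (t₀ - δ) (t₀ + δ) with hI
  have hIc : I ⊆ Icc (t₀ - δ) (t₀ + δ) := Ioo_subset_Icc_self
  have hsubP : I ×ˢ Ioo 0 δ ⊆ Icc (t₀ - δ) (t₀ + δ) ×ˢ Icc (-δ) δ :=
    prod_mono hIc (fun s hs => ⟨by linarith [hs.1], hs.2.le⟩)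
  have hsubM : I ×ˢ Ioo (-δ) 0 ⊆ Icc (t₀ - δ) (t₀ + δ) ×ˢ Icc (-δ) δ :=
    prod_mono hIc (fun s hs => ⟨hs.1.le, by linarith [hs.2]⟩)
  have hΦc : ContinuousOn Φ (Icc (t₀ - δ) (t₀ + δ) ×ˢ Icc (-δ) δ) := by
    have : Continuous Φ := (ha.cont.comp continuous_fst).add (by fun_prop)
    exact this.continuousOn
  -- A half of the box is connected and misses the curve, so it lies in E or in the exterior of E.
  have hhalf : ∀ B : Set ℝ, B.OrdConnected → B ⊆ Icc (-δ) δ → (0 : ℝ) ∉ B →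
      Φ '' (I ×ˢ B) ⊆ E ∨ Φ '' (I ×ˢ B) ⊆ (E ∪ range a)ᶜ := by
    intro B hB hBs hB0
    have hsub : I ×ˢ B ⊆ Icc (t₀ - δ) (t₀ + δ) ×ˢ Icc (-δ) δ := prod_mono hIc hBs
    refine IsPreconnected.subset_or_subset hE.isOpen hE.isOpen_ext IsBoundedBy.disjoint_ext ?_
      ((isPreconnected_Ioo.prod hB.isPreconnected).image _ (hΦc.mono hsub))
    rintro _ ⟨x, hx, rfl⟩
    by_cases h : Φ x ∈ E
    · exact Or.inl h
    · refine Or.inr fun h' => ?_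
      rcases h' with h' | ⟨t, ht⟩
      · exact h h'
      · have := hcurve t x (hsub hx) ht
        rw [this] at hx
        exact hB0 hx.2
  have hP := hhalf (Ioo 0 δ) ordConnected_Ioo (fun s hs => ⟨by linarith [hs.1], hs.2.le⟩) (by simp)
  have hM := hhalf (Ioo (-δ) 0) ordConnected_Ioo (fun s hs => ⟨hs.1.le, by linarith [hs.2]⟩)
    (by simp)
  have hmem0 : a t₀ ∈ Φ '' (I ×ˢ Ioo (-δ) δ) :=
    ⟨(t₀, 0), ⟨⟨by linarith, by linarith⟩, ⟨by linarith, by linarith⟩⟩, by simp [hΦ]⟩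
  have hsplit : ∀ y ∈ Φ '' (I ×ˢ Ioo (-δ) δ), y ∉ range a →
      y ∈ Φ '' (I ×ˢ Ioo (-δ) 0) ∨ y ∈ Φ '' (I ×ˢ Ioo 0 δ) := by
    rintro _ ⟨x, hx, rfl⟩ hr
    rcases lt_trichotomy x.2 0 with h | h | h
    · exact Or.inl ⟨x, ⟨hx.1, hx.2.1, h⟩, rfl⟩
    · exact absurd ⟨x.1, by simp [hΦ, h]⟩ hr
    · exact Or.inr ⟨x, ⟨hx.1, h, hx.2.2⟩, rfl⟩
  -- The curve is in the closure of E and of its exterior, so the box contains points of both; the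
  -- two halves therefore cannot lie on the same side.
  obtain ⟨y₁, hy₁, hy₁E⟩ := mem_closure_iff_nhds.1 (hE.subset_closure ⟨t₀, rfl⟩) _ (hopen.mem_nhds hmem0)
  obtain ⟨y₂, hy₂, hy₂E⟩ :=
    mem_closure_iff_nhds.1 (hE.subset_closure_ext ⟨t₀, rfl⟩) _ (hopen.mem_nhds hmem0)
  have hs₁ := hsplit y₁ hy₁ (fun h => hE.disjoint.le_bot ⟨hy₁E, h⟩)
  have hs₂ := hsplit y₂ hy₂ (fun h => hy₂E (Or.inr h))
  have hdis : ∀ {y}, y ∈ E → y ∈ (E ∪ range a)ᶜ → False := fun h1 h2 => h2 (Or.inl h1)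
  -- vanishing of test functions on the boundary of the box
  have hvan : ∀ φ : ℝ × ℝ → ℝ, tsupport φ ⊆ Φ '' (I ×ˢ Ioo (-δ) δ) →
      ∀ x ∈ Icc (t₀ - δ) (t₀ + δ) ×ˢ Icc (-δ) δ, x ∉ I ×ˢ Ioo (-δ) δ → φ (Φ x) = 0 := by
    intro φ hs x hx hx'
    apply image_eq_zero_of_notMem_tsupport
    intro h
    obtain ⟨x', hx1, hx2⟩ := hs h
    have := hinj (prod_mono hIc Ioo_subset_Icc_self hx1) hx hx2
    exact hx' (this ▸ hx1)
  have hline : ∀ φ : ℝ × ℝ → ℝ, tsupport φ ⊆ Φ '' (I ×ˢ Ioo (-δ) δ) → ∀ v,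
      ∫ t in (t₀ - δ)..(t₀ + δ), φ (a t) * cross (deriv a t) v
        = ∫ t, φ (a t) * cross (deriv a t) v := by
    intro φ hs v
    rw [intervalIntegral.integral_of_le (by linarith), integral_Ioc_eq_integral_Ioo]
    refine setIntegral_eq_integral_of_forall_compl_eq_zero fun t ht => ?_
    suffices h : a t ∉ tsupport φ by rw [image_eq_zero_of_notMem_tsupport h, zero_mul]
    intro h
    obtain ⟨x, hx, hxt⟩ := hs h
    have := hcurve t x (prod_mono hIc Ioo_subset_Icc_self hx) hxt.symm
    rw [this] at hx
    exact ht hx.1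
  have hside : ∀ φ : ℝ × ℝ → ℝ, tsupport φ ⊆ Φ '' (I ×ˢ Ioo (-δ) δ) →
      ∫ s in (0 : ℝ)..δ, (φ (a (t₀ + δ) + s • N) - φ (a (t₀ - δ) + s • N)) = 0 ∧
      ∫ s in (-δ)..(0 : ℝ), (φ (a (t₀ + δ) + s • N) - φ (a (t₀ - δ) + s • N)) = 0 := by
    intro φ hs
    have h : ∀ s ∈ Icc (-δ) δ, φ (a (t₀ + δ) + s • N) - φ (a (t₀ - δ) + s • N) = 0 := by
      intro s hss
      have h1 := hvan φ hs (t₀ + δ, s) ⟨⟨by linarith, le_rfl⟩, hss⟩ (fun h => lt_irrefl _ h.1.2)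
      have h2 := hvan φ hs (t₀ - δ, s) ⟨⟨le_rfl, by linarith⟩, hss⟩ (fun h => lt_irrefl _ h.1.1)
      simp only [hΦ] at h1 h2
      rw [h1, h2, sub_zero]
    constructor
    · refine intervalIntegral.integral_zero_ae (ae_of_all _ fun s hss => h s ?_)
      rw [uIoc_of_le hδ.le] at hss
      exact ⟨by linarith [hss.1], hss.2⟩
    · refine intervalIntegral.integral_zero_ae (ae_of_all _ fun s hss => h s ?_)
      rw [uIoc_of_le (by linarith)] at hss
      exact ⟨hss.1.le, by linarith [hss.2]⟩
  -- The arc is the edge s = 0 of the lower half box, and the test function vanishes on the other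
  -- three edges. For the upper half the arc is the opposite edge, which reverses the sign.
  have hlower : ∀ v, ∀ φ : ℝ × ℝ → ℝ, IsTest φ → tsupport φ ⊆ Φ '' (I ×ˢ Ioo (-δ) δ) →
      ∫ x in Φ '' (I ×ˢ Ioo (-δ) 0), fderiv ℝ φ x v = ∫ t, φ (a t) * cross (deriv a t) v := by
    intro v φ hφ hs
    rw [integral_image_box (by linarith) (by linarith) (fun t ht => (hgood t ht).1)
      (fun t ht => (hgood t ht).2) (hinj.mono hsubM) (hφ.smooth.of_le (by simp)),
      (hside φ hs).2, mul_zero, add_zero, ← hline φ hs]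
    refine intervalIntegral.integral_congr fun t ht => ?_
    rw [uIcc_of_le (by linarith)] at ht
    have h1 := hvan φ hs (t, -δ) ⟨ht, ⟨le_rfl, by linarith⟩⟩ (fun h => lt_irrefl _ h.2.1)
    simp only [hΦ] at h1
    simp [h1, -neg_smul]
  have hupper : ∀ v, ∀ φ : ℝ × ℝ → ℝ, IsTest φ → tsupport φ ⊆ Φ '' (I ×ˢ Ioo (-δ) δ) →
      ∫ x in Φ '' (I ×ˢ Ioo 0 δ), fderiv ℝ φ x v = - ∫ t, φ (a t) * cross (deriv a t) v := by
    intro v φ hφ hs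
    rw [integral_image_box (by linarith) (by linarith) (fun t ht => (hgood t ht).1)
      (fun t ht => (hgood t ht).2) (hinj.mono hsubP) (hφ.smooth.of_le (by simp)),
      (hside φ hs).1, mul_zero, add_zero, ← hline φ hs, ← intervalIntegral.integral_neg]
    refine intervalIntegral.integral_congr fun t ht => ?_
    rw [uIcc_of_le (by linarith)] at ht
    have h1 := hvan φ hs (t, δ) ⟨ht, ⟨by linarith, le_rfl⟩⟩ (fun h => lt_irrefl _ h.2.2)
    simp only [hΦ] at h1
    simp [h1]
  have hrestrict : ∀ H : Set (ℝ × ℝ), H ⊆ E → E ∩ Φ '' (I ×ˢ Ioo (-δ) δ) ⊆ H → MeasurableSet H →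
      ∀ v, ∀ φ : ℝ × ℝ → ℝ, tsupport φ ⊆ Φ '' (I ×ˢ Ioo (-δ) δ) →
      ∫ x in E, fderiv ℝ φ x v = ∫ x in H, fderiv ℝ φ x v := by
    intro H hHE hEH hHm v φ hs
    refine (setIntegral_eq_of_subset_of_forall_sdiff_eq_zero hE.isOpen.measurableSet hHE
      fun x hx => ?_)
    rw [fderiv_of_notMem_tsupport ℝ (fun h => hx.2 (hEH ⟨hx.1, hs h⟩))]
    simp
  have hopenhalf : ∀ B : Set ℝ, IsOpen B → B ⊆ Ioo (-δ) δ → MeasurableSet (Φ '' (I ×ˢ B)) := by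
    intro B hB hBs
    refine (isOpen_Ioo.prod hB).measurableSet.image_of_continuousOn_injOn
      (hΦc.mono (prod_mono hIc (hBs.trans Ioo_subset_Icc_self)))
      (hinj.mono (prod_mono hIc (hBs.trans Ioo_subset_Icc_self)))
  have hmM := hopenhalf (Ioo (-δ) 0) isOpen_Ioo (Ioo_subset_Ioo_right hδ.le)
  have hmP := hopenhalf (Ioo 0 δ) isOpen_Ioo (Ioo_subset_Ioo_left (by linarith))
  have hnotin : ∀ {A B : Set (ℝ × ℝ)}, A ⊆ (E ∪ range a)ᶜ →
      (∀ y ∈ Φ '' (I ×ˢ Ioo (-δ) δ), y ∉ range a → y ∈ B ∨ y ∈ A) →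
      E ∩ Φ '' (I ×ˢ Ioo (-δ) δ) ⊆ B := by
    intro A B hA h y hy
    rcases h y hy.2 (fun hr => hE.disjoint.le_bot ⟨hy.1, hr⟩) with h1 | h1
    · exact h1
    · exact (hdis hy.1 (hA h1)).elim
  by_cases hPE : Φ '' (I ×ˢ Ioo 0 δ) ⊆ E
  · right
    have hME : Φ '' (I ×ˢ Ioo (-δ) 0) ⊆ (E ∪ range a)ᶜ := by
      rcases hM with hM | hM
      · rcases hs₂ with h | h
        · exact (hdis (hM h) hy₂E).elim
        · exact (hdis (hPE h) hy₂E).elim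
      · exact hM
    refine ⟨⟨_, hopen.mem_nhds hmem0, fun φ hφ hs v => ?_⟩, fun q w hq hq0 hw => ?_⟩
    · rw [hrestrict _ hPE (hnotin hME fun y h1 h2 => (hsplit y h1 h2).symm) hmP v φ hs,
        hupper v φ hφ hs]
      simp [lineFlux, integral_neg]
    · filter_upwards [hpath q w hq hq0 hw] with s hs using hPE hs
  · left
    have hPE : Φ '' (I ×ˢ Ioo 0 δ) ⊆ (E ∪ range a)ᶜ := hP.resolve_left hPE
    have hME : Φ '' (I ×ˢ Ioo (-δ) 0) ⊆ E := by
      rcases hM with hM | hM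
      · exact hM
      · rcases hs₁ with h | h
        · exact (hdis hy₁E (hM h)).elim
        · exact (hdis hy₁E (hPE h)).elim
    refine ⟨⟨_, hopen.mem_nhds hmem0, fun φ hφ hs v => ?_⟩, fun q w hq hq0 hw => ?_⟩
    · rw [hrestrict _ hME (hnotin hPE fun y h1 h2 => hsplit y h1 h2) hmM v φ hs,
        hlower v φ hφ hs]
      simp [lineFlux]
    · filter_upwards [hpath q w hq hq0 hw] with s hs using fun h => hdis h (hPE hs)

end EscapeArea

end

/-! ### Constancy of the side along the whole boundary curve. -/

noncomputable section

namespace EscapeArea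

lemma fderiv_apply_eq_cross {χ : ℝ × ℝ → ℝ} (z w : ℝ × ℝ) :
    fderiv ℝ χ z w = fderiv ℝ χ z (1, 0) * cross w (0, 1)
      - fderiv ℝ χ z (0, 1) * cross w (1, 0) := by
  have : w = w.1 • (1, 0) + w.2 • (0, 1) := by ext <;> simp
  conv_lhs => rw [this, map_add, map_smul, map_smul, smul_eq_mul, smul_eq_mul]
  simp [cross]
  ring

/-- The symmetry of second derivatives, as a compatibility condition on `L`. -/
lemma curl_eq_of_gaussGreen {E : Set (ℝ × ℝ)} {L : ℝ × ℝ → (ℝ × ℝ → ℝ) → ℝ} {U : Set (ℝ × ℝ)}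
    (h : ∀ φ, IsTest φ → tsupport φ ⊆ U → ∀ v, ∫ x in E, fderiv ℝ φ x v = L v φ)
    {χ : ℝ × ℝ → ℝ} (hχ : IsTest χ) (hs : tsupport χ ⊆ U) :
    L (0, 1) (fun z => fderiv ℝ χ z (1, 0)) = L (1, 0) (fun z => fderiv ℝ χ z (0, 1)) := by
  rw [← h _ (hχ.fderiv_apply _) ((tsupport_fderiv_apply_subset ℝ _).trans hs),
    ← h _ (hχ.fderiv_apply _) ((tsupport_fderiv_apply_subset ℝ _).trans hs)]
  refine integral_congr_ae (ae_of_all _ fun x => ?_)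
  have hd : DifferentiableAt ℝ (fderiv ℝ χ) x :=
    (hχ.smooth.fderiv_right (m := ∞) (by simp)).differentiable (by simp) x
  have hsymm := ((contDiff_infty.1 hχ.smooth 2).contDiffAt (x := x)).isSymmSndFDerivAt
    (by simp)
  have e : ∀ u w : ℝ × ℝ, fderiv ℝ (fun z => fderiv ℝ χ z u) x w = fderiv ℝ (fderiv ℝ χ) x w u := by
    intro u w
    rw [fderiv_clm_apply hd (differentiableAt_const u)]
    simp
  simp only [e]
  exact hsymm _ _

/-- Weights that agree where the curve meets `U` give the same flux for functions
supported in `U`. -/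
lemma lineFlux_congr {a : ℝ → ℝ × ℝ} {w w' : ℝ → ℝ} {U : Set (ℝ × ℝ)}
    (h : ∀ t, a t ∈ U → w t = w' t) {φ : ℝ × ℝ → ℝ} (hs : tsupport φ ⊆ U) (v : ℝ × ℝ) :
    lineFlux a w v φ = lineFlux a w' v φ := by
  refine integral_congr_ae (ae_of_all _ fun t => ?_)
  by_cases ht : a t ∈ U
  · simp only [h t ht]
  · simp [image_eq_zero_of_notMem_tsupport (fun h => ht (hs h))]

lemma lineFlux_zero (a : ℝ → ℝ × ℝ) (v : ℝ × ℝ) (φ : ℝ × ℝ → ℝ) :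
    lineFlux a (fun _ => 0) v φ = 0 := by simp [lineFlux]

lemma GaussGreenAt.congr_weight {E : Set (ℝ × ℝ)} {a : ℝ → ℝ × ℝ} {w w' : ℝ → ℝ} {z : ℝ × ℝ}
    (h : GaussGreenAt E (lineFlux a w) z) {V : Set (ℝ × ℝ)} (hV : V ∈ 𝓝 z)
    (hw : ∀ t, a t ∈ V → w t = w' t) : GaussGreenAt E (lineFlux a w') z := by
  obtain ⟨U, hU, h⟩ := h
  refine ⟨U ∩ V, inter_mem hU hV, fun φ hφ hs v => ?_⟩
  rw [h φ hφ (hs.trans inter_subset_left), lineFlux_congr hw (hs.trans inter_subset_right)]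

/-- Off the curve the indicator is locally constant and nearby test functions do not see the curve,
so both sides vanish whatever the weight. -/
lemma IsBoundedBy.gaussGreenAt_of_notMem {E : Set (ℝ × ℝ)} {a : ℝ → ℝ × ℝ} (hE : IsBoundedBy E a)
    (w : ℝ → ℝ) {z : ℝ × ℝ} (hz : z ∉ range a) : GaussGreenAt E (lineFlux a w) z := by
  have key : ∀ U ∈ 𝓝 z, (U ⊆ E ∨ Disjoint U E) → (∀ t, a t ∉ U) →
      GaussGreenAt E (lineFlux a w) z := by
    intro U hU h h'
    refine ⟨U, hU, fun φ hφ hs v => ?_⟩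
    rw [integral_fderiv_eq_zero_of_subset h hφ hs,
      lineFlux_congr (w' := fun _ => 0) (fun t ht => (h' t ht).elim) hs, lineFlux_zero]
  by_cases h : z ∈ E
  · exact key E (hE.isOpen.mem_nhds h) (Or.inl subset_rfl)
      (fun t ht => hE.disjoint.le_bot ⟨ht, t, rfl⟩)
  · exact key _ (hE.isOpen_ext.mem_nhds (fun h' => h'.elim h hz))
      (Or.inr IsBoundedBy.disjoint_ext.symm) (fun t ht => ht (Or.inr ⟨t, rfl⟩))

lemma exists_test_bump {z : ℝ × ℝ} {U : Set (ℝ × ℝ)} (hU : U ∈ 𝓝 z) :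
    ∃ χ, IsTest χ ∧ tsupport χ ⊆ U ∧ χ z = 1 ∧ ∀ x, 0 ≤ χ x := by
  obtain ⟨χ, h1, h2, h3, h4, h5⟩ := exists_contDiff_tsupport_subset (n := ⊤) hU
  exact ⟨χ, ⟨h3, h2⟩, h1, h5, fun x => (h4 ⟨x, rfl⟩).1⟩

namespace IsPeriodicCurve

variable {a : ℝ → ℝ × ℝ}

lemma integrable_fderiv_deriv (ha : IsPeriodicCurve a) {χ : ℝ × ℝ → ℝ} (hχ : IsTest χ) :
    Integrable (fun t => fderiv ℝ χ (a t) (deriv a t)) := by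
  have h1 := ha.integrable_lineFlux (w := fun _ => 1) aestronglyMeasurable_const (C := 1) (by simp)
    (hχ.fderiv_apply (1, 0)) (0, 1)
  have h2 := ha.integrable_lineFlux (w := fun _ => 1) aestronglyMeasurable_const (C := 1) (by simp)
    (hχ.fderiv_apply (0, 1)) (1, 0)
  refine (h1.sub h2).congr (ae_of_all _ fun t => ?_)
  simp only [Pi.sub_apply, one_mul]
  exact (fderiv_apply_eq_cross _ _).symm

/-- The curl of a weighted flux is the integral of w against d(χ ∘ a), which detects the jumps of w.
For the boundary of a set it must be zero. -/
lemma curl_lineFlux (ha : IsPeriodicCurve a) {w : ℝ → ℝ} (hw : AEStronglyMeasurable w) {C : ℝ}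
    (hC : ∀ t, |w t| ≤ C) {χ : ℝ × ℝ → ℝ} (hχ : IsTest χ) :
    lineFlux a w (0, 1) (fun z => fderiv ℝ χ z (1, 0))
      - lineFlux a w (1, 0) (fun z => fderiv ℝ χ z (0, 1))
      = ∫ t, w t * fderiv ℝ χ (a t) (deriv a t) := by
  unfold lineFlux
  rw [← integral_sub (ha.integrable_lineFlux hw hC (hχ.fderiv_apply _) _)
    (ha.integrable_lineFlux hw hC (hχ.fderiv_apply _) _)]
  refine integral_congr_ae (ae_of_all _ fun t => ?_)
  simp only
  rw [fderiv_apply_eq_cross (a t) (deriv a t)]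
  ring

lemma integral_fderiv_deriv (ha : IsPeriodicCurve a) {χ : ℝ × ℝ → ℝ} (hχ : IsTest χ) (x y : ℝ) :
    ∫ t in x..y, fderiv ℝ χ (a t) (deriv a t) = χ (a y) - χ (a x) := by
  refine integral_eq_of_hasDerivAt_off_countable (fun t => χ (a t)) _ ha.countable_irregular
    (hχ.smooth.continuous.comp ha.cont).continuousOn (fun t ht => ?_)
    (ha.integrable_fderiv_deriv hχ).intervalIntegrable
  have ht' : ContDiffAt ℝ 1 a t ∧ deriv a t ≠ 0 := not_not.1 ht.2
  exact (hχ.differentiable _).hasFDerivAt.comp_hasDerivAt t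
    (ht'.1.differentiableAt (by simp)).hasDerivAt

/-- The boundary of a weighted arc, tested near the parameter `b`. -/
lemma exists_nhds_integral_eq_jump (ha : IsPeriodicCurve a) {w : ℝ → ℝ} {b w₁ w₂ : ℝ}
    (h₁ : ∀ᶠ t in 𝓝[<] b, w t = w₁) (h₂ : ∀ᶠ t in 𝓝[>] b, w t = w₂) :
    ∃ U ∈ 𝓝 (a b), ∀ χ, IsTest χ → tsupport χ ⊆ U →
      ∫ t, w t * fderiv ℝ χ (a t) (deriv a t) = (w₁ - w₂) * χ (a b) := by
  obtain ⟨l, hl, hl'⟩ := mem_nhdsLT_iff_exists_Ioo_subset.1 h₁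
  obtain ⟨r, hr, hr'⟩ := mem_nhdsGT_iff_exists_Ioo_subset.1 h₂
  rw [mem_Iio] at hl
  rw [mem_Ioi] at hr
  obtain ⟨U, hU, hloc⟩ := ha.exists_nhds b (Ioo_mem_nhds hl hr)
  refine ⟨U, hU, fun χ hχ hs => ?_⟩
  have hz : ∀ t, t ∉ Ioo l r → fderiv ℝ χ (a t) (deriv a t) = 0 ∧ χ (a t) = 0 := by
    intro t ht
    have h : a t ∉ tsupport χ := fun h => ht (hloc t (hs h))
    exact ⟨by rw [fderiv_of_notMem_tsupport ℝ h]; simp, image_eq_zero_of_notMem_tsupport h⟩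
  have hi := ha.integrable_fderiv_deriv hχ
  have e1 : ∫ t in l..b, w t * fderiv ℝ χ (a t) (deriv a t) = w₁ * χ (a b) := by
    have : ∫ t in l..b, w t * fderiv ℝ χ (a t) (deriv a t)
        = ∫ t in l..b, w₁ * fderiv ℝ χ (a t) (deriv a t) := by
      rw [intervalIntegral.integral_of_le hl.le, intervalIntegral.integral_of_le hl.le,
        integral_Ioc_eq_integral_Ioo, integral_Ioc_eq_integral_Ioo]
      refine setIntegral_congr_fun measurableSet_Ioo fun t ht => ?_
      have : w t = w₁ := hl' ht
      simp only [this]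
    rw [this, intervalIntegral.integral_const_mul, ha.integral_fderiv_deriv hχ,
      (hz l (fun h => lt_irrefl _ h.1)).2, sub_zero]
  have e2 : ∫ t in b..r, w t * fderiv ℝ χ (a t) (deriv a t) = - (w₂ * χ (a b)) := by
    have : ∫ t in b..r, w t * fderiv ℝ χ (a t) (deriv a t)
        = ∫ t in b..r, w₂ * fderiv ℝ χ (a t) (deriv a t) := by
      rw [intervalIntegral.integral_of_le hr.le, intervalIntegral.integral_of_le hr.le,
        integral_Ioc_eq_integral_Ioo, integral_Ioc_eq_integral_Ioo]
      refine setIntegral_congr_fun measurableSet_Ioo fun t ht => ?_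
      have : w t = w₂ := hr' ht
      simp only [this]
    rw [this, intervalIntegral.integral_const_mul, ha.integral_fderiv_deriv hχ,
      (hz r (fun h => lt_irrefl _ h.2)).2]
    ring
  have i1 : IntervalIntegrable (fun t => w t * fderiv ℝ χ (a t) (deriv a t)) volume l b := by
    rw [intervalIntegrable_iff_integrableOn_Ioo_of_le hl.le]
    refine ((hi.const_mul w₁).integrableOn (s := Ioo l b)).congr_fun (fun t ht => ?_)
      measurableSet_Ioo
    have : w t = w₁ := hl' ht
    simp only [this]
  have i2 : IntervalIntegrable (fun t => w t * fderiv ℝ χ (a t) (deriv a t)) volume b r := by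
    rw [intervalIntegrable_iff_integrableOn_Ioo_of_le hr.le]
    refine ((hi.const_mul w₂).integrableOn (s := Ioo b r)).congr_fun (fun t ht => ?_)
      measurableSet_Ioo
    have : w t = w₂ := hr' ht
    simp only [this]
  rw [← setIntegral_eq_integral_of_forall_compl_eq_zero (s := Ioo l r)
    (fun t ht => by rw [(hz t ht).1, mul_zero]), ← integral_Ioc_eq_integral_Ioo,
    ← intervalIntegral.integral_of_le (hl.trans hr).le,
    ← intervalIntegral.integral_add_adjacent_intervals i1 i2, e1, e2]
  ring

/-- At a nearby regular point, test with a bump and with v transverse to the curve: the unweighted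
flux is positive, so it determines the weight. -/
lemma weight_unique (ha : IsPeriodicCurve a) {E : Set (ℝ × ℝ)} {c c' t : ℝ}
    (h : GaussGreenAt E (lineFlux a fun _ => c) (a t))
    (h' : GaussGreenAt E (lineFlux a fun _ => c') (a t)) : c = c' := by
  have h1 : ∀ᶠ τ in 𝓝[≠] t, GaussGreenAt E (lineFlux a fun _ => c) (a τ) :=
    nhdsWithin_le_nhds (ha.cont.continuousAt.eventually h.eventually)
  have h2 : ∀ᶠ τ in 𝓝[≠] t, GaussGreenAt E (lineFlux a fun _ => c') (a τ) :=
    nhdsWithin_le_nhds (ha.cont.continuousAt.eventually h'.eventually)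
  obtain ⟨τ, ⟨⟨U, hU, h3⟩, U', hU', h4⟩, hreg, hne⟩ := ((h1.and h2).and (ha.reg t)).exists
  obtain ⟨N, δ, hδ, hgood, -⟩ := ha.exists_box hreg hne
  have hI : Icc (τ - δ) (τ + δ) ∈ 𝓝 τ := Icc_mem_nhds (by linarith) (by linarith)
  obtain ⟨V, hV, hloc⟩ := ha.exists_nhds τ hI
  obtain ⟨χ, hχ, hs, hχ1, hχ0⟩ := exists_test_bump (inter_mem (inter_mem hU hU') hV)
  have e := (h3 χ hχ (hs.trans (inter_subset_left.trans inter_subset_left)) N).symm.trans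
    (h4 χ hχ (hs.trans (inter_subset_left.trans inter_subset_right)) N)
  unfold lineFlux at e
  rw [integral_const_mul, integral_const_mul] at e
  have hpos : 0 < ∫ t, χ (a t) * cross (deriv a t) N := by
    rw [integral_pos_iff_support_of_nonneg]
    · refine Measure.measure_pos_of_mem_nhds volume (x := τ) ?_
      have : ∀ᶠ s in 𝓝 τ, 0 < χ (a s) :=
        (hχ.smooth.continuous.comp ha.cont).continuousAt.eventually
          (lt_mem_nhds (by simp [hχ1]))
      filter_upwards [this, hI] with s hs1 hs2
      exact (mul_pos hs1 (hgood s hs2).2).ne'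
    · intro s
      by_cases hsV : a s ∈ V
      · exact mul_nonneg (hχ0 _) (hgood s (hloc s hsV)).2.le
      · simp [image_eq_zero_of_notMem_tsupport (fun h => hsV (hs h).2)]
    · have := ha.integrable_lineFlux (w := fun _ => 1) aestronglyMeasurable_const (C := 1)
        (by simp) hχ N
      simpa using this
  exact mul_right_cancel₀ hpos.ne' e

end IsPeriodicCurve

/-- A domain lies on the same side all along its boundary curve, and satisfies the
Gauss–Green formula. -/
theorem IsBoundedBy.exists_gaussGreen {E : Set (ℝ × ℝ)} {a : ℝ → ℝ × ℝ} (hE : IsBoundedBy E a)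
    (ha : IsPeriodicCurve a) : ∃ c : ℝ, (c = 1 ∨ c = -1) ∧
      ∀ z, GaussGreenAt E (lineFlux a fun _ => c) z := by
  set A : ℝ → Set ℝ := fun c => {t | GaussGreenAt E (lineFlux a fun _ => c) (a t)} with hA
  have hAo : ∀ c, IsOpen (A c) := fun c => isOpen_iff_mem_nhds.2 fun t ht =>
    ha.cont.continuousAt.eventually (GaussGreenAt.eventually ht)
  have hAd : Disjoint (A 1) (A (-1)) := by
    rw [Set.disjoint_left]
    intro t h1 h2
    have := ha.weight_unique h1 h2
    norm_num at this
  have hreg : ∀ t, ContDiffAt ℝ 1 a t ∧ deriv a t ≠ 0 → t ∈ A 1 ∪ A (-1) := fun t ht => by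
    rcases hE.regular_side ha ht.1 ht.2 with h | h
    · exact Or.inl h.1
    · exact Or.inr h.1
  have hint : ∀ l r, (∀ t ∈ Ioo l r, ContDiffAt ℝ 1 a t ∧ deriv a t ≠ 0) →
      ∃ c : ℝ, (c = 1 ∨ c = -1) ∧ Ioo l r ⊆ A c := by
    intro l r h
    rcases isPreconnected_Ioo.subset_or_subset (hAo 1) (hAo (-1)) hAd
      (fun t ht => hreg t (h t ht)) with h | h
    · exact ⟨1, Or.inl rfl, h⟩
    · exact ⟨-1, Or.inr rfl, h⟩
  have hcov : ∀ t, t ∈ A 1 ∪ A (-1) := by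
    intro t
    have hl := (ha.reg t).filter_mono (nhdsWithin_mono t (fun x hx => ne_of_lt hx : Iio t ⊆ {t}ᶜ))
    have hr := (ha.reg t).filter_mono (nhdsWithin_mono t (fun x hx => ne_of_gt hx : Ioi t ⊆ {t}ᶜ))
    obtain ⟨l, hlt, hl'⟩ := mem_nhdsLT_iff_exists_Ioo_subset.1 hl
    obtain ⟨r, hrt, hr'⟩ := mem_nhdsGT_iff_exists_Ioo_subset.1 hr
    rw [mem_Iio] at hlt
    rw [mem_Ioi] at hrt
    obtain ⟨c₁, hc₁, hA₁⟩ := hint l t (fun s hs => hl' hs)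
    obtain ⟨c₂, hc₂, hA₂⟩ := hint t r (fun s hs => hr' hs)
    -- The sides found before and after the possibly irregular parameter t are glued into a step
    -- weight. Removability of the point `a t` gives Gauss–Green there with this weight.
    set w : ℝ → ℝ := fun s => if s < t then c₁ else c₂ with hw
    have hwm : AEStronglyMeasurable w :=
      (Measurable.ite measurableSet_Iio measurable_const measurable_const).aestronglyMeasurable
    have hwb : ∀ s, |w s| ≤ 1 := by
      intro s
      simp only [hw]
      split_ifs
      · rcases hc₁ with h | h <;> simp [h]
      · rcases hc₂ with h | h <;> simp [h]
    obtain ⟨U, hU, hloc⟩ := ha.exists_nhds t (Ioo_mem_nhds hlt hrt)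
    have hgg : GaussGreenAt E (lineFlux a w) (a t) := by
      refine gaussGreenAt_of_punctured (ha.isBoundaryFunctional hwm hwb) ?_
      filter_upwards [self_mem_nhdsWithin, nhdsWithin_le_nhds hU] with y hy hyU
      by_cases hyr : y ∈ range a
      · obtain ⟨s, rfl⟩ := hyr
        have hst : s ≠ t := fun h => hy (by simp [h])
        have hs := hloc s hyU
        rcases lt_or_gt_of_ne hst with h | h
        · obtain ⟨V, hV, hV'⟩ := ha.exists_nhds s (Iio_mem_nhds h)
          refine GaussGreenAt.congr_weight (w := fun _ => c₁) (hA₁ ⟨hs.1, h⟩) hV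
            fun τ hτ => ?_
          simp only [hw]
          rw [if_pos (mem_Iio.1 (hV' τ hτ))]
        · obtain ⟨V, hV, hV'⟩ := ha.exists_nhds s (Ioi_mem_nhds h)
          refine GaussGreenAt.congr_weight (w := fun _ => c₂) (hA₂ ⟨h, hs.2⟩) hV
            fun τ hτ => ?_
          simp only [hw]
          rw [if_neg (not_lt.2 (le_of_lt (hV' τ hτ)))]
      · exact hE.gaussGreenAt_of_notMem w hyr
    -- The curl of the flux near `a t` is the jump c₁ - c₂ times the value of the test function, and
    -- it vanishes.
    have hcc : c₁ = c₂ := by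
      obtain ⟨V, hV, hV'⟩ := hgg
      obtain ⟨V₂, hV₂, hj⟩ := ha.exists_nhds_integral_eq_jump (w := w) (b := t) (w₁ := c₁)
        (w₂ := c₂) (by filter_upwards [self_mem_nhdsWithin] with s hs using if_pos hs)
        (by filter_upwards [self_mem_nhdsWithin] with s hs using
          if_neg (not_lt.2 (le_of_lt hs)))
      obtain ⟨χ, hχ, hs, hχ1, -⟩ := exists_test_bump (inter_mem hV hV₂)
      have h1 := curl_eq_of_gaussGreen hV' hχ (hs.trans inter_subset_left)
      have h2 := ha.curl_lineFlux hwm hwb hχ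
      rw [h1, sub_self, hj χ hχ (hs.trans inter_subset_right), hχ1, mul_one] at h2
      linarith
    have hw' : w = fun _ => c₁ := by
      funext s
      simp [hw, hcc]
    rw [hw'] at hgg
    rcases hc₁ with rfl | rfl
    · exact Or.inl hgg
    · exact Or.inr hgg
  have hfin : ∃ c : ℝ, (c = 1 ∨ c = -1) ∧ ∀ t, t ∈ A c := by
    rcases isPreconnected_univ.subset_or_subset (hAo 1) (hAo (-1)) hAd (fun t _ => hcov t) with h | h
    · exact ⟨1, Or.inl rfl, fun t => h (mem_univ t)⟩
    · exact ⟨-1, Or.inr rfl, fun t => h (mem_univ t)⟩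
  obtain ⟨c, hc, hAc⟩ := hfin
  refine ⟨c, hc, fun z => ?_⟩
  by_cases hz : z ∈ range a
  · obtain ⟨t, rfl⟩ := hz
    exact hAc t
  · exact hE.gaussGreenAt_of_notMem _ hz

end EscapeArea

end

/-! ### Unfolding integrals over one period; the orientation read at the ends. -/

noncomputable section

namespace EscapeArea

/-- A smooth compactly supported function whose integer translates sum to one. -/
def unfoldBump (x : ℝ) : ℝ := Real.smoothTransition (x + 1) - Real.smoothTransition x

lemma contDiff_unfoldBump : ContDiff ℝ ∞ unfoldBump :=
  (Real.smoothTransition.contDiff.comp (contDiff_id.add contDiff_const)).sub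
    Real.smoothTransition.contDiff

lemma unfoldBump_of_one_le {x : ℝ} (h : 1 ≤ x) : unfoldBump x = 0 := by
  simp [unfoldBump, Real.smoothTransition.one_of_one_le h,
    Real.smoothTransition.one_of_one_le (show 1 ≤ x + 1 by linarith)]

lemma unfoldBump_of_le_neg_one {x : ℝ} (h : x ≤ -1) : unfoldBump x = 0 := by
  simp [unfoldBump, Real.smoothTransition.zero_of_nonpos (show x ≤ 0 by linarith),
    Real.smoothTransition.zero_of_nonpos (show x + 1 ≤ 0 by linarith)]

lemma abs_unfoldBump_le (x : ℝ) : |unfoldBump x| ≤ 1 := by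
  have h1 := Real.smoothTransition.nonneg (x + 1)
  have h2 := Real.smoothTransition.le_one (x + 1)
  have h3 := Real.smoothTransition.nonneg x
  have h4 := Real.smoothTransition.le_one x
  rw [abs_le, unfoldBump]
  constructor <;> linarith

lemma hasCompactSupport_unfoldBump : HasCompactSupport unfoldBump := by
  refine HasCompactSupport.intro (isCompact_Icc (a := (-1 : ℝ)) (b := 1)) fun x hx => ?_
  rw [mem_Icc, not_and_or, not_le, not_le] at hx
  rcases hx with h | h
  · exact unfoldBump_of_le_neg_one h.le
  · exact unfoldBump_of_one_le h.le

/-- Unfolding: integrals of periodic functions against the translates of `unfoldBump`. -/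
lemma integral_mul_unfoldBump {g c : ℝ → ℝ} (hg : Function.Periodic g 1)
    (hgi : ∀ x y, IntervalIntegrable g volume x y) (hc : Continuous c)
    (hcs : ∀ t, c (t + 1) = c t + 1) :
    ∫ t, g t * unfoldBump (c t) = ∫ t in (0 : ℝ)..1, g t := by
  obtain ⟨D, hD⟩ := exists_abs_sub_le_of_shift hc hcs
  have hD0 : 0 ≤ D := (abs_nonneg _).trans (hD 0)
  -- With this choice c ≥ 1 from M on, c ≤ -1 up to -M, and still c ≤ 0 up to -M + 1.
  set M := D + 1 with hM
  have hbig : ∀ t, M ≤ t → 1 ≤ c t := fun t ht => by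
    have := (abs_le.1 (hD t)).1; linarith
  have hsmall : ∀ t, t ≤ -M → c t ≤ -1 := fun t ht => by
    have := (abs_le.1 (hD t)).2; linarith
  have hSc : Continuous fun t => Real.smoothTransition (c t) :=
    Real.smoothTransition.continuous.comp hc
  -- Since g is periodic and c gains 1 over a period, the integrand is h (t + 1) - h t. The integral
  -- telescopes to two end windows, on which the transition function is 0 and 1.
  set h : ℝ → ℝ := fun t => g t * Real.smoothTransition (c t) with hh
  have hhi : ∀ x y, IntervalIntegrable h volume x y := fun x y =>
    (hgi x y).mul_continuousOn hSc.continuousOn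
  have hshift : ∀ t, g t * unfoldBump (c t) = h (t + 1) - h t := by
    intro t
    simp only [hh, unfoldBump, hcs, hg t]
    ring
  have hhi' : ∀ x y, IntervalIntegrable (fun t => h (t + 1)) volume x y := fun x y => by
    have := (hhi (x + 1) (y + 1)).comp_add_right 1
    simpa using this
  calc ∫ t, g t * unfoldBump (c t) = ∫ t in (-M)..M, g t * unfoldBump (c t) := by
        rw [intervalIntegral.integral_of_le (by linarith)]
        refine (setIntegral_eq_integral_of_forall_compl_eq_zero fun t ht => ?_).symm
        rw [mem_Ioc, not_and_or, not_lt, not_le] at ht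
        rcases ht with ht | ht
        · rw [unfoldBump_of_le_neg_one (hsmall t ht), mul_zero]
        · rw [unfoldBump_of_one_le (hbig t ht.le), mul_zero]
    _ = (∫ t in (-M)..M, h (t + 1)) - ∫ t in (-M)..M, h t := by
        rw [← intervalIntegral.integral_sub (hhi' _ _) (hhi _ _)]
        exact intervalIntegral.integral_congr fun t _ => hshift t
    _ = (∫ t in M..(M + 1), h t) - ∫ t in (-M)..(-M + 1), h t := by
        rw [intervalIntegral.integral_comp_add_right (fun t => h t)]
        have e1 := intervalIntegral.integral_add_adjacent_intervals (hhi (-M) (-M + 1))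
          (hhi (-M + 1) (M + 1))
        have e2 := intervalIntegral.integral_add_adjacent_intervals (hhi (-M) M) (hhi M (M + 1))
        linarith
    _ = ∫ t in M..(M + 1), g t := by
        have z : ∫ t in (-M)..(-M + 1), h t = 0 := by
          refine intervalIntegral.integral_zero_ae (ae_of_all _ fun t ht => ?_)
          rw [uIoc_of_le (by linarith)] at ht
          have : c t ≤ 0 := by
            have := (abs_le.1 (hD t)).2; linarith [ht.2]
          simp [hh, Real.smoothTransition.zero_of_nonpos this]
        rw [z, sub_zero]
        refine intervalIntegral.integral_congr fun t ht => ?_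
        rw [uIcc_of_le (by linarith)] at ht
        simp [hh, Real.smoothTransition.one_of_one_le (hbig t ht.1)]
    _ = ∫ t in (0 : ℝ)..1, g t := by
        have := hg.intervalIntegral_add_eq M 0
        rwa [zero_add] at this

lemma integral_unfoldBump : ∫ x, unfoldBump x = 1 := by
  have := integral_mul_unfoldBump (g := fun _ => 1) (c := id) (fun _ => rfl)
    (fun _ _ => intervalIntegrable_const) continuous_id (fun _ => rfl)
  simpa using this

/-- The test function `ρ(θ) g(ψ)` with `ρ = unfoldBump`. -/
lemma isTest_unfoldBump_mul {g : ℝ → ℝ} (hg : ContDiff ℝ ∞ g) (hgc : HasCompactSupport g) :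
    IsTest (fun z : ℝ × ℝ => unfoldBump z.1 * g z.2) where
  smooth := (contDiff_unfoldBump.comp contDiff_fst).mul (hg.comp contDiff_snd)
  compact := by
    refine HasCompactSupport.intro (hasCompactSupport_unfoldBump.isCompact.prod hgc.isCompact)
      fun z hz => ?_
    rw [mem_prod, not_and_or] at hz
    rcases hz with h | h
    · simp [image_eq_zero_of_notMem_tsupport h]
    · simp [image_eq_zero_of_notMem_tsupport h]

lemma fderiv_unfoldBump_mul {g : ℝ → ℝ} (hg : ContDiff ℝ ∞ g) (z : ℝ × ℝ) :
    fderiv ℝ (fun z : ℝ × ℝ => unfoldBump z.1 * g z.2) z (0, 1) = unfoldBump z.1 * deriv g z.2 := by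
  have h1 : HasFDerivAt (fun z : ℝ × ℝ => unfoldBump z.1)
      (deriv unfoldBump z.1 • ContinuousLinearMap.fst ℝ ℝ ℝ) z :=
    ((contDiff_unfoldBump.differentiable (by simp) z.1).hasDerivAt).comp_hasFDerivAt z
      hasFDerivAt_fst
  have h2 : HasFDerivAt (fun z : ℝ × ℝ => g z.2)
      (deriv g z.2 • ContinuousLinearMap.snd ℝ ℝ ℝ) z :=
    ((hg.differentiable (by simp) z.2).hasDerivAt).comp_hasFDerivAt z hasFDerivAt_snd
  rw [(h1.fun_mul h2).fderiv]
  simp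

/-- Unfolding of the flux of the vertical direction along a periodic curve. -/
lemma IsPeriodicCurve.lineFlux_unfoldBump {a : ℝ → ℝ × ℝ} (ha : IsPeriodicCurve a) {w : ℝ → ℝ}
    (hw : Measurable w) {C : ℝ} (hC : ∀ t, |w t| ≤ C) (hwp : Function.Periodic w 1)
    {g : ℝ → ℝ} (hg : Continuous g) :
    lineFlux a w (0, 1) (fun z => unfoldBump z.1 * g z.2)
      = ∫ t in (0 : ℝ)..1, w t * (g (a t).2 * (deriv a t).1) := by
  have hdp : ∀ t, deriv a (t + 1) = deriv a t := by
    intro t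
    have h1 : (fun s => a (s + 1)) = fun s => a s + (1, 0) := funext ha.shift
    rw [← deriv_comp_add_const, h1, deriv_add_const]
  rw [← integral_mul_unfoldBump (c := fun t => (a t).1)]
  · refine integral_congr_ae (ae_of_all _ fun t => ?_)
    simp only [cross]
    ring
  · intro t
    simp [hwp t, hdp, ha.shift]
  · intro x y
    obtain ⟨M, hM0, hM⟩ := ha.ae_abs_cross_le (0, 1)
    have hgc : Continuous (fun t => g (a t).2) := hg.comp ha.cont.snd
    obtain ⟨G, hG⟩ := isCompact_uIcc.exists_bound_of_continuousOn (s := uIcc x y) hgc.continuousOn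
    refine IntervalIntegrable.mono_fun' (g := fun _ => C * (G * M)) intervalIntegrable_const ?_ ?_
    · refine Measurable.aestronglyMeasurable ?_
      exact hw.mul (hgc.measurable.mul (measurable_deriv a).fst)
    · filter_upwards [ae_restrict_mem measurableSet_uIoc, ae_restrict_of_ae hM] with t ht hMt
      have h1 := hG t (uIoc_subset_uIcc ht)
      have h2 : |(deriv a t).1| ≤ M := by simpa [cross] using hMt
      have h3 := hC t
      rw [Real.norm_eq_abs] at *
      rw [abs_mul, abs_mul]
      gcongr
      · exact (abs_nonneg _).trans h3
      · exact (abs_nonneg _).trans h1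
  · exact ha.cont.fst
  · intro t
    simp [ha.shift]

/-- A smooth cutoff equal to one on `[-B, B]`. -/
lemma exists_cutoff {B : ℝ} (hB : 0 ≤ B) : ∃ η : ℝ → ℝ, ContDiff ℝ ∞ η ∧ HasCompactSupport η ∧
    ∀ x ∈ Icc (-B) B, η x = 1 := by
  let η : ContDiffBump (0 : ℝ) := ⟨B + 1, B + 2, by linarith, by linarith⟩
  refine ⟨η, η.contDiff, η.hasCompactSupport, fun x hx => η.one_of_mem_closedBall ?_⟩
  have : (η : ContDiffBump (0 : ℝ)).rIn = B + 1 := rfl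
  rw [this, Metric.mem_closedBall, dist_zero_right, Real.norm_eq_abs, abs_le]
  constructor <;> linarith [hx.1, hx.2]

/-- The side on which a domain lies is determined at the ends of the cylinder. -/
lemma sign_eq_of_ends {E : Set (ℝ × ℝ)} {a : ℝ → ℝ × ℝ} (ha : IsPeriodicCurve a)
    (hE : MeasurableSet E) {c : ℝ} (hc : ∀ z, GaussGreenAt E (lineFlux a fun _ => c) z)
    {B : ℝ} (hB : ∀ t, |(a t).2| ≤ B) {l h : ℝ}
    (hlow : ∀ z : ℝ × ℝ, z.2 < -B → E.indicator (fun _ => (1 : ℝ)) z = l)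
    (hhigh : ∀ z : ℝ × ℝ, B < z.2 → E.indicator (fun _ => (1 : ℝ)) z = h) : c = l - h := by
  have hB0 : 0 ≤ B := (abs_nonneg _).trans (hB 0)
  obtain ⟨η, hη, hηc, hη1⟩ := exists_cutoff (B := B + 1) (by linarith)
  have hηd : ∀ x ∈ Icc (-B) B, deriv η x = 0 := by
    intro x hx
    have : η =ᶠ[𝓝 x] fun _ => 1 := by
      filter_upwards [Icc_mem_nhds (show -(B + 1) < x by linarith [hx.1])
        (show x < B + 1 by linarith [hx.2])] with y hy using hη1 y hy
    rw [this.deriv_eq, deriv_const]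
  have hgg := gaussGreen_of_forall_tsupport
    (ha.isBoundaryFunctional (w := fun _ => c) (C := |c|) aestronglyMeasurable_const
      (fun _ => le_rfl)) (isTest_unfoldBump_mul hη hηc) (fun z _ => hc z) (0, 1)
  rw [ha.lineFlux_unfoldBump (C := |c|) measurable_const (fun _ => le_rfl) (fun _ => rfl)
    hη.continuous] at hgg
  have hR : ∫ t in (0 : ℝ)..1, c * (η (a t).2 * (deriv a t).1) = c := by
    rw [intervalIntegral.integral_const_mul]
    -- The flux of the vertical direction through one period counts how often the curve winds around
    -- the cylinder, which is once.
    have e : ∫ t in (0 : ℝ)..1, η (a t).2 * (deriv a t).1 = 1 := by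
      have e1 : ∫ t in (0 : ℝ)..1, η (a t).2 * (deriv a t).1 = (a 1).1 - (a 0).1 := by
        refine integral_eq_of_hasDerivAt_off_countable (fun t => (a t).1) _
          ha.countable_irregular ha.cont.fst.continuousOn (fun t ht => ?_) ?_
        · have ht' : ContDiffAt ℝ 1 a t ∧ deriv a t ≠ 0 := not_not.1 ht.2
          have hη' : η (a t).2 = 1 := hη1 _ (by
            have := abs_le.1 (hB t); constructor <;> linarith [this.1, this.2])
          rw [hη', one_mul]
          exact (ht'.1.differentiableAt (by simp)).hasDerivAt.fst
        · obtain ⟨M, hM0, hM⟩ := ha.ae_abs_cross_le (0, 1)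
          refine IntervalIntegrable.mono_fun' (g := fun _ => M) intervalIntegrable_const
            ((hη.continuous.comp ha.cont.snd).measurable.mul
              (measurable_deriv a).fst).aestronglyMeasurable ?_
          filter_upwards [ae_restrict_of_ae hM] with t ht
          have hη' : η (a t).2 = 1 := hη1 _ (by
            have := abs_le.1 (hB t); constructor <;> linarith [this.1, this.2])
          simpa [hη', cross] using ht
      rw [e1]
      have := ha.shift 0
      rw [zero_add] at this
      simp [this]
    rw [e, mul_one]
  rw [hR] at hgg
  rw [← hgg, ← integral_indicator hE]
  -- The indicator is known only for |ψ| > B, but η' vanishes on [-B, B]; the place where l is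
  -- switched to h inside this band is therefore immaterial.
  set k : ℝ → ℝ := fun ψ => (if ψ < 0 then l else h) * deriv η ψ with hk
  have e1 : ∫ z, E.indicator (fun x => fderiv ℝ (fun z : ℝ × ℝ => unfoldBump z.1 * η z.2) x (0, 1)) z
      = ∫ z : ℝ × ℝ, unfoldBump z.1 * k z.2 := by
    refine integral_congr_ae (ae_of_all _ fun z => ?_)
    have e : E.indicator (fun x => fderiv ℝ (fun z : ℝ × ℝ => unfoldBump z.1 * η z.2) x (0, 1)) z
      = E.indicator (fun _ => (1 : ℝ)) z * (unfoldBump z.1 * deriv η z.2) := by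
      by_cases hz : z ∈ E
      · simp [hz, fderiv_unfoldBump_mul hη]
      · simp [hz]
    simp only [e, hk]
    by_cases h1 : z.2 < -B
    · rw [hlow z h1, if_pos (by linarith)]; ring
    · by_cases h2 : B < z.2
      · rw [hhigh z h2, if_neg (by linarith)]; ring
      · rw [hηd _ ⟨not_lt.1 h1, not_lt.1 h2⟩]; ring
  rw [e1, Measure.volume_eq_prod, integral_prod_mul, integral_unfoldBump, one_mul]
  obtain ⟨K, hK0, hK⟩ : ∃ K, 0 < K ∧ ∀ x, x ∉ Ioo (-K) K → η x = 0 ∧ deriv η x = 0 := by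
    obtain ⟨K, hK⟩ := hηc.isCompact.isBounded.subset_ball 0
    refine ⟨max K 1, by positivity, fun x hx => ?_⟩
    have hx' : x ∉ tsupport η := fun h => hx (by
      have := hK h
      rw [mem_ball_zero_iff, Real.norm_eq_abs, abs_lt] at this
      exact ⟨by linarith [this.1, le_max_left K 1], this.2.trans_le (le_max_left _ _)⟩)
    refine ⟨image_eq_zero_of_notMem_tsupport hx', ?_⟩
    rw [← fderiv_apply_one_eq_deriv, fderiv_of_notMem_tsupport ℝ hx']
    simp
  have hdc : Continuous (deriv η) := hη.continuous_deriv (by simp)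
  have ftc : ∀ x y, ∫ t in x..y, deriv η t = η y - η x := fun x y =>
    intervalIntegral.integral_deriv_eq_sub (fun t _ => hη.differentiable (by simp) t)
      (hdc.intervalIntegrable _ _)
  have c1 : ∫ ψ in (-K)..0, k ψ = l := by
    have : ∫ ψ in (-K)..0, k ψ = ∫ ψ in (-K)..0, l * deriv η ψ := by
      rw [intervalIntegral.integral_of_le (by linarith), intervalIntegral.integral_of_le (by linarith),
        integral_Ioc_eq_integral_Ioo, integral_Ioc_eq_integral_Ioo]
      refine setIntegral_congr_fun measurableSet_Ioo fun t ht => ?_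
      simp [hk, ht.2]
    rw [this, intervalIntegral.integral_const_mul, ftc, hη1 0 ⟨by linarith, by linarith⟩,
      (hK (-K) (fun h => lt_irrefl _ h.1)).1]
    ring
  have c2 : ∫ ψ in (0 : ℝ)..K, k ψ = -h := by
    have : ∫ ψ in (0 : ℝ)..K, k ψ = ∫ ψ in (0 : ℝ)..K, h * deriv η ψ := by
      refine intervalIntegral.integral_congr fun t ht => ?_
      rw [uIcc_of_le hK0.le] at ht
      simp [hk, not_lt.2 ht.1]
    rw [this, intervalIntegral.integral_const_mul, ftc, hη1 0 ⟨by linarith, by linarith⟩,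
      (hK K (fun h => lt_irrefl _ h.2)).1]
    ring
  have hki : ∀ x y, IntervalIntegrable k volume x y := by
    intro x y
    have hm : AEStronglyMeasurable (fun ψ : ℝ => if ψ < 0 then l else h)
        (volume.restrict (uIoc x y)) :=
      (Measurable.ite measurableSet_Iio measurable_const measurable_const).aestronglyMeasurable
    refine IntervalIntegrable.mono_fun' (g := fun ψ => (|l| + |h|) * |deriv η ψ|)
      ((hdc.abs.const_mul _).intervalIntegrable _ _) (hm.mul hdc.aestronglyMeasurable) ?_
    refine ae_of_all _ fun ψ => ?_
    simp only [hk]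
    rw [Real.norm_eq_abs, abs_mul]
    gcongr
    split_ifs <;> linarith [abs_nonneg l, abs_nonneg h]
  have : ∫ y, k y = ∫ y in (-K)..K, k y := by
    rw [intervalIntegral.integral_of_le (by linarith), integral_Ioc_eq_integral_Ioo]
    refine (setIntegral_eq_integral_of_forall_compl_eq_zero fun t ht => ?_).symm
    simp [hk, (hK t ht).2]
  rw [this, ← intervalIntegral.integral_add_adjacent_intervals (hki (-K) 0) (hki 0 K), c1, c2]
  ring

/-- The area of a periodic set over one period, unfolded. -/
lemma setIntegral_unfoldBump {E : Set (ℝ × ℝ)} (hE : MeasurableSet E)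
    (hper : ∀ θ ψ, (θ + 1, ψ) ∈ E ↔ (θ, ψ) ∈ E) {B : ℝ} (hB : ∀ z ∈ E, |z.2| ≤ B) :
    ∫ z in E, unfoldBump z.1 = (volume (E ∩ (Ico (0 : ℝ) 1 ×ˢ univ))).toReal ∧
      volume (E ∩ (Ico (0 : ℝ) 1 ×ˢ univ)) ≠ ⊤ := by
  have hsub : ∀ I : Set ℝ, E ∩ (I ×ˢ univ) ⊆ I ×ˢ Icc (-B) B := fun I z hz =>
    ⟨hz.2.1, abs_le.1 (hB z hz.1)⟩
  have hfin : ∀ x y, volume (E ∩ (Icc x y ×ˢ univ)) < ⊤ := fun x y => by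
    refine (measure_mono (hsub _)).trans_lt ?_
    exact (isCompact_Icc.prod isCompact_Icc).measure_lt_top
  have hfin' : volume (E ∩ (Ico (0 : ℝ) 1 ×ˢ univ)) ≠ ⊤ :=
    ((measure_mono (inter_subset_inter_right _ (prod_mono Ico_subset_Icc_self subset_rfl))).trans_lt
      (hfin 0 1)).ne
  refine ⟨?_, hfin'⟩
  set F : ℝ × ℝ → ℝ := E.indicator (fun _ => 1) with hF
  -- The length of the slice at θ, a periodic function whose integral over one period is the area.
  set g : ℝ → ℝ := fun θ => ∫ ψ, F (θ, ψ) with hg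
  have hgp : Function.Periodic g 1 := by
    intro θ
    simp only [hg]
    congr 1
    ext ψ
    by_cases h : (θ, ψ) ∈ E
    · simp [hF, h, (hper θ ψ).2 h]
    · simp [hF, h, mt (hper θ ψ).1 h]
  have hFm : Measurable F := measurable_const.indicator hE
  have hFi : ∀ x y, Integrable (fun z : ℝ × ℝ => (Icc x y).indicator (fun _ => (1 : ℝ)) z.1 * F z) := by
    intro x y
    have : (fun z : ℝ × ℝ => (Icc x y).indicator (fun _ => (1 : ℝ)) z.1 * F z)
        = (E ∩ (Icc x y ×ˢ univ)).indicator (fun _ => 1) := by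
      ext z
      by_cases h1 : z.1 ∈ Icc x y <;> by_cases h2 : z ∈ E <;> simp [hF, h1, h2]
    rw [this]
    exact (integrable_indicator_iff (hE.inter (measurableSet_Icc.prod MeasurableSet.univ))).2
      (integrableOn_const (hfin x y).ne)
  have hgi : ∀ x y, IntegrableOn g (Icc x y) := by
    intro x y
    have h1 := (hFi x y).integral_prod_left
    rw [← integrable_indicator_iff measurableSet_Icc]
    refine h1.congr (ae_of_all _ fun θ => ?_)
    simp only
    rw [integral_const_mul]
    by_cases h : θ ∈ Icc x y <;> simp [h, hg]
  have hgi' : ∀ x y, IntervalIntegrable g volume x y := fun x y => by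
    rw [intervalIntegrable_iff]
    exact (hgi (min x y) (max x y)).mono_set Ioc_subset_Icc_self
  have hL : ∫ z in E, unfoldBump z.1 = ∫ θ, g θ * unfoldBump θ := by
    rw [← integral_indicator hE]
    have e : E.indicator (fun z : ℝ × ℝ => unfoldBump z.1) = fun z => F z * unfoldBump z.1 := by
      ext z
      by_cases h : z ∈ E <;> simp [hF, h]
    rw [e, Measure.volume_eq_prod, integral_prod]
    · refine integral_congr_ae (ae_of_all _ fun θ => ?_)
      simp only
      rw [integral_mul_const]
    · rw [← Measure.volume_eq_prod]
      refine (hFi (-1) 1).mono' (hFm.mul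
        (contDiff_unfoldBump.continuous.measurable.comp measurable_fst)).aestronglyMeasurable
        (ae_of_all _ fun z => ?_)
      rw [Real.norm_eq_abs, abs_mul]
      have hF0 : 0 ≤ F z := indicator_nonneg (fun _ _ => zero_le_one) z
      rw [abs_of_nonneg hF0, mul_comm]
      by_cases h : z.1 ∈ Icc (-1 : ℝ) 1
      · rw [indicator_of_mem h]
        exact mul_le_mul_of_nonneg_right (abs_unfoldBump_le _) hF0
      · rw [indicator_of_notMem h, zero_mul]
        rw [mem_Icc, not_and_or, not_le, not_le] at h
        rcases h with h | h
        · rw [unfoldBump_of_le_neg_one h.le]; simp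
        · rw [unfoldBump_of_one_le h.le]; simp
  rw [hL]
  have := integral_mul_unfoldBump (c := id) hgp hgi' continuous_id (fun _ => rfl)
  simp only [id] at this
  rw [this, intervalIntegral.integral_of_le zero_le_one, integral_Ioc_eq_integral_Ioo,
    ← integral_Ico_eq_integral_Ioo, ← measureReal_def, ← integral_indicator_one
      (hE.inter (measurableSet_Ico.prod MeasurableSet.univ)), ← integral_indicator measurableSet_Ico]
  rw [Measure.volume_eq_prod, integral_prod]
  · refine integral_congr_ae (ae_of_all _ fun θ => ?_)
    by_cases h : θ ∈ Ico (0 : ℝ) 1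
    · simp only [indicator_of_mem h, hg]
      refine integral_congr_ae (ae_of_all _ fun ψ => ?_)
      by_cases h2 : (θ, ψ) ∈ E
      · have h3 : (θ, ψ) ∈ E ∩ (Ico (0 : ℝ) 1 ×ˢ univ) := ⟨h2, h, mem_univ _⟩
        simp only [hF, indicator_of_mem h2, indicator_of_mem h3, Pi.one_apply]
      · have h3 : (θ, ψ) ∉ E ∩ (Ico (0 : ℝ) 1 ×ˢ univ) := fun h' => h2 h'.1
        simp only [hF, indicator_of_notMem h2, indicator_of_notMem h3]
    · simp only [indicator_of_notMem h]
      symm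
      refine integral_eq_zero_of_ae (ae_of_all _ fun ψ => ?_)
      exact indicator_of_notMem (fun h' => h h'.2.1) _
  · rw [← Measure.volume_eq_prod]
    exact (integrable_indicator_iff (hE.inter (measurableSet_Ico.prod MeasurableSet.univ))).2
      (integrableOn_const hfin')

end EscapeArea

end

/-! ### The map generated by F: area preservation, the boundary line, the primitive. -/

noncomputable section

namespace EscapeArea

/-- The mixed generating function on the plane, with variables `(ψ', θ)`. -/
def mixedGenU (f : ℝ → ℝ → ℝ) (p : ℝ × ℝ) : ℝ := mixedGen f p.1 p.2

/-- The primitive of `T^*(ψ dθ) - ψ dθ` given by the generating function. -/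
def primitive (f : ℝ → ℝ → ℝ) (T : ℝ × ℝ → ℝ × ℝ) (z : ℝ × ℝ) : ℝ :=
  (T z).2 * (T z).1 - mixedGenU f ((T z).2, z.1)

lemma phase_mem_nhds {J : Set ℝ} {z : ℝ × ℝ} (hz : z.2 ∈ interior J) : phase J ∈ 𝓝 z :=
  prod_mem_nhds univ_mem (mem_interior_iff_mem_nhds.1 hz)

lemma mem_phase {J : Set ℝ} {z : ℝ × ℝ} : z ∈ phase J ↔ z.2 ∈ J := by simp [phase]

lemma uniqueDiffOn_domain {J : Set ℝ} (hJ : J = univ ∨ J = Ici 0) : UniqueDiffOn ℝ J := by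
  rcases hJ with rfl | rfl
  · exact uniqueDiffOn_univ
  · exact uniqueDiffOn_Ici 0

namespace IsGeneratedBy

variable {J : Set ℝ} {f : ℝ → ℝ → ℝ} {T : ℝ × ℝ → ℝ × ℝ}

lemma contDiffAt_uncurry (hT : IsGeneratedBy J f T) {ψ' : ℝ} (h : ψ' ∈ J) (θ : ℝ) :
    ContDiffAt ℝ 2 (fun p : ℝ × ℝ => f p.1 p.2) (ψ', θ) := by
  obtain ⟨U, hU, hJU, hf⟩ := hT.smooth
  exact hf.contDiffAt ((hU.prod isOpen_univ).mem_nhds ⟨hJU h, mem_univ _⟩)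

lemma contDiffAt_mixedGenU (hT : IsGeneratedBy J f T) {ψ' : ℝ} (h : ψ' ∈ J) (θ : ℝ) :
    ContDiffAt ℝ 2 (mixedGenU f) (ψ', θ) :=
  (contDiffAt_fst.mul contDiffAt_snd).add (hT.contDiffAt_uncurry h θ)

lemma mixedGenDθ_eq (hT : IsGeneratedBy J f T) {ψ' : ℝ} (h : ψ' ∈ J) (θ : ℝ) :
    mixedGenDθ f ψ' θ = fderiv ℝ (mixedGenU f) (ψ', θ) (0, 1) := by
  have h1 : HasDerivAt (fun x : ℝ => (ψ', x)) ((0, 1) : ℝ × ℝ) θ :=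
    (hasDerivAt_const θ ψ').prodMk (hasDerivAt_id θ)
  exact (((hT.contDiffAt_mixedGenU h θ).differentiableAt (by simp)).hasFDerivAt.comp_hasDerivAt
    θ h1).deriv

lemma mixedGenDψ_eq (hT : IsGeneratedBy J f T) {ψ' : ℝ} (h : ψ' ∈ J) (θ : ℝ) :
    mixedGenDψ f ψ' θ = fderiv ℝ (mixedGenU f) (ψ', θ) (1, 0) := by
  have h1 : HasDerivAt (fun x : ℝ => (x, θ)) ((1, 0) : ℝ × ℝ) ψ' :=
    (hasDerivAt_id ψ').prodMk (hasDerivAt_const ψ' θ)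
  exact (((hT.contDiffAt_mixedGenU h θ).differentiableAt (by simp)).hasFDerivAt.comp_hasDerivAt
    ψ' h1).deriv

lemma differentiableAt_fst (hT : IsGeneratedBy J f T) {ψ' : ℝ} (h : ψ' ∈ J) (θ : ℝ) :
    DifferentiableAt ℝ (fun p => f p θ) ψ' := by
  have h1 : HasDerivAt (fun x : ℝ => (x, θ)) ((1, 0) : ℝ × ℝ) ψ' :=
    (hasDerivAt_id ψ').prodMk (hasDerivAt_const ψ' θ)
  exact (((hT.contDiffAt_uncurry h θ).differentiableAt (by simp)).hasFDerivAt.comp_hasDerivAt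
    ψ' h1).differentiableAt

lemma mixedGenDψ_eq_add (hT : IsGeneratedBy J f T) {ψ' : ℝ} (h : ψ' ∈ J) (θ : ℝ) :
    mixedGenDψ f ψ' θ = θ + deriv (fun p => f p θ) ψ' := by
  have h1 : HasDerivAt (fun p => p * θ + f p θ) (1 * θ + deriv (fun p => f p θ) ψ') ψ' :=
    ((hasDerivAt_id ψ').mul_const θ).add (hT.differentiableAt_fst h θ).hasDerivAt
  rw [one_mul] at h1
  exact h1.deriv

lemma mapsTo (hT : IsGeneratedBy J f T) {z : ℝ × ℝ} (hz : z.2 ∈ J) : (T z).2 ∈ J :=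
  mem_phase.1 (hT.bijOn.mapsTo (mem_phase.2 hz))

lemma injOn (hT : IsGeneratedBy J f T) {z w : ℝ × ℝ} (hz : z.2 ∈ J) (hw : w.2 ∈ J)
    (h : T z = T w) : z = w := hT.bijOn.injOn (mem_phase.2 hz) (mem_phase.2 hw) h

lemma snd_eq (hT : IsGeneratedBy J f T) {z : ℝ × ℝ} (hz : z.2 ∈ J) :
    z.2 = fderiv ℝ (mixedGenU f) ((T z).2, z.1) (0, 1) := by
  rw [← hT.mixedGenDθ_eq (hT.mapsTo hz)]
  exact ((hT.generated z.1 z.2 hz (T z).1 (T z).2 (hT.mapsTo hz)).1 rfl).1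

lemma fst_eq (hT : IsGeneratedBy J f T) {z : ℝ × ℝ} (hz : z.2 ∈ J) :
    (T z).1 = fderiv ℝ (mixedGenU f) ((T z).2, z.1) (1, 0) := by
  rw [← hT.mixedGenDψ_eq (hT.mapsTo hz)]
  exact ((hT.generated z.1 z.2 hz (T z).1 (T z).2 (hT.mapsTo hz)).1 rfl).2

lemma map_shift (hT : IsGeneratedBy J f T) (hJ : J = univ ∨ J = Ici 0) {z : ℝ × ℝ}
    (hz : z.2 ∈ J) : T (z + (1, 0)) = T z + (1, 0) := by
  have hw := hT.mapsTo hz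
  obtain ⟨h1, h2⟩ := (hT.generated z.1 z.2 hz (T z).1 (T z).2 hw).1 rfl
  have key : T (z.1 + 1, z.2) = ((T z).1 + 1, (T z).2) := by
    refine (hT.generated (z.1 + 1) z.2 hz _ _ hw).2 ⟨?_, ?_⟩
    · have e : (fun x => mixedGen f (T z).2 (x + 1)) = fun x => mixedGen f (T z).2 x + (T z).2 := by
        ext x
        simp only [mixedGen, hT.periodic _ hw]
        ring
      have h3 : mixedGenDθ f (T z).2 (z.1 + 1) = mixedGenDθ f (T z).2 z.1 := by
        unfold mixedGenDθ
        rw [← deriv_comp_add_const, e, deriv_add_const]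
      rw [h3]; exact h1
    · rw [hT.mixedGenDψ_eq_add hw]
      rw [hT.mixedGenDψ_eq_add hw] at h2
      -- Periodicity of f is given only for momenta in J, so at an endpoint of J the two derivatives
      -- are compared through derivatives within J.
      have hu := uniqueDiffOn_domain hJ _ hw
      have h3 : deriv (fun p => f p (z.1 + 1)) (T z).2 = deriv (fun p => f p z.1) (T z).2 := by
        rw [← (hT.differentiableAt_fst hw _).derivWithin hu,
          ← (hT.differentiableAt_fst hw _).derivWithin hu]
        exact derivWithin_congr (fun p hp => hT.periodic p hp _) (hT.periodic _ hw _)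
      rw [h3]
      linarith
  have e1 : z + (1, 0) = (z.1 + 1, z.2) := by ext <;> simp
  have e2 : T z + (1, 0) = ((T z).1 + 1, (T z).2) := by ext <;> simp
  rw [e1, e2, key]

lemma contDiffAt (hT : IsGeneratedBy J f T) {z : ℝ × ℝ} (hz : z.2 ∈ interior J) :
    ContDiffAt ℝ 1 T z := hT.contDiffOn.contDiffAt (phase_mem_nhds hz)

lemma hasFDerivAt (hT : IsGeneratedBy J f T) {z : ℝ × ℝ} (hz : z.2 ∈ interior J) :
    HasFDerivAt T (fderiv ℝ T z) z := ((hT.contDiffAt hz).differentiableAt (by simp)).hasFDerivAt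

/-- `T` preserves the area form. -/
lemma cross_fderiv (hT : IsGeneratedBy J f T) {z : ℝ × ℝ} (hz : z.2 ∈ interior J) (h k : ℝ × ℝ) :
    cross (fderiv ℝ T z h) (fderiv ℝ T z k) = cross h k := by
  have hzJ := interior_subset hz
  have hw := hT.mapsTo hzJ
  set D := fderiv ℝ (mixedGenU f) with hD
  set A := fderiv ℝ T z with hA
  have hTd : HasFDerivAt T A z := hT.hasFDerivAt hz
  have hC := hT.contDiffAt_mixedGenU hw z.1
  have hDd : HasFDerivAt D (fderiv ℝ D ((T z).2, z.1)) ((T z).2, z.1) :=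
    ((hC.fderiv_right (m := 1) (by norm_num)).differentiableAt (by simp)).hasFDerivAt
  set S := fderiv ℝ D ((T z).2, z.1) with hS
  have hsymm : ∀ u v, S u v = S v u := hC.isSymmSndFDerivAt (by simp)
  have hin : HasFDerivAt (fun y : ℝ × ℝ => ((T y).2, y.1))
      (((ContinuousLinearMap.snd ℝ ℝ ℝ).comp A).prod (ContinuousLinearMap.fst ℝ ℝ ℝ)) z :=
    hTd.snd.prodMk hasFDerivAt_fst
  have hcomp := hDd.comp z hin
  have hev : ∀ᶠ y : ℝ × ℝ in 𝓝 z, y.2 ∈ J := by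
    filter_upwards [phase_mem_nhds hz] with y hy using mem_phase.1 hy
  -- Differentiating the generating equations expresses dψ and dθ' through the Hessian S of F. As S
  -- is symmetric, dθ' ∧ dψ' and dθ ∧ dψ are both the mixed second derivative times dθ ∧ dψ'.
  have e2 : ∀ u, u.2 = S ((A u).2, u.1) (0, 1) := by
    intro u
    have h1 : HasFDerivAt (fun y : ℝ × ℝ => D ((T y).2, y.1) (0, 1)) _ z :=
      hcomp.clm_apply (hasFDerivAt_const ((0, 1) : ℝ × ℝ) z)
    have h2 : HasFDerivAt (fun y : ℝ × ℝ => D ((T y).2, y.1) (0, 1))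
        (ContinuousLinearMap.snd ℝ ℝ ℝ) z := by
      refine hasFDerivAt_snd.congr_of_eventuallyEq ?_
      filter_upwards [hev] with y hy using (hT.snd_eq hy).symm
    have := congrArg (fun B => B u) (h2.unique h1)
    simpa using this
  have e1 : ∀ u, (A u).1 = S ((A u).2, u.1) (1, 0) := by
    intro u
    have h1 : HasFDerivAt (fun y : ℝ × ℝ => D ((T y).2, y.1) (1, 0)) _ z :=
      hcomp.clm_apply (hasFDerivAt_const ((1, 0) : ℝ × ℝ) z)
    have h2 : HasFDerivAt (fun y : ℝ × ℝ => D ((T y).2, y.1) (1, 0))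
        ((ContinuousLinearMap.fst ℝ ℝ ℝ).comp A) z := by
      refine hTd.fst.congr_of_eventuallyEq ?_
      filter_upwards [hev] with y hy using (hT.fst_eq hy).symm
    have := congrArg (fun B => B u) (h2.unique h1)
    simpa using this
  have lin : ∀ (x y : ℝ) (v : ℝ × ℝ), S (x, y) v = x * S (1, 0) v + y * S (0, 1) v := by
    intro x y v
    have : ((x, y) : ℝ × ℝ) = x • (1, 0) + y • (0, 1) := by ext <;> simp
    rw [this, map_add, map_smul, map_smul]
    simp
  have hs := hsymm (1, 0) (0, 1)
  unfold cross
  rw [e1 h, e1 k, e2 h, e2 k, lin _ h.1, lin _ h.1, lin _ k.1, lin _ k.1, hs]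
  ring

/-- A kernel vector of the derivative would have zero cross product with every vector, since T
preserves area; so the inverse function theorem applies. -/
lemma exists_strictFDerivAt (hT : IsGeneratedBy J f T) {z : ℝ × ℝ} (hz : z.2 ∈ interior J) :
    ∃ e : (ℝ × ℝ) ≃L[ℝ] ℝ × ℝ, HasStrictFDerivAt T (e : ℝ × ℝ →L[ℝ] ℝ × ℝ) z := by
  have hinj : Function.Injective (fderiv ℝ T z) := by
    rw [injective_iff_map_eq_zero]
    intro x hx
    have h1 := hT.cross_fderiv hz x (1, 0)
    have h2 := hT.cross_fderiv hz x (0, 1)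
    rw [hx] at h1 h2
    simp [cross] at h1 h2
    exact Prod.ext h2.symm h1
  obtain ⟨e, he⟩ := exists_equiv_of_injective hinj
  exact ⟨e, he ▸ (hT.contDiffAt hz).hasStrictFDerivAt (by simp)⟩

lemma map_nhds (hT : IsGeneratedBy J f T) {z : ℝ × ℝ} (hz : z.2 ∈ interior J) :
    map T (𝓝 z) = 𝓝 (T z) := by
  obtain ⟨e, he⟩ := hT.exists_strictFDerivAt hz
  exact he.map_nhds_eq_of_equiv

/-- T is open at interior points, so the image point has a neighbourhood inside the phase space. -/
lemma mapsTo_interior (hT : IsGeneratedBy J f T) {z : ℝ × ℝ} (hz : z.2 ∈ interior J) :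
    (T z).2 ∈ interior J := by
  have h1 : phase J ∈ 𝓝 (T z) := by
    rw [← hT.map_nhds hz, mem_map]
    filter_upwards [phase_mem_nhds hz] with y hy using hT.bijOn.mapsTo hy
  have h2 : Tendsto (fun x : ℝ => ((T z).1, x)) (𝓝 (T z).2) (𝓝 (T z)) := by
    have : Continuous (fun x : ℝ => ((T z).1, x)) := by fun_prop
    exact this.continuousAt
  rw [mem_interior_iff_mem_nhds]
  filter_upwards [h2 h1] with x hx using mem_phase.1 hx

lemma isOpen_image (hT : IsGeneratedBy J f T) {O : Set (ℝ × ℝ)} (hO : IsOpen O)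
    (hs : ∀ z ∈ O, z.2 ∈ interior J) : IsOpen (T '' O) := by
  rw [isOpen_iff_mem_nhds]
  rintro _ ⟨z, hz, rfl⟩
  rw [← hT.map_nhds (hs z hz)]
  exact image_mem_map (hO.mem_nhds hz)

/-- The boundary of the phase space is invariant. -/
lemma snd_map_boundary (hT : IsGeneratedBy (Ici 0) f T) (θ : ℝ) : (T (θ, 0)).2 = 0 := by
  set b : ℝ → ℝ × ℝ := fun θ => T (θ, 0) with hb
  have h0 : ∀ θ : ℝ, ((θ, 0) : ℝ × ℝ).2 ∈ Ici (0 : ℝ) := fun θ => self_mem_Ici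
  have hbc : Continuous b :=
    hT.contDiffOn.continuousOn.comp_continuous (by fun_prop) (fun θ => mem_phase.2 (h0 θ))
  have hbs : ∀ t, b (t + 1) = b t + (1, 0) := by
    intro t
    have := hT.map_shift (Or.inr rfl) (h0 t)
    simpa [hb] using this
  have hbi : Function.Injective b := fun x y h => by
    simpa using hT.injOn (h0 x) (h0 y) h
  -- Interior points have interior images, so the preimage of a boundary point lies on the boundary.
  have hsurj : ∀ x : ℝ, ∃ θ, b θ = (x, 0) := by
    intro x
    obtain ⟨z, hz, hzx⟩ := hT.bijOn.surjOn (mem_phase.2 (h0 x))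
    have hz2 : z.2 = 0 := by
      by_contra hne
      have hpos : 0 < z.2 := lt_of_le_of_ne (mem_phase.1 hz) (Ne.symm hne)
      have := hT.mapsTo_interior (z := z) (by rw [interior_Ici]; exact hpos)
      rw [hzx, interior_Ici] at this
      exact lt_irrefl (0 : ℝ) this
    refine ⟨z.1, ?_⟩
    rw [← hzx, hb]
    simp only
    rw [← hz2]
  -- It remains to see that every θ is a value of this right inverse. It is continuous, because `b`
  -- is an embedding, and has bounded displacement, so it is onto.
  choose h hh using hsurj
  have hhc : Continuous h := by
    rw [(isClosedEmbedding_of_shift hbc hbs hbi).isInducing.continuous_iff]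
    have : b ∘ h = fun x => (x, 0) := funext hh
    rw [this]
    fun_prop
  have hhs : ∀ x, h (x + 1) = h x + 1 := by
    intro x
    apply hbi
    rw [hh, hbs, hh]
    simp
  obtain ⟨D, hD⟩ := exists_abs_sub_le_of_shift hhc hhs
  obtain ⟨x, rfl⟩ : θ ∈ range h := by
    refine mem_range_of_exists_le_of_exists_ge hhc ⟨θ - D, ?_⟩ ⟨θ + D, ?_⟩
    · have := (abs_le.1 (hD (θ - D))).2; linarith
    · have := (abs_le.1 (hD (θ + D))).1; linarith
  have := hh x
  simp only [hb] at this
  rw [this]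

lemma mem_interior_of_map (hT : IsGeneratedBy J f T) (hJ : J = univ ∨ J = Ici 0) {z : ℝ × ℝ}
    (hz : z.2 ∈ J) (h : (T z).2 ∈ interior J) : z.2 ∈ interior J := by
  rcases hJ with rfl | rfl
  · simp
  · rw [interior_Ici] at *
    refine lt_of_le_of_ne (mem_Ici.1 hz) fun h0 => ?_
    have hz' : z = (z.1, 0) := Prod.ext rfl h0.symm
    rw [hz', hT.snd_map_boundary] at h
    exact lt_irrefl (0 : ℝ) h

/-- In d(ψ'θ' - F) the terms θ' dψ' cancel because ∂F/∂ψ' = θ', and ∂F/∂θ = ψ leaves ψ' dθ' - ψ dθ.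
-/
lemma hasFDerivAt_primitive (hT : IsGeneratedBy J f T) {z : ℝ × ℝ} (hz : z.2 ∈ interior J) :
    HasFDerivAt (primitive f T) ((T z).2 • (ContinuousLinearMap.fst ℝ ℝ ℝ).comp (fderiv ℝ T z)
      - z.2 • ContinuousLinearMap.fst ℝ ℝ ℝ) z := by
  have hzJ := interior_subset hz
  have hw := hT.mapsTo hzJ
  have hTd := hT.hasFDerivAt hz
  have hin : HasFDerivAt (fun y : ℝ × ℝ => ((T y).2, y.1))
      (((ContinuousLinearMap.snd ℝ ℝ ℝ).comp (fderiv ℝ T z)).prod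
        (ContinuousLinearMap.fst ℝ ℝ ℝ)) z := hTd.snd.prodMk hasFDerivAt_fst
  have hF : HasFDerivAt (mixedGenU f) (fderiv ℝ (mixedGenU f) ((T z).2, z.1)) ((T z).2, z.1) :=
    ((hT.contDiffAt_mixedGenU hw z.1).differentiableAt (by simp)).hasFDerivAt
  have h := (hTd.snd.fun_mul hTd.fst).fun_sub (hF.comp z hin)
  refine h.congr_fderiv ?_
  have lin : ∀ u : ℝ × ℝ, fderiv ℝ (mixedGenU f) ((T z).2, z.1) u = u.1 * (T z).1 + u.2 * z.2 := by
    intro u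
    have : u = u.1 • (1, 0) + u.2 • (0, 1) := by ext <;> simp
    conv_lhs => rw [this, map_add, map_smul, map_smul, ← hT.fst_eq hzJ, ← hT.snd_eq hzJ]
    simp
  ext <;> simp [lin] <;> ring

lemma primitive_eq (hT : IsGeneratedBy J f T) {z : ℝ × ℝ} (hz : z.2 ∈ J) :
    primitive f T z = (T z).2 * deriv (fun p => f p z.1) (T z).2 - f (T z).2 z.1 := by
  have h1 := hT.fst_eq hz
  rw [← hT.mixedGenDψ_eq (hT.mapsTo hz), hT.mixedGenDψ_eq_add (hT.mapsTo hz)] at h1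
  simp only [primitive, mixedGenU, mixedGen]
  linear_combination (T z).2 * h1

lemma primitive_shift (hT : IsGeneratedBy J f T) (hJ : J = univ ∨ J = Ici 0) {z : ℝ × ℝ}
    (hz : z.2 ∈ J) : primitive f T (z + (1, 0)) = primitive f T z := by
  simp only [primitive, hT.map_shift hJ hz, mixedGenU, mixedGen, Prod.fst_add, Prod.snd_add,
    add_zero, hT.periodic _ (hT.mapsTo hz)]
  ring

end IsGeneratedBy

end EscapeArea

end

/-! ### Gauss–Green for R and for T(R). -/

noncomputable section

namespace EscapeArea

variable {J : Set ℝ} {f : ℝ → ℝ → ℝ} {T : ℝ × ℝ → ℝ × ℝ} {γ : ℝ → ℝ × ℝ} {R : Set (ℝ × ℝ)}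

lemma eventually_ne_add_int (b t : ℝ) : ∀ᶠ τ in 𝓝[≠] t, ∀ k : ℤ, τ ≠ b + k := by
  have hcl : IsClosed ((fun x : ℝ => b + x) '' ((fun k : ℤ => (k : ℝ)) '' {k : ℤ | b + k ≠ t})) :=
    (Homeomorph.addLeft b).isClosedMap _
      (Int.isClosedEmbedding_coe_real.isClosedMap _ (isClosed_discrete _))
  have hmem : ((fun x : ℝ => b + x) '' ((fun k : ℤ => (k : ℝ)) '' {k : ℤ | b + k ≠ t}))ᶜ ∈ 𝓝 t := by
    refine hcl.isOpen_compl.mem_nhds ?_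
    rintro ⟨_, ⟨k, hk, rfl⟩, h⟩
    exact hk h
  filter_upwards [nhdsWithin_le_nhds hmem, self_mem_nhdsWithin] with τ h1 h2 k hk
  exact h1 ⟨k, ⟨k, fun h => h2 (by simp [hk, h]), rfl⟩, hk.symm⟩

lemma IsClosedCurve.isPeriodicCurve (hγ : IsClosedCurve J γ) : IsPeriodicCurve γ where
  cont := by
    obtain ⟨K, hK⟩ := hγ.lipschitz
    exact hK.continuous
  shift t := by rw [hγ.shift]; ext <;> simp
  inj s t h := by
    have := hγ.simple s t 0 (by simp [h])
    simpa using this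
  reg t := by
    obtain ⟨S, hS⟩ := hγ.regular
    have : ∀ᶠ τ in 𝓝[≠] t, ∀ b ∈ S, ∀ k : ℤ, τ ≠ b + k :=
      (Filter.eventually_all_finset S).2 fun b _ => eventually_ne_add_int b t
    filter_upwards [this] with τ hτ using hS τ hτ
  bdd := by
    obtain ⟨K, hK⟩ := hγ.lipschitz
    exact ⟨K, ae_of_all _ fun t => norm_deriv_le_of_lipschitz hK⟩

lemma IsGeneratedBy.deriv_comp (hT : IsGeneratedBy J f T) {t : ℝ} (hi : (γ t).2 ∈ interior J)
    (hd : DifferentiableAt ℝ γ t) :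
    HasDerivAt (fun t => T (γ t)) (fderiv ℝ T (γ t) (deriv γ t)) t :=
  (hT.hasFDerivAt hi).comp_hasDerivAt t hd.hasDerivAt

lemma IsGeneratedBy.isPeriodicCurve_comp (hT : IsGeneratedBy J f T)
    (hJ : J = univ ∨ J = Ici 0) (hγ : IsPeriodicCurve γ) (hi : ∀ t, (γ t).2 ∈ interior J) :
    IsPeriodicCurve (fun t => T (γ t)) where
  cont := continuous_iff_continuousAt.2 fun t =>
    (hT.contDiffAt (hi t)).continuousAt.comp hγ.cont.continuousAt
  shift t := by rw [hγ.shift, hT.map_shift hJ (interior_subset (hi t))]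
  inj s t h := hγ.inj (hT.injOn (interior_subset (hi s)) (interior_subset (hi t)) h)
  reg t := by
    filter_upwards [hγ.reg t] with τ hτ
    refine ⟨(hT.contDiffAt (hi τ)).comp τ hτ.1, ?_⟩
    rw [(hT.deriv_comp (hi τ) (hτ.1.differentiableAt (by simp))).deriv]
    intro h
    apply hτ.2
    have h1 := hT.cross_fderiv (hi τ) (deriv γ τ) (1, 0)
    have h2 := hT.cross_fderiv (hi τ) (deriv γ τ) (0, 1)
    rw [h] at h1 h2
    simp [cross] at h1 h2
    exact Prod.ext h2.symm h1
  bdd := by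
    obtain ⟨K, hK⟩ := hγ.bdd
    -- The derivative of T along the curve is continuous and periodic, hence bounded; this bounds
    -- the speed of the image curve.
    have hcont : Continuous (fun t => fderiv ℝ T (γ t)) := continuous_iff_continuousAt.2 fun t =>
      ContinuousAt.comp (g := fderiv ℝ T)
        ((hT.contDiffAt (hi t)).fderiv_right (m := 0) (by simp)).continuousAt hγ.cont.continuousAt
    have hper : Function.Periodic (fun t => fderiv ℝ T (γ t)) 1 := by
      intro t
      simp only [hγ.shift]
      rw [← fderiv_comp_add_right]
      have : (fun z => T (z + (1, 0))) =ᶠ[𝓝 (γ t)] fun z => T z + (1, 0) := by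
        filter_upwards [phase_mem_nhds (hi t)] with z hz using hT.map_shift hJ (mem_phase.1 hz)
      rw [this.fderiv_eq, fderiv_add_const]
    obtain ⟨D, hD⟩ := isCompact_Icc.exists_bound_of_continuousOn (s := Icc (0 : ℝ) 1)
      hcont.continuousOn
    have hD' : ∀ t, ‖fderiv ℝ T (γ t)‖ ≤ D := by
      intro t
      obtain ⟨s, hs, h⟩ := hper.exists_mem_Ico₀ one_pos t
      rw [h]
      exact hD s (Ico_subset_Icc_self hs)
    refine ⟨D * K, ?_⟩
    filter_upwards [hK, hγ.ae_regular] with t ht hr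
    rw [(hT.deriv_comp (hi t) (hr.1.differentiableAt (by simp))).deriv]
    refine (ContinuousLinearMap.le_opNorm _ _).trans ?_
    exact mul_le_mul (hD' t) ht (norm_nonneg _) ((norm_nonneg _).trans (hD' t))

lemma IsPeriodicCurve.exists_pos_le_snd (hγ : IsPeriodicCurve γ) (hpos : ∀ t, 0 < (γ t).2) :
    ∃ c > 0, ∀ t, c ≤ (γ t).2 := by
  have hp : Function.Periodic (fun t => (γ t).2) 1 := fun t => by simp [hγ.shift]
  obtain ⟨s, -, hs⟩ := isCompact_Icc.exists_isMinOn (s := Icc (0 : ℝ) 1) ⟨0, by simp⟩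
    hγ.cont.snd.continuousOn
  refine ⟨(γ s).2, hpos s, fun t => ?_⟩
  obtain ⟨τ, hτ, h⟩ := hp.exists_mem_Ico₀ one_pos t
  rw [h]
  exact hs (Ico_subset_Icc_self hτ)

lemma ext_eq (R : Set (ℝ × ℝ)) (C : Set (ℝ × ℝ)) (P : Set (ℝ × ℝ)) :
    (R ∪ Pᶜ ∪ C)ᶜ = P \ (R ∪ C) := by
  ext z
  simp only [mem_compl_iff, mem_union, Set.mem_sdiff]
  tauto

/-- For J = [0, ∞) the curve stays a positive distance above the line ψ = 0, and the strip below it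
belongs to R. Gluing the lower half plane to R thus gives a set open in the whole plane whose only
boundary is the curve. -/
lemma IsDomainBoundedBy.isBoundedBy (hR : IsDomainBoundedBy J γ R) (hJ : J = univ ∨ J = Ici 0)
    (hγ : IsPeriodicCurve γ) (hi : ∀ t, (γ t).2 ∈ interior J) :
    IsBoundedBy (R ∪ (phase J)ᶜ) γ := by
  obtain ⟨U, hU, hRU⟩ := hR.isOpen
  obtain ⟨V, hV, hXV⟩ := hR.isOpen_exterior
  have hopen : IsOpen (R ∪ (phase J)ᶜ) ∧ IsOpen (R ∪ (phase J)ᶜ ∪ range γ)ᶜ := by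
    rw [ext_eq, hXV]
    rcases hJ with rfl | rfl
    · have : phase (univ : Set ℝ) = univ := by simp [phase]
      rw [hRU, this]
      simpa using ⟨hU, hV⟩
    · simp only [interior_Ici, mem_Ioi] at hi
      obtain ⟨c, hc, hcγ⟩ := hγ.exists_pos_le_snd hi
      have hlow : ∀ z : ℝ × ℝ, 0 ≤ z.2 → z.2 < c → z ∈ R := fun z h0 h1 =>
        hR.low z (mem_phase.2 h0) (fun t => h1.trans_le (hcγ t))
      have hO : IsOpen {z : ℝ × ℝ | 0 < z.2} := isOpen_lt continuous_const continuous_snd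
      have hO' : IsOpen {z : ℝ × ℝ | z.2 < c} := isOpen_lt continuous_snd continuous_const
      constructor
      · have : R ∪ (phase (Ici 0))ᶜ = (U ∩ {z | 0 < z.2}) ∪ {z | z.2 < c} := by
          ext z
          simp only [mem_union, mem_compl_iff, mem_phase, mem_Ici, not_le, mem_inter_iff,
            mem_ofPred_eq]
          constructor
          · rintro (h | h)
            · by_cases h0 : z.2 < c
              · exact Or.inr h0
              · rw [hRU] at h
                exact Or.inl ⟨h.1, by linarith⟩
            · exact Or.inr (h.trans hc)
          · rintro (h | h)
            · left
              rw [hRU]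
              exact ⟨h.1, mem_phase.2 h.2.le⟩
            · by_cases h0 : z.2 < 0
              · exact Or.inr h0
              · exact Or.inl (hlow z (not_lt.1 h0) h)
        rw [this]
        exact (hU.inter hO).union hO'
      · have : V ∩ phase (Ici 0) = V ∩ {z | 0 < z.2} := by
          ext z
          constructor
          · intro h
            refine ⟨h.1, ?_⟩
            by_contra h0
            have hz : z ∈ phase (Ici 0) \ (R ∪ range γ) := hXV ▸ h
            exact hz.2 (Or.inl (hlow z (mem_phase.1 h.2) (by
              simp only [mem_ofPred_eq, not_lt] at h0; linarith)))
          · exact fun h => ⟨h.1, mem_phase.2 (mem_Ici.2 (le_of_lt h.2))⟩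
        rw [this]
        exact hV.inter hO
  refine ⟨hopen.1, hopen.2, ?_, ?_, ?_⟩
  · rw [disjoint_union_left]
    refine ⟨hR.disjoint, ?_⟩
    rw [Set.disjoint_right]
    rintro _ ⟨t, rfl⟩ h
    exact h (mem_phase.2 (interior_subset (hi t)))
  · exact hR.subset_closure.trans (closure_mono subset_union_left)
  · rw [ext_eq]
    exact hR.subset_closure_exterior

/-- Bijectivity carries the exterior of R to the exterior of the image, and T is open at interior
points. The delicate place is the line ψ = 0, near which the image of R has to fill a whole strip.
-/
lemma IsGeneratedBy.isBoundedBy_image (hT : IsGeneratedBy J f T)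
    (hR : IsDomainBoundedBy J γ R) (hJ : J = univ ∨ J = Ici 0)
    (hγ : IsPeriodicCurve γ) (hi : ∀ t, (γ t).2 ∈ interior J) :
    IsBoundedBy (T '' R ∪ (phase J)ᶜ) (fun t => T (γ t)) := by
  have hB := hR.isBoundedBy hJ hγ hi
  have hTγ := hT.isPeriodicCurve_comp hJ hγ hi
  set X := phase J \ (R ∪ range γ) with hX
  have hXo : IsOpen X := by
    have := hB.isOpen_ext
    rwa [ext_eq] at this
  have hXi : ∀ z ∈ X, z.2 ∈ interior J := by
    intro z hz
    have h1 : phase J ∈ 𝓝 z := mem_of_superset (hXo.mem_nhds hz) (fun y hy => hy.1)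
    have h2 : Tendsto (fun x : ℝ => (z.1, x)) (𝓝 z.2) (𝓝 z) := by
      have : Continuous (fun x : ℝ => (z.1, x)) := by fun_prop
      exact this.continuousAt
    rw [mem_interior_iff_mem_nhds]
    filter_upwards [h2 h1] with x hx using mem_phase.1 hx
  have hext : (T '' R ∪ (phase J)ᶜ ∪ range (fun t => T (γ t)))ᶜ = T '' X := by
    rw [ext_eq]
    ext z
    constructor
    · rintro ⟨hz, hz'⟩
      obtain ⟨w, hw, rfl⟩ := hT.bijOn.surjOn hz
      refine ⟨w, ⟨hw, ?_⟩, rfl⟩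
      rintro (h | ⟨t, rfl⟩)
      · exact hz' (Or.inl ⟨w, h, rfl⟩)
      · exact hz' (Or.inr ⟨t, rfl⟩)
    · rintro ⟨w, hw, rfl⟩
      refine ⟨hT.bijOn.mapsTo hw.1, ?_⟩
      rintro (⟨y, hy, hyw⟩ | ⟨t, ht⟩)
      · have := hT.bijOn.injOn (hR.subset hy) hw.1 hyw
        exact hw.2 (Or.inl (this ▸ hy))
      · have := hT.bijOn.injOn (mem_phase.2 (interior_subset (hi t))) hw.1 ht
        exact hw.2 (Or.inr ⟨t, this⟩)
  have hXo' : IsOpen (T '' X) := hT.isOpen_image hXo hXi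
  -- Openness of images is available only at interior points of the phase space, so the boundary
  -- line is treated separately.
  set R' := R ∩ {z | z.2 ∈ interior J} with hR'
  have hRo : IsOpen R' := by
    have : R' = (R ∪ (phase J)ᶜ) ∩ {z | z.2 ∈ interior J} := by
      ext z
      simp only [hR', mem_inter_iff, mem_union, mem_compl_iff, mem_phase, mem_ofPred_eq]
      exact ⟨fun h => ⟨Or.inl h.1, h.2⟩, fun h =>
        ⟨h.1.resolve_right (fun h' => h' (interior_subset h.2)), h.2⟩⟩
    rw [this]
    exact hB.isOpen.inter (isOpen_interior.preimage continuous_snd)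
  have hTRo : IsOpen (T '' R') := hT.isOpen_image hRo (fun z hz => hz.2)
  refine ⟨?_, hext ▸ hXo', ?_, ?_, ?_⟩
  · rcases hJ with rfl | rfl
    · have h1 : R' = R := by simp [hR']
      have h2 : phase (univ : Set ℝ) = univ := by simp [phase]
      rw [h2, compl_univ, union_empty, ← h1]
      exact hTRo
    · have hi0 : ∀ t, 0 < (γ t).2 := by simpa using hi
      have hTi0 : ∀ t, 0 < (T (γ t)).2 := fun t => by
        simpa using hT.mapsTo_interior (hi t)
      obtain ⟨c, hc, hcγ⟩ := hγ.exists_pos_le_snd hi0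
      obtain ⟨c', hc', hcγ'⟩ := hTγ.exists_pos_le_snd hTi0
      have hlow : ∀ z : ℝ × ℝ, 0 ≤ z.2 → z.2 < c → z ∈ R := fun z h0 h1 =>
        hR.low z (mem_phase.2 h0) (fun t => h1.trans_le (hcγ t))
      have hpos : ∀ w : ℝ × ℝ, 0 < w.2 → w.2 ∈ interior (Ici (0 : ℝ)) := fun w hw => by
        rw [interior_Ici]; exact hw
      -- The strip is connected and covered by the disjoint open sets T(R') and T(X). Points T(0, s)
      -- with small s > 0 lie in it by invariance of the boundary line and come from R, which
      -- excludes T(X).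
      have hband : (univ ×ˢ Ioo 0 c' : Set (ℝ × ℝ)) ⊆ T '' R' := by
        have hdisj : Disjoint (T '' R') (T '' X) := by
          rw [Set.disjoint_left]
          rintro _ ⟨y, hy, rfl⟩ ⟨w, hw, hwy⟩
          have := hT.bijOn.injOn hw.1 (hR.subset hy.1) hwy
          exact hw.2 (Or.inl (this ▸ hy.1))
        have hcov : (univ ×ˢ Ioo 0 c' : Set (ℝ × ℝ)) ⊆ T '' R' ∪ T '' X := by
          rintro z ⟨-, hz⟩
          obtain ⟨w, hw, rfl⟩ := hT.bijOn.surjOn (mem_phase.2 (show z.2 ∈ Ici 0 from hz.1.le))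
          have hwi := hT.mem_interior_of_map (Or.inr rfl) (mem_phase.1 hw) (hpos _ hz.1)
          by_cases h : w ∈ R
          · exact Or.inl ⟨w, ⟨h, hwi⟩, rfl⟩
          · refine Or.inr ⟨w, ⟨hw, ?_⟩, rfl⟩
            rintro (h' | ⟨t, rfl⟩)
            · exact h h'
            · exact absurd hz.2 (not_lt.2 (hcγ' t))
        refine (IsPreconnected.subset_or_subset hTRo hXo' hdisj hcov
          (isPreconnected_univ.prod isPreconnected_Ioo)).resolve_right fun hbad => ?_
        have hcont : Tendsto (fun s : ℝ => (T (0, s)).2) (𝓝[>] 0) (𝓝 0) := by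
          have h1 : ContinuousWithinAt T (phase (Ici 0)) (0, 0) :=
            hT.contDiffOn.continuousOn _ (mem_phase.2 self_mem_Ici)
          have h2 : Tendsto (fun s : ℝ => ((0 : ℝ), s)) (𝓝[>] 0) (𝓝[phase (Ici 0)] (0, 0)) := by
            refine tendsto_nhdsWithin_iff.2 ⟨?_, ?_⟩
            · have : Continuous (fun s : ℝ => ((0 : ℝ), s)) := by fun_prop
              exact this.continuousAt.tendsto.mono_left nhdsWithin_le_nhds
            · filter_upwards [self_mem_nhdsWithin] with s hs
              exact mem_phase.2 (mem_Ici.2 (le_of_lt hs))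
          have h3 := (continuous_snd.tendsto _).comp (h1.tendsto.comp h2)
          rw [hT.snd_map_boundary] at h3
          exact h3
        have hev1 : ∀ᶠ s : ℝ in 𝓝[>] 0, (T (0, s)).2 < c' := hcont.eventually (gt_mem_nhds hc')
        have hev2 : ∀ᶠ s : ℝ in 𝓝[>] 0, s < c := nhdsWithin_le_nhds (gt_mem_nhds hc)
        obtain ⟨s, ⟨hs1, hs2⟩, hs3⟩ := ((hev1.and hev2).and self_mem_nhdsWithin).exists
        have hs3 : 0 < s := hs3
        have hsi := hT.mapsTo_interior (z := (0, s)) (hpos _ hs3)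
        rw [interior_Ici] at hsi
        have hin : T (0, s) ∈ T '' X := hbad ⟨mem_univ _, hsi, hs1⟩
        exact hdisj.le_bot ⟨⟨(0, s), ⟨hlow _ hs3.le hs2, hpos _ hs3⟩, rfl⟩, hin⟩
      have : T '' R ∪ (phase (Ici 0))ᶜ = T '' R' ∪ {z | z.2 < c'} := by
        ext z
        simp only [mem_union, mem_compl_iff, mem_phase, mem_Ici, not_le, mem_ofPred_eq]
        constructor
        · rintro (⟨w, hw, rfl⟩ | h)
          · by_cases hw0 : 0 < w.2
            · exact Or.inl ⟨w, ⟨hw, hpos _ hw0⟩, rfl⟩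
            · right
              have hw2 : w.2 = 0 := le_antisymm (not_lt.1 hw0) (mem_phase.1 (hR.subset hw))
              have hw' : w = (w.1, 0) := Prod.ext rfl hw2
              rw [hw', hT.snd_map_boundary]
              exact hc'
          · exact Or.inr (h.trans hc')
        · rintro (⟨w, hw, rfl⟩ | h)
          · exact Or.inl ⟨w, hw.1, rfl⟩
          · rcases lt_trichotomy z.2 0 with h0 | h0 | h0
            · exact Or.inr h0
            · left
              obtain ⟨w, hw, rfl⟩ := hT.bijOn.surjOn (mem_phase.2 (show z.2 ∈ Ici 0 from h0.ge))
              have hw2 : ¬ 0 < w.2 := fun hw2 => by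
                have := hT.mapsTo_interior (hpos w hw2)
                rw [interior_Ici, h0] at this
                exact lt_irrefl (0 : ℝ) this
              exact ⟨w, hlow w (mem_phase.1 hw) ((not_lt.1 hw2).trans_lt hc), rfl⟩
            · obtain ⟨w, hw, hwz⟩ := hband ⟨mem_univ z.1, h0, h⟩
              exact Or.inl ⟨w, hw.1, hwz⟩
      rw [this]
      exact hTRo.union (isOpen_lt continuous_snd continuous_const)
  · rw [disjoint_union_left]
    constructor
    · rw [Set.disjoint_left]
      rintro _ ⟨w, hw, rfl⟩ ⟨t, ht⟩
      have := hT.bijOn.injOn (mem_phase.2 (interior_subset (hi t))) (hR.subset hw) ht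
      exact hR.disjoint.le_bot ⟨hw, t, this⟩
    · rw [Set.disjoint_right]
      rintro _ ⟨t, rfl⟩ h
      exact h (mem_phase.2 (hT.mapsTo (interior_subset (hi t))))
  · rintro _ ⟨t, rfl⟩
    exact closure_mono subset_union_left
      (mem_closure_image (hT.contDiffAt (hi t)).continuousAt (hR.subset_closure ⟨t, rfl⟩))
  · rintro _ ⟨t, rfl⟩
    rw [hext]
    exact mem_closure_image (hT.contDiffAt (hi t)).continuousAt
      (hR.subset_closure_exterior ⟨t, rfl⟩)

/-- The Gauss–Green formula for `R_C`. -/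
lemma IsDomainBoundedBy.gaussGreen (hR : IsDomainBoundedBy J γ R) (hJ : J = univ ∨ J = Ici 0)
    (hγ : IsPeriodicCurve γ) (hi : ∀ t, (γ t).2 ∈ interior J) :
    ∀ z, GaussGreenAt (R ∪ (phase J)ᶜ) (lineFlux γ fun _ => 1) z := by
  have hB := hR.isBoundedBy hJ hγ hi
  obtain ⟨c, -, hc⟩ := hB.exists_gaussGreen hγ
  obtain ⟨B, hBb⟩ := hγ.exists_bound_snd
  -- Far below the curve the indicator is 1, far above it is 0.
  have : c = 1 - 0 := by
    refine sign_eq_of_ends hγ hB.isOpen.measurableSet hc hBb (fun z hz => ?_) (fun z hz => ?_)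
    · refine indicator_of_mem ?_ _
      by_cases h : z ∈ phase J
      · exact Or.inl (hR.low z h fun t => by linarith [(abs_le.1 (hBb t)).1])
      · exact Or.inr h
    · refine indicator_of_notMem ?_ _
      have hzJ : z ∈ phase J := by
        rw [mem_phase]
        rcases hJ with rfl | rfl
        · exact mem_univ _
        · exact ((abs_nonneg _).trans (hBb 0)).trans hz.le
      rintro (h | h)
      · exact hR.high z hzJ (fun t => by linarith [(abs_le.1 (hBb t)).2]) h
      · exact h hzJ
  rw [this, sub_zero] at hc
  exact hc

/-- The Gauss–Green formula for `T(R_C)`: the map `T` preserves orientation. -/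
lemma IsGeneratedBy.gaussGreen_image (hT : IsGeneratedBy J f T)
    (hR : IsDomainBoundedBy J γ R) (hJ : J = univ ∨ J = Ici 0)
    (hγ : IsPeriodicCurve γ) (hi : ∀ t, (γ t).2 ∈ interior J) :
    ∀ z, GaussGreenAt (T '' R ∪ (phase J)ᶜ) (lineFlux (fun t => T (γ t)) fun _ => 1) z := by
  have hB := hR.isBoundedBy hJ hγ hi
  have hB' := hT.isBoundedBy_image hR hJ hγ hi
  have hTγ := hT.isPeriodicCurve_comp hJ hγ hi
  have hgg := hR.gaussGreen hJ hγ hi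
  obtain ⟨c, hc, hgg'⟩ := hB'.exists_gaussGreen hTγ
  rcases hc with rfl | rfl
  · exact hgg'
  -- With weight -1 a short path leaving `B`-side across the curve in direction N would have an
  -- image entering T(R), since T preserves the orientation of the pair (γ', N). This contradicts
  -- injectivity.
  exfalso
  obtain ⟨t, hreg, hreg'⟩ := ((hγ.reg 0).and (hTγ.reg 0)).exists
  have hside := (hB.regular_side hγ hreg.1 hreg.2).resolve_right fun h => by
    have := hγ.weight_unique h.1 (hgg _); norm_num at this
  have hside' := (hB'.regular_side hTγ hreg'.1 hreg'.2).resolve_left fun h => by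
    have := hTγ.weight_unique h.1 (hgg' _); norm_num at this
  obtain ⟨N, δ, hδ, hgood, -⟩ := hγ.exists_box hreg.1 hreg.2
  have hN := (hgood t ⟨by linarith, by linarith⟩).2
  have hq : HasDerivAt (fun s : ℝ => γ t + s • N) N 0 := by
    simpa using ((hasDerivAt_id (0 : ℝ)).smul_const N).const_add (γ t)
  have hTq : HasDerivAt (fun s : ℝ => T (γ t + s • N)) (fderiv ℝ T (γ t) N) 0 := by
    have h1 : HasFDerivAt T (fderiv ℝ T (γ t)) (γ t + (0 : ℝ) • N) := by
      simpa using hT.hasFDerivAt (hi t)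
    exact h1.comp_hasDerivAt (0 : ℝ) hq
  have ev1 := hside.2 _ N hq (by simp) hN
  have ev2 := hside'.2 _ _ hTq (by simp) (by
    rw [(hT.deriv_comp (hi t) (hreg.1.differentiableAt (by simp))).deriv, hT.cross_fderiv (hi t)]
    exact hN)
  have ev3 : ∀ᶠ s : ℝ in 𝓝[>] 0, γ t + s • N ∈ phase J := by
    have : Tendsto (fun s : ℝ => γ t + s • N) (𝓝[>] 0) (𝓝 (γ t)) := by
      have := hq.continuousAt.tendsto.mono_left (nhdsWithin_le_nhds (s := Ioi 0))
      simpa using this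
    exact this (phase_mem_nhds (hi t))
  obtain ⟨s, ⟨h1, h2⟩, h3⟩ := ((ev1.and ev2).and ev3).exists
  rcases h2 with ⟨w, hw, hwT⟩ | h2
  · have := hT.bijOn.injOn (hR.subset hw) h3 hwT
    exact h1 (Or.inl (this ▸ hw))
  · exact h2 (hT.bijOn.mapsTo h3)

/-- `T(R_C)` does not reach the upper end of the cylinder. -/
lemma IsGeneratedBy.exists_bound_image (hT : IsGeneratedBy J f T)
    (hR : IsDomainBoundedBy J γ R) (hJ : J = univ ∨ J = Ici 0)
    (hγ : IsPeriodicCurve γ) (hi : ∀ t, (γ t).2 ∈ interior J) :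
    ∃ B, ∀ z ∈ T '' R ∪ (phase J)ᶜ, z.2 ≤ B := by
  have hB' := hT.isBoundedBy_image hR hJ hγ hi
  have hTγ := hT.isPeriodicCurve_comp hJ hγ hi
  have hgg := hT.gaussGreen_image hR hJ hγ hi
  obtain ⟨B, hBb⟩ := hTγ.exists_bound_snd
  -- A horizontal strip that misses the image curve is connected, so the indicator is constant on
  -- it.
  have hdich : ∀ I : Set ℝ, I.OrdConnected → (∀ t, (T (γ t)).2 ∉ I) → ∃ l : ℝ, (l = 0 ∨ l = 1) ∧
      ∀ z : ℝ × ℝ, z.2 ∈ I → (T '' R ∪ (phase J)ᶜ).indicator (fun _ => (1 : ℝ)) z = l := by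
    intro I hI hIt
    have hcov : (univ ×ˢ I : Set (ℝ × ℝ)) ⊆ (T '' R ∪ (phase J)ᶜ) ∪
        (T '' R ∪ (phase J)ᶜ ∪ range (fun t => T (γ t)))ᶜ := by
      rintro z ⟨-, hz⟩
      by_cases h : z ∈ T '' R ∪ (phase J)ᶜ
      · exact Or.inl h
      · refine Or.inr fun h' => ?_
        rcases h' with h' | ⟨t, rfl⟩
        · exact h h'
        · exact hIt t hz
    rcases IsPreconnected.subset_or_subset hB'.isOpen hB'.isOpen_ext IsBoundedBy.disjoint_ext hcov
      (isPreconnected_univ.prod hI.isPreconnected) with h | h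
    · exact ⟨1, Or.inr rfl, fun z hz => indicator_of_mem (h ⟨mem_univ _, hz⟩) _⟩
    · exact ⟨0, Or.inl rfl, fun z hz => indicator_of_notMem
        (fun h' => h (show z ∈ univ ×ˢ I from ⟨mem_univ _, hz⟩) (Or.inl h')) _⟩
  obtain ⟨l, hl, hlow⟩ := hdich (Iio (-B)) ordConnected_Iio
    (fun t h => by linarith [(abs_le.1 (hBb t)).1, mem_Iio.1 h])
  obtain ⟨h, hh, hhigh⟩ := hdich (Ioi B) ordConnected_Ioi
    (fun t h => by linarith [(abs_le.1 (hBb t)).2, mem_Ioi.1 h])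
  -- The sign is already known to be 1, so 1 = l - h with l, h ∈ {0, 1}, which leaves h = 0.
  have e := sign_eq_of_ends hTγ hB'.isOpen.measurableSet hgg hBb hlow hhigh
  have hh0 : h = 0 := by
    rcases hl with hl | hl <;> rcases hh with hh | hh <;> rw [hl, hh] at e <;> first | exact hh | norm_num at e
  refine ⟨B, fun z hz => ?_⟩
  by_contra hlt
  have := hhigh z (not_le.1 hlt)
  rw [indicator_of_mem hz, hh0] at this
  norm_num at this

end EscapeArea

end

/-! ### Sums over interlaced orbits; Gauss–Green for a difference of domains. -/

noncomputable section

namespace EscapeArea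

/-- Sums of a periodic function along an arithmetic progression that exhausts the residues. -/
lemma sum_progression_eq {m : ℕ} (hm : 0 < m) {h : ℤ → ℝ} (hp : ∀ i, h (i + m) = h i) {n : ℤ}
    (hn : ∀ x : ℤ, ∃ j < m, ∃ k : ℤ, x = n * (j : ℕ) + m * k) (c : ℤ) :
    ∑ j ∈ Finset.range m, h (c + n * j) = ∑ j ∈ Finset.range m, h j := by
  have : NeZero m := ⟨hm.ne'⟩
  have hper : Function.Periodic h (m : ℤ) := hp
  have hH : ∀ x y : ℤ, (x : ZMod m) = (y : ZMod m) → h x = h y := by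
    intro x y hxy
    obtain ⟨k, hk⟩ := (ZMod.intCast_eq_intCast_iff_dvd_sub x y m).1 hxy
    have hy : y = x + k * m := by linarith
    rw [hy]
    exact (hper.int_mul k x).symm
  have key : ∀ (n c : ℤ), (∀ x : ℤ, ∃ j < m, ∃ k : ℤ, x = n * (j : ℕ) + m * k) →
      ∑ j ∈ Finset.range m, h (c + n * j) = ∑ z : ZMod m, h (z.val : ℤ) := by
    intro n c hn
    rw [Finset.sum_range]
    -- The progression has m terms and meets every residue class, so it is a bijection onto `ZMod
    -- m`.
    let φ : Fin m → ZMod m := fun j => ((c + n * (j : ℕ) : ℤ) : ZMod m)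
    have hsurj : Function.Surjective φ := by
      intro z
      obtain ⟨j, hj, k, hk⟩ := hn ((z.val : ℤ) - c)
      refine ⟨⟨j, hj⟩, ?_⟩
      have e : c + n * (j : ℕ) = (z.val : ℤ) - m * k := by linarith
      simp only [φ, e]
      push_cast
      simp
    have hbij : Function.Bijective φ :=
      (Fintype.bijective_iff_surjective_and_card φ).2 ⟨hsurj, by simp⟩
    rw [← hbij.sum_comp]
    refine Finset.sum_congr rfl fun j _ => hH _ _ ?_
    simp [φ]
  rw [key n c hn]
  have := key 1 0 (fun x => ⟨(x % m).toNat, ?_, x / m, ?_⟩)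
  · rw [← this]
    simp
  · have h1 := Int.emod_nonneg x (b := (m : ℤ)) (by exact_mod_cast hm.ne')
    have h2 := Int.emod_lt_of_pos x (b := (m : ℤ)) (by exact_mod_cast hm)
    omega
  · have h1 := Int.emod_nonneg x (b := (m : ℤ)) (by exact_mod_cast hm.ne')
    have h2 := Int.emod_add_mul_ediv x m
    rw [Int.toNat_of_nonneg h1]
    linarith

lemma sum_range_two_mul (m : ℕ) (F : ℕ → ℝ) :
    ∑ q ∈ Finset.range (2 * m), F q = ∑ x ∈ Finset.range m, (F (2 * x) + F (2 * x + 1)) := by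
  induction m with
  | zero => simp
  | succ m ih =>
    rw [show 2 * (m + 1) = 2 * m + 1 + 1 by ring, Finset.sum_range_succ, Finset.sum_range_succ, ih,
      Finset.sum_range_succ]
    ring

/-- The sum over alternate arcs of the increments of a periodic function is the difference of its
sums over the two interlaced orbits. -/
lemma abs_sum_alternating {m : ℕ} (hm : 0 < m) {g d : ℤ → ℝ} (hg : ∀ i, g (i + 2 * m) = g i)
    (hd : ∀ i, d i = 0 ∨ d i = 1) (hd' : ∀ i, d (i + 1) = 1 - d i) {n iu is : ℤ}
    (hcov : ∀ i : ℤ, (∃ j < m, ∃ k : ℤ, i = iu + 2 * n * (j : ℕ) + 2 * m * k) ∨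
      (∃ j < m, ∃ k : ℤ, i = is + 2 * n * (j : ℕ) + 2 * m * k)) :
    |∑ q ∈ Finset.range (2 * m), d (iu + q) * (g (iu + q + 1) - g (iu + q))|
      = |∑ j ∈ Finset.range m, g (iu + 2 * n * j) - ∑ j ∈ Finset.range m, g (is + 2 * n * j)| := by
  -- All indices of the first orbit have the parity of iu, so iu + 1 belongs to the second orbit,
  -- whose indices have the other parity.
  obtain ⟨x₀, hx₀⟩ : ∃ x₀ : ℤ, is = iu + 1 + 2 * x₀ := by
    rcases hcov (iu + 1) with ⟨j, -, k, h⟩ | ⟨j, -, k, h⟩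
    · exfalso
      have : (1 : ℤ) = 2 * (n * j + m * k) := by linarith
      omega
    · exact ⟨-(n * j + m * k), by linarith⟩
  -- By parity iu + 2x belongs to the first orbit, so every integer x has the form n j + m k; in
  -- effect n and m are coprime.
  have hsurj : ∀ x : ℤ, ∃ j < m, ∃ k : ℤ, x = n * (j : ℕ) + m * k := by
    intro x
    rcases hcov (iu + 2 * x) with ⟨j, hj, k, h⟩ | ⟨j, -, k, h⟩
    · exact ⟨j, hj, k, by linarith⟩
    · exfalso
      have : 2 * (x - x₀ - n * j - m * k) = 1 := by linarith
      omega
  set h : ℤ → ℝ := fun x => g (iu + 2 * x) with hh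
  set h' : ℤ → ℝ := fun x => g (iu + 1 + 2 * x) with hh'
  have hp : ∀ x, h (x + m) = h x := fun x => by
    simp only [hh]
    rw [← hg (iu + 2 * x)]
    congr 1
    ring
  have hp' : ∀ x, h' (x + m) = h' x := fun x => by
    simp only [hh']
    rw [← hg (iu + 1 + 2 * x)]
    congr 1
    ring
  have eu : ∑ j ∈ Finset.range m, g (iu + 2 * n * j) = ∑ j ∈ Finset.range m, h j := by
    rw [← sum_progression_eq hm hp hsurj 0]
    refine Finset.sum_congr rfl fun j _ => ?_
    simp only [hh]
    congr 1
    ring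
  have es : ∑ j ∈ Finset.range m, g (is + 2 * n * j) = ∑ j ∈ Finset.range m, h' j := by
    rw [← sum_progression_eq hm hp' hsurj x₀]
    refine Finset.sum_congr rfl fun j _ => ?_
    simp only [hh', hx₀]
    congr 1
    ring
  have hshift : ∑ j ∈ Finset.range m, h (j + 1) = ∑ j ∈ Finset.range m, h j := by
    have e1 := Finset.sum_range_succ (fun j : ℕ => h j) m
    have e2 := Finset.sum_range_succ' (fun j : ℕ => h j) m
    have e3 := hp 0
    rw [zero_add] at e3
    push_cast at e1 e2
    linarith
  have hdx : ∀ x : ℕ, d (iu + 2 * x) = d iu := by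
    intro x
    induction x with
    | zero => simp
    | succ x ih =>
      have e : iu + 2 * ((x + 1 : ℕ) : ℤ) = iu + 2 * x + 1 + 1 := by push_cast; ring
      rw [e, hd', hd', ih]
      ring
  have e0 : ∑ q ∈ Finset.range (2 * m), d (iu + q) * (g (iu + q + 1) - g (iu + q))
      = ∑ x ∈ Finset.range m, (d iu * (h' x - h x) + (1 - d iu) * (h (x + 1) - h' x)) := by
    rw [sum_range_two_mul]
    refine Finset.sum_congr rfl fun x _ => ?_
    have a1 : d (iu + ((2 * x : ℕ) : ℤ)) = d iu := by push_cast; exact hdx x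
    have a2 : d (iu + ((2 * x + 1 : ℕ) : ℤ)) = 1 - d iu := by
      have : iu + ((2 * x + 1 : ℕ) : ℤ) = iu + 2 * x + 1 := by push_cast; ring
      rw [this, hd', hdx]
    have a3 : g (iu + ((2 * x : ℕ) : ℤ) + 1) = h' x := by
      simp only [hh']; congr 1; push_cast; ring
    have a4 : g (iu + ((2 * x : ℕ) : ℤ)) = h x := by
      simp only [hh]; congr 1
    have a5 : g (iu + ((2 * x + 1 : ℕ) : ℤ) + 1) = h (x + 1) := by
      simp only [hh]; congr 1; push_cast; ring
    have a6 : g (iu + ((2 * x + 1 : ℕ) : ℤ)) = h' x := by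
      simp only [hh']; congr 1; push_cast; ring
    rw [a1, a2, a3, a4, a5, a6]
  rw [e0, eu, es, Finset.sum_add_distrib, ← Finset.mul_sum, ← Finset.mul_sum,
    Finset.sum_sub_distrib, Finset.sum_sub_distrib, hshift]
  -- Whether the even or the odd arcs are counted affects only the sign.
  rcases hd iu with h0 | h1
  · rw [h0]; congr 1; ring
  · rw [h1, abs_sub_comm]; congr 1; ring

lemma setIntegral_fderiv_congr {E E' U : Set (ℝ × ℝ)} (hE : MeasurableSet E)
    (hE' : MeasurableSet E') (h : ∀ z ∈ U, z ∈ E ↔ z ∈ E') {φ : ℝ × ℝ → ℝ} (hs : tsupport φ ⊆ U)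
    (v : ℝ × ℝ) : ∫ x in E, fderiv ℝ φ x v = ∫ x in E', fderiv ℝ φ x v := by
  rw [← integral_indicator hE, ← integral_indicator hE']
  refine integral_congr_ae (ae_of_all _ fun z => ?_)
  by_cases hz : z ∈ U
  · by_cases h1 : z ∈ E
    · simp only [indicator_of_mem h1, indicator_of_mem ((h z hz).1 h1)]
    · simp only [indicator_of_notMem h1, indicator_of_notMem (mt (h z hz).2 h1)]
  · have : fderiv ℝ φ z = 0 := fderiv_of_notMem_tsupport ℝ (fun h => hz (hs h))
    simp [indicator, this]

open Classical in
/-- The indicator of a set along a curve. -/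
def weightIn (E : Set (ℝ × ℝ)) (a : ℝ → ℝ × ℝ) (t : ℝ) : ℝ := if a t ∈ E then 1 else 0

lemma weightIn_of_mem {E : Set (ℝ × ℝ)} {a : ℝ → ℝ × ℝ} {t : ℝ} (h : a t ∈ E) :
    weightIn E a t = 1 := if_pos h

lemma weightIn_of_notMem {E : Set (ℝ × ℝ)} {a : ℝ → ℝ × ℝ} {t : ℝ} (h : a t ∉ E) :
    weightIn E a t = 0 := if_neg h

lemma abs_weightIn_le (E : Set (ℝ × ℝ)) (a : ℝ → ℝ × ℝ) (t : ℝ) : |weightIn E a t| ≤ 1 := by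
  unfold weightIn; split_ifs <;> simp

lemma measurable_weightIn {E : Set (ℝ × ℝ)} (hE : MeasurableSet E) {a : ℝ → ℝ × ℝ}
    (ha : Continuous a) : Measurable (weightIn E a) :=
  Measurable.ite (ha.measurable hE) measurable_const measurable_const

/-- The Gauss–Green formula for the difference of two domains away from the common points of
their boundary curves. -/
lemma gaussGreenAt_diff {A B : Set (ℝ × ℝ)} {a b : ℝ → ℝ × ℝ} (hA : IsBoundedBy A a)
    (hB : IsBoundedBy B b) (hgA : ∀ z, GaussGreenAt A (lineFlux a fun _ => 1) z)
    (hgB : ∀ z, GaussGreenAt B (lineFlux b fun _ => 1) z) {z : ℝ × ℝ}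
    (hz : z ∉ range a ∩ range b) :
    GaussGreenAt (A \ B)
      (fun v φ => lineFlux a (weightIn Bᶜ a) v φ - lineFlux b (weightIn A b) v φ) z := by
  have hAm := hA.isOpen.measurableSet
  have hBm := hB.isOpen.measurableSet
  have hABm : MeasurableSet (A \ B) := hAm.diff hBm
  have hzero : ∀ {U : Set (ℝ × ℝ)} {c : ℝ → ℝ × ℝ} {w : ℝ → ℝ}, (∀ t, c t ∈ U → w t = 0) →
      ∀ {φ : ℝ × ℝ → ℝ}, tsupport φ ⊆ U → ∀ v, lineFlux c w v φ = 0 := by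
    intro U c w h φ hs v
    rw [lineFlux_congr h hs, lineFlux_zero]
  -- At most one of the two curves passes through z. Near z the set A \ B is therefore the
  -- complement of B, or A, or empty; in the first case the flux through b enters with a minus sign.
  by_cases hzb : z ∈ range b
  · have hza : z ∉ range a := fun h => hz ⟨h, hzb⟩
    by_cases hzA : z ∈ A
    · obtain ⟨U, hU, hg⟩ := hgB z
      refine ⟨U ∩ A, inter_mem hU (hA.isOpen.mem_nhds hzA), fun φ hφ hs v => ?_⟩
      beta_reduce
      rw [setIntegral_fderiv_congr hABm hBm.compl (fun x hx => ⟨fun h => h.2, fun h => ⟨hx.2, h⟩⟩) hs,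
        setIntegral_compl hBm (hφ.fderiv_apply v).integrable, hφ.integral_fderiv,
        hg φ hφ (hs.trans inter_subset_left),
        hzero (U := U ∩ A) (fun t ht => (hA.disjoint.le_bot ⟨ht.2, t, rfl⟩).elim) hs,
        lineFlux_congr (U := U ∩ A) (w := weightIn A b) (w' := fun _ => 1)
          (fun t ht => weightIn_of_mem ht.2) hs]
    · have hn := hA.isOpen_ext.mem_nhds (show z ∈ (A ∪ range a)ᶜ from fun h => h.elim hzA hza)
      refine ⟨_, hn, fun φ hφ hs v => ?_⟩
      beta_reduce
      rw [integral_fderiv_eq_zero_of_subset (Or.inr ?_) hφ hs,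
        hzero (fun t ht => (ht (Or.inr ⟨t, rfl⟩)).elim) hs,
        hzero (U := (A ∪ range a)ᶜ) (w := weightIn A b)
          (fun t ht => weightIn_of_notMem (fun h => ht (Or.inl h))) hs, sub_zero]
      rw [Set.disjoint_left]
      exact fun x hx hx' => hx (Or.inl hx'.1)
  · by_cases hzB : z ∈ B
    · refine ⟨_, hB.isOpen.mem_nhds hzB, fun φ hφ hs v => ?_⟩
      beta_reduce
      rw [integral_fderiv_eq_zero_of_subset (Or.inr ?_) hφ hs,
        hzero (w := weightIn Bᶜ a) (fun t ht => weightIn_of_notMem (fun h => h ht)) hs,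
        hzero (fun t ht => (hB.disjoint.le_bot ⟨ht, t, rfl⟩).elim) hs, sub_zero]
      rw [Set.disjoint_left]
      exact fun x hx hx' => hx'.2 hx
    · have hn := hB.isOpen_ext.mem_nhds (show z ∈ (B ∪ range b)ᶜ from fun h => h.elim hzB hzb)
      obtain ⟨U, hU, hg⟩ := hgA z
      refine ⟨_, inter_mem hU hn, fun φ hφ hs v => ?_⟩
      beta_reduce
      rw [setIntegral_fderiv_congr hABm hAm (U := U ∩ (B ∪ range b)ᶜ)
          (fun x hx => ⟨fun h => h.1, fun h => ⟨h, fun h' => hx.2 (Or.inl h')⟩⟩) hs,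
        hg φ hφ (hs.trans inter_subset_left),
        hzero (U := U ∩ (B ∪ range b)ᶜ) (c := b) (fun t ht => (ht.2 (Or.inr ⟨t, rfl⟩)).elim) hs,
        lineFlux_congr (w := weightIn Bᶜ a) (w' := fun _ => 1)
          (fun t ht => weightIn_of_mem (fun h' => ht.2 (Or.inl h'))) hs, sub_zero]

/-- Along an arc that avoids the boundary curve of `E`, membership in `E` is constant. -/
lemma IsBoundedBy.weightIn_const {E : Set (ℝ × ℝ)} {a b : ℝ → ℝ × ℝ} (hE : IsBoundedBy E b)
    (ha : Continuous a) {l r : ℝ} (h : ∀ t ∈ Ioo l r, a t ∉ range b) :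
    (∀ t ∈ Ioo l r, a t ∈ E) ∨ (∀ t ∈ Ioo l r, a t ∉ E) := by
  have hcov : a '' Ioo l r ⊆ E ∪ (E ∪ range b)ᶜ := by
    rintro _ ⟨t, ht, rfl⟩
    by_cases h' : a t ∈ E
    · exact Or.inl h'
    · exact Or.inr fun h'' => h''.elim h' (h t ht)
  rcases IsPreconnected.subset_or_subset hE.isOpen hE.isOpen_ext IsBoundedBy.disjoint_ext hcov
    (isPreconnected_Ioo.image _ ha.continuousOn) with h1 | h1
  · exact Or.inl fun t ht => h1 ⟨t, ht, rfl⟩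
  · exact Or.inr fun t ht h2 => h1 ⟨t, ht, rfl⟩ (Or.inl h2)

end EscapeArea

end

/-! ### The turnstile and the flux formula. -/

noncomputable section

namespace EscapeArea

variable {J : Set ℝ} {f : ℝ → ℝ → ℝ} {T : ℝ × ℝ → ℝ × ℝ} {γ : ℝ → ℝ × ℝ} {R : Set (ℝ × ℝ)}
  {m : ℕ} {u s : ℝ × ℝ} {t : ℤ → ℝ}

lemma IsPeriodicCurve.deriv_shift (hγ : IsPeriodicCurve γ) (τ : ℝ) :
    deriv γ (τ + 1) = deriv γ τ := by
  have h1 : (fun s => γ (s + 1)) = fun s => γ s + (1, 0) := funext hγ.shift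
  rw [← deriv_comp_add_const, h1, deriv_add_const]

lemma IsPeriodicCurve.intervalIntegrable_snd_mul (hγ : IsPeriodicCurve γ) {w : ℝ → ℝ}
    (hw : Measurable w) {C : ℝ} (hC : ∀ t, |w t| ≤ C) (x y : ℝ) :
    IntervalIntegrable (fun τ => w τ * ((γ τ).2 * (deriv γ τ).1)) volume x y := by
  obtain ⟨M, hM0, hM⟩ := hγ.ae_abs_cross_le (0, 1)
  obtain ⟨B, hB⟩ := hγ.exists_bound_snd
  refine IntervalIntegrable.mono_fun' (g := fun _ => C * (B * M)) intervalIntegrable_const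
    (hw.mul (hγ.cont.snd.measurable.mul (measurable_deriv γ).fst)).aestronglyMeasurable ?_
  filter_upwards [ae_restrict_of_ae hM] with τ hτ
  have h2 : |(deriv γ τ).1| ≤ M := by simpa [cross] using hτ
  rw [Real.norm_eq_abs, abs_mul, abs_mul]
  have h3 := hC τ
  have h4 := hB τ
  gcongr
  · exact (abs_nonneg _).trans h3
  · exact (abs_nonneg _).trans h4

/-- The difference of the line integrals of `ψ dθ` along an arc and its image. -/
lemma IsGeneratedBy.integral_primitive (hT : IsGeneratedBy J f T) (hJ : J = univ ∨ J = Ici 0)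
    (hγ : IsPeriodicCurve γ) (hi : ∀ t, (γ t).2 ∈ interior J) (x y : ℝ) :
    ∫ τ in x..y, ((T (γ τ)).2 * (deriv (fun t => T (γ t)) τ).1 - (γ τ).2 * (deriv γ τ).1)
      = primitive f T (γ y) - primitive f T (γ x) := by
  have hTγ := hT.isPeriodicCurve_comp hJ hγ hi
  refine integral_eq_of_hasDerivAt_off_countable (fun τ => primitive f T (γ τ)) _
    hγ.countable_irregular ?_ (fun τ hτ => ?_) ?_
  · exact fun τ _ => ((hT.hasFDerivAt_primitive (hi τ)).continuousAt.comp
      hγ.cont.continuousAt).continuousWithinAt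
  · have hτ' : ContDiffAt ℝ 1 γ τ ∧ deriv γ τ ≠ 0 := not_not.1 hτ.2
    have hd := hτ'.1.differentiableAt (by simp)
    have h := (hT.hasFDerivAt_primitive (hi τ)).comp_hasDerivAt τ hd.hasDerivAt
    rw [(hT.deriv_comp (hi τ) hd).deriv]
    simpa [Function.comp_def] using h
  · have h1 := hTγ.intervalIntegrable_snd_mul (w := fun _ => 1) measurable_const (C := 1)
      (by simp) x y
    have h2 := hγ.intervalIntegrable_snd_mul (w := fun _ => 1) measurable_const (C := 1)
      (by simp) x y
    simpa using h1.sub h2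

namespace IsTurnstile

lemma shift_mul (h : IsTurnstile T m u s γ R t) (i q : ℤ) : t (i + 2 * m * q) = t i + q := by
  induction q with
  | zero => simp
  | succ q ih =>
    have : i + 2 * (m : ℤ) * (q + 1) = i + 2 * m * q + 2 * m := by ring
    rw [this, h.shift, ih]
    push_cast
    ring
  | pred q ih =>
    have h1 := h.shift (i + 2 * (m : ℤ) * (-q - 1))
    have : i + 2 * (m : ℤ) * (-q - 1) + 2 * m = i + 2 * m * -q := by ring
    rw [this, ih] at h1
    push_cast at h1 ⊢
    linarith

/-- With 2m indices per turn, the parameters fall into finitely many classes modulo 1, each of them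
discrete. -/
lemma eventually_ne (h : IsTurnstile T m u s γ R t) (hm : 0 < m) (τ : ℝ) :
    ∀ᶠ σ in 𝓝[≠] τ, ∀ i, σ ≠ t i := by
  have : ∀ᶠ σ in 𝓝[≠] τ, ∀ r ∈ Finset.range (2 * m), ∀ k : ℤ, σ ≠ t (r : ℤ) + k :=
    (Filter.eventually_all_finset _).2 fun r _ => eventually_ne_add_int _ τ
  filter_upwards [this] with σ hσ i hi
  have hpos : (0 : ℤ) < 2 * m := by exact_mod_cast Nat.mul_pos two_pos hm
  have h1 := Int.emod_nonneg i hpos.ne'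
  have h2 := Int.emod_lt_of_pos i hpos
  have h3 := Int.emod_add_mul_ediv i (2 * m)
  refine hσ (i % (2 * m)).toNat (Finset.mem_range.2 (by omega)) (i / (2 * m)) ?_
  rw [Int.toNat_of_nonneg h1, ← h.shift_mul, h3, hi]

lemma notMem_Ioo (h : IsTurnstile T m u s γ R t) {i j : ℤ} : t j ∉ Ioo (t i) (t (i + 1)) := by
  rintro ⟨h1, h2⟩
  have h3 := h.strictMono.lt_iff_lt.1 h1
  have h4 := h.strictMono.lt_iff_lt.1 h2
  omega

end IsTurnstile

lemma orbit_mem_phase (hT : IsGeneratedBy J f T) {z : ℝ × ℝ} (hz : z ∈ phase J) (j : ℕ) :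
    T^[j] z ∈ phase J := by
  induction j with
  | zero => exact hz
  | succ j ih =>
    rw [Function.iterate_succ_apply']
    exact hT.bijOn.mapsTo ih

lemma periodicSum_eq (hT : IsGeneratedBy J f T) {z : ℝ × ℝ} (hz : z ∈ phase J) (m : ℕ) :
    periodicSum f T m z = ∑ j ∈ Finset.range m, primitive f T (T^[j] z) := by
  refine Finset.sum_congr rfl fun j _ => ?_
  rw [Function.iterate_succ_apply', hT.primitive_eq (mem_phase.1 (orbit_mem_phase hT hz j))]

lemma mixedSum_eq (z : ℝ × ℝ) (m : ℕ) :
    mixedSum f T m z = ∑ j ∈ Finset.range m, primitive f T (T^[j] z) := by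
  refine Finset.sum_congr rfl fun j _ => ?_
  rw [Function.iterate_succ_apply']
  rfl

/-- The flux formula. -/
theorem escapeArea_eq (hJ : J = univ ∨ J = Ici 0) (hT : IsGeneratedBy J f T) {n : ℤ}
    (hm : 0 < m) (hu : IsPeriodicOfType J T n m u) (hs : IsPeriodicOfType J T n m s)
    (hC : IsClosedCurve J γ) (hR : IsDomainBoundedBy J γ R) (ht : IsTurnstile T m u s γ R t) :
    escapeArea T R = ENNReal.ofReal |periodicSum f T m u - periodicSum f T m s| := by
  have hγ := hC.isPeriodicCurve
  have hi := hC.mem_interior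
  have hTγ := hT.isPeriodicCurve_comp hJ hγ hi
  have hγph : ∀ τ, γ τ ∈ phase J := fun τ => mem_phase.2 (interior_subset (hi τ))
  set b : ℝ → ℝ × ℝ := fun τ => T (γ τ) with hb
  -- The complement of the phase space is added to both sets, to make them open in the plane, and
  -- cancels in A \ B.
  set A := T '' R ∪ (phase J)ᶜ with hA
  set B := R ∪ (phase J)ᶜ with hBdef
  have hAb : IsBoundedBy A b := hT.isBoundedBy_image hR hJ hγ hi
  have hBb : IsBoundedBy B γ := hR.isBoundedBy hJ hγ hi
  have hAm := hAb.isOpen.measurableSet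
  have hBm := hBb.isOpen.measurableSet
  have hrange : range b = T '' range γ := by
    ext z
    simp [hb]
  -- the order of the points
  obtain ⟨k, hk⟩ := ht.order
  have hTph : ∀ τ, b τ ∈ phase J := fun τ => hT.bijOn.mapsTo (hγph τ)
  have hcross1 : ∀ τ, b τ ∈ range γ → ∃ i, τ = t i := by
    intro τ hτ
    have h1 : b τ ∈ range γ ∩ T '' range γ := ⟨hτ, γ τ, ⟨τ, rfl⟩, rfl⟩
    rw [ht.inter] at h1
    obtain ⟨j, hj⟩ := h1
    -- The common point γ (t j) is the image of γ (t (j - k)), and T ∘ γ is injective.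
    refine ⟨j - k, ?_⟩
    have h2 := hk (j - k)
    rw [sub_add_cancel] at h2
    exact hγ.inj (hT.bijOn.injOn (hγph τ) (hγph _) (hj.symm.trans h2.symm))
  have hcross2 : ∀ τ, γ τ ∈ range b → ∃ i, τ = t i := by
    intro τ hτ
    have h1 : γ τ ∈ range γ ∩ T '' range γ := ⟨⟨τ, rfl⟩, hrange ▸ hτ⟩
    rw [ht.inter] at h1
    obtain ⟨j, hj⟩ := h1
    exact ⟨j, hγ.inj hj.symm⟩
  have hiter : ∀ (j : ℕ) (i : ℤ), T^[j] (γ (t i)) = γ (t (i + j * k)) := by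
    intro j
    induction j with
    | zero => simp
    | succ j ih =>
      intro i
      rw [Function.iterate_succ_apply, hk, ih]
      congr 2
      push_cast
      ring
  have hγint : ∀ (τ : ℝ) (q : ℤ), γ (τ + q) = ((γ τ).1 + q, (γ τ).2) := by
    intro τ q
    induction q with
    | zero => simp
    | succ q ih =>
      have e : τ + ((q + 1 : ℤ) : ℝ) = τ + (q : ℤ) + 1 := by push_cast; ring
      rw [e, hC.shift, ih]
      push_cast
      ext <;> simp
      ring
    | pred q ih =>
      have h1 := hC.shift (τ + ((-q - 1 : ℤ) : ℝ))
      have e : τ + ((-q - 1 : ℤ) : ℝ) + 1 = τ + ((-q : ℤ) : ℝ) := by push_cast; ring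
      rw [e, ih] at h1
      have h2 := congrArg Prod.fst h1
      have h3 := congrArg Prod.snd h1
      simp only at h2 h3
      refine Prod.ext ?_ h3.symm
      push_cast at h2 ⊢
      linarith
  have hfind : ∀ z, z ∈ orbitLifts T m u ∪ orbitLifts T m s → ∃ i, γ (t i) = z := by
    intro z hz
    rw [← ht.points] at hz
    exact hz
  obtain ⟨iu, hiu⟩ := hfind u (Or.inl ⟨0, hm, 0, by simp⟩)
  obtain ⟨is, his⟩ := hfind s (Or.inr ⟨0, hm, 0, by simp⟩)
  -- Applying T m times moves the index by m k, while the translation by n turns moves it by 2 m n.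
  have hk2 : k = 2 * n := by
    have h1 := hu.2
    rw [← hiu, hiter, ← hγint, ← ht.shift_mul] at h1
    have h2 := ht.strictMono.injective (hγ.inj h1)
    have h3 : (m : ℤ) * k = m * (2 * n) := by linarith
    exact mul_left_cancel₀ (by exact_mod_cast hm.ne') h3
  have hgA := hT.gaussGreen_image hR hJ hγ hi
  have hgB := hR.gaussGreen hJ hγ hi
  have hwAm : Measurable (weightIn Bᶜ b) := measurable_weightIn hBm.compl hTγ.cont
  have hwBm : Measurable (weightIn A γ) := measurable_weightIn hAm hγ.cont
  set L : ℝ × ℝ → (ℝ × ℝ → ℝ) → ℝ :=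
    fun v φ => lineFlux b (weightIn Bᶜ b) v φ - lineFlux γ (weightIn A γ) v φ with hL
  have hLb : IsBoundaryFunctional L :=
    (hTγ.isBoundaryFunctional hwAm.aestronglyMeasurable (abs_weightIn_le _ _)).sub
      (hγ.isBoundaryFunctional hwBm.aestronglyMeasurable (abs_weightIn_le _ _))
  -- The common points of the two curves are isolated, hence removable.
  have hgg : ∀ p, GaussGreenAt (A \ B) L p := by
    intro p
    refine gaussGreenAt_of_punctured hLb ?_
    have hev : ∀ᶠ y in 𝓝[≠] p, y ∉ range b ∩ range γ := by
      by_cases hp : p ∈ range γ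
      · obtain ⟨τ, rfl⟩ := hp
        have h1 := ht.eventually_ne hm τ
        rw [eventually_nhdsWithin_iff] at h1
        obtain ⟨U, hU, hloc⟩ := hγ.exists_nhds τ h1
        filter_upwards [nhdsWithin_le_nhds hU, self_mem_nhdsWithin] with y hyU hyne hy
        obtain ⟨σ, rfl⟩ := hy.2
        obtain ⟨i, hi'⟩ := hcross2 σ hy.1
        exact hloc σ hyU (fun h => hyne (by rw [mem_singleton_iff.1 h]; rfl)) i hi'
      · have h1 := hγ.isClosedEmbedding.isClosed_range.isOpen_compl.mem_nhds hp
        filter_upwards [nhdsWithin_le_nhds h1] with y hy hy' using hy hy'.2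
    filter_upwards [hev] with y hy using gaussGreenAt_diff hAb hBb hgA hgB hy
  -- the weights are constant on the arcs
  have hwc : ∀ (E : Set (ℝ × ℝ)) (a c : ℝ → ℝ × ℝ), IsBoundedBy E c → Continuous a →
      (∀ τ, a τ ∈ range c → ∃ i, τ = t i) → ∀ i, (∀ τ ∈ Ioo (t i) (t (i + 1)), a τ ∈ E) ∨
        (∀ τ ∈ Ioo (t i) (t (i + 1)), a τ ∉ E) := by
    intro E a c hE ha hcr i
    refine hE.weightIn_const ha fun τ hτ hmem => ?_
    obtain ⟨j, rfl⟩ := hcr τ hmem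
    exact ht.notMem_Ioo hτ
  have hd : ∀ i, ∃ d : ℝ, (d = 0 ∨ d = 1) ∧ ∀ τ ∈ Ioo (t i) (t (i + 1)), weightIn Bᶜ b τ = d := by
    intro i
    rcases hwc B b γ hBb hTγ.cont hcross1 i with h | h
    · exact ⟨0, Or.inl rfl, fun τ hτ => weightIn_of_notMem (fun h' => h' (h τ hτ))⟩
    · exact ⟨1, Or.inr rfl, fun τ hτ => weightIn_of_mem (h τ hτ)⟩
  have he : ∀ i, ∃ d : ℝ, (d = 0 ∨ d = 1) ∧ ∀ τ ∈ Ioo (t i) (t (i + 1)), weightIn A γ τ = d := by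
    intro i
    rcases hwc A γ b hAb hγ.cont hcross2 i with h | h
    · exact ⟨1, Or.inr rfl, fun τ hτ => weightIn_of_mem (h τ hτ)⟩
    · exact ⟨0, Or.inl rfl, fun τ hτ => weightIn_of_notMem (h τ hτ)⟩
  choose d hd01 hd using hd
  choose e he01 he using he
  have hlt : ∀ i, t i < t (i + 1) := fun i => ht.strictMono (by omega)
  have hright : ∀ i, Ioo (t i) (t (i + 1)) ∈ 𝓝[>] (t i) := fun i => Ioo_mem_nhdsGT (hlt i)
  have hleft : ∀ i, Ioo (t i) (t (i + 1)) ∈ 𝓝[<] (t (i + 1)) := fun i => Ioo_mem_nhdsLT (hlt i)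
  -- The curve b stays in the phase space, so it lies in B exactly when it lies in R, and this
  -- changes at each crossing.
  have halt : ∀ i, d (i + 1) = 1 - d i := by
    intro i
    have hin : ∀ τ, T (γ τ) ∈ R → weightIn Bᶜ b τ = 0 := fun τ h =>
      weightIn_of_notMem (fun h' => h' (Or.inl h))
    have hout : ∀ τ, T (γ τ) ∉ R → weightIn Bᶜ b τ = 1 := fun τ h =>
      weightIn_of_mem (fun h' => h'.elim h (fun h'' => h'' (hTph τ)))
    rcases ht.crossing (i + 1) with ⟨h1, h2⟩ | ⟨h1, h2⟩
    · obtain ⟨τ, h3, h4⟩ := (h1.and (hleft i)).exists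
      obtain ⟨σ, h5, h6⟩ := (h2.and (hright (i + 1))).exists
      rw [← hd i τ h4, ← hd (i + 1) σ h6, hin τ h3, hout σ h5]
      norm_num
    · obtain ⟨τ, h3, h4⟩ := (h1.and (hleft i)).exists
      obtain ⟨σ, h5, h6⟩ := (h2.and (hright (i + 1))).exists
      rw [← hd i τ h4, ← hd (i + 1) σ h6, hout τ h3, hin σ h5]
      norm_num
  have hd2 : ∀ i q : ℤ, d (i + 2 * q) = d i := by
    intro i q
    induction q with
    | zero => simp
    | succ q ih =>
      have : i + 2 * ((q : ℤ) + 1) = i + 2 * q + 1 + 1 := by ring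
      rw [this, halt, halt, ih]
      ring
    | pred q ih =>
      have h1 : i + 2 * -(q : ℤ) = i + 2 * (-q - 1) + 1 + 1 := by ring
      rw [h1, halt, halt] at ih
      linarith
  -- The curl of the flux of A \ B vanishes at the common point, where b has parameter t (j + 1 - k)
  -- and γ has t (j + 1); hence the jumps of the two weights agree. Since k is even and d has period
  -- 2, the index shift disappears.
  have hjump : ∀ j, d j - d (j + 1) = e j - e (j + 1) := by
    intro j
    have hp : b (t (j + 1 - k)) = γ (t (j + 1)) := by
      have := hk (j + 1 - k)
      rwa [sub_add_cancel] at this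
    have hl1 := hleft (j - k)
    rw [show j - k + 1 = j + 1 - k by ring] at hl1
    obtain ⟨U₁, hU₁, h₁⟩ := hTγ.exists_nhds_integral_eq_jump (w := weightIn Bᶜ b)
      (b := t (j + 1 - k)) (w₁ := d (j - k)) (w₂ := d (j + 1 - k))
      (by
        filter_upwards [hl1] with τ hτ
        refine hd (j - k) τ ?_
        rwa [show j - k + 1 = j + 1 - k by ring])
      (by filter_upwards [hright (j + 1 - k)] with τ hτ using hd _ τ hτ)
    obtain ⟨U₂, hU₂, h₂⟩ := hγ.exists_nhds_integral_eq_jump (w := weightIn A γ)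
      (b := t (j + 1)) (w₁ := e j) (w₂ := e (j + 1))
      (by filter_upwards [hleft j] with τ hτ using he _ τ hτ)
      (by filter_upwards [hright (j + 1)] with τ hτ using he _ τ hτ)
    change U₁ ∈ 𝓝 (b (t (j + 1 - k))) at hU₁
    rw [hp] at hU₁
    obtain ⟨U₃, hU₃, h₃⟩ := hgg (γ (t (j + 1)))
    obtain ⟨χ, hχ, hsub, hχ1, -⟩ := exists_test_bump (inter_mem (inter_mem hU₁ hU₂) hU₃)
    have hcurl := curl_eq_of_gaussGreen h₃ hχ (hsub.trans inter_subset_right)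
    have c1 := hTγ.curl_lineFlux hwAm.aestronglyMeasurable (abs_weightIn_le _ _) hχ
    have c2 := hγ.curl_lineFlux hwBm.aestronglyMeasurable (abs_weightIn_le _ _) hχ
    rw [h₁ χ hχ (hsub.trans (inter_subset_left.trans inter_subset_left))] at c1
    rw [h₂ χ hχ (hsub.trans (inter_subset_left.trans inter_subset_right)), hχ1, mul_one] at c2
    change _ = (d (j - k) - d (j + 1 - k)) * χ (b (t (j + 1 - k))) at c1
    rw [hp, hχ1, mul_one] at c1
    have e1 : d (j - k) = d j := by
      have := hd2 j (-n)
      rwa [show j + 2 * -n = j - k by rw [hk2]; ring] at this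
    have e2 : d (j + 1 - k) = d (j + 1) := by
      have := hd2 (j + 1) (-n)
      rwa [show j + 1 + 2 * -n = j + 1 - k by rw [hk2]; ring] at this
    rw [← e1, ← e2, ← c1, ← c2]
    simp only [hL] at hcurl
    linarith
  -- Alternation makes the jump of d equal to 1 or -1; a jump of this size determines both values of
  -- the {0, 1}-valued weight e.
  have hde : ∀ j, e j = d j := by
    intro j
    have h1 := hjump j
    have h2 := halt j
    rcases hd01 j with h3 | h3 <;> rcases he01 j with h4 | h4 <;>
      rcases he01 (j + 1) with h5 | h5 <;> rw [h2, h3, h4, h5] at h1 <;> rw [h3, h4] <;>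
      norm_num at h1
  -- the area as a sum over the arcs
  have hE : T '' R \ R = A \ B := by
    ext z
    constructor
    · rintro ⟨⟨w, hw, rfl⟩, h2⟩
      refine ⟨Or.inl ⟨w, hw, rfl⟩, fun h => h.elim h2 fun h' => h' ?_⟩
      exact hT.bijOn.mapsTo (hR.subset hw)
    · rintro ⟨h1, h2⟩
      exact ⟨h1.resolve_right fun h => h2 (Or.inr h), fun h => h2 (Or.inl h)⟩
  have hEm : MeasurableSet (A \ B) := hAm.diff hBm
  have hRshift : ∀ z, z + (1, 0) ∈ R ↔ z ∈ R := by
    intro z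
    have := hR.shift z.1 z.2
    have e : z + (1, 0) = (z.1 + 1, z.2) := by ext <;> simp
    rw [e]
    exact this
  have hphshift : ∀ z : ℝ × ℝ, z + (1, 0) ∈ phase J ↔ z ∈ phase J := by
    intro z
    simp [mem_phase]
  have hTRshift : ∀ z, z + (1, 0) ∈ T '' R ↔ z ∈ T '' R := by
    intro z
    constructor
    · rintro ⟨w, hw, hwz⟩
      have hw' : w + (-1, 0) ∈ R := by
        rw [← hRshift]
        have e : w + (-1, 0) + (1, 0) = w := by ext <;> simp
        rwa [e]
      refine ⟨w + (-1, 0), hw', ?_⟩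
      have h1 := hT.map_shift hJ (mem_phase.1 (hR.subset hw'))
      have e : w + (-1, 0) + (1, 0) = w := by ext <;> simp
      rw [e, hwz] at h1
      exact (add_right_cancel h1).symm
    · rintro ⟨w, hw, rfl⟩
      exact ⟨w + (1, 0), (hRshift w).2 hw, hT.map_shift hJ (mem_phase.1 (hR.subset hw))⟩
  have hAshift : ∀ z, z + (1, 0) ∈ A ↔ z ∈ A := fun z => by
    simp only [hA, mem_union, mem_compl_iff, hTRshift, hphshift]
  have hBshift : ∀ z, z + (1, 0) ∈ B ↔ z ∈ B := fun z => by
    simp only [hBdef, mem_union, mem_compl_iff, hRshift, hphshift]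
  have hEper : ∀ θ ψ, (θ + 1, ψ) ∈ A \ B ↔ (θ, ψ) ∈ A \ B := by
    intro θ ψ
    have e : ((θ + 1, ψ) : ℝ × ℝ) = (θ, ψ) + (1, 0) := by simp
    rw [e, Set.mem_sdiff, Set.mem_sdiff, hAshift, hBshift]
  obtain ⟨B₁, hB₁⟩ := hT.exists_bound_image hR hJ hγ hi
  obtain ⟨B₂, hB₂⟩ := hγ.exists_bound_snd
  obtain ⟨B₃, hB₃⟩ := hTγ.exists_bound_snd
  set K := max (max B₁ B₂) B₃ with hK
  have hK1 : B₁ ≤ K := (le_max_left _ _).trans (le_max_left _ _)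
  have hK2 : B₂ ≤ K := (le_max_right _ _).trans (le_max_left _ _)
  have hK3 : B₃ ≤ K := le_max_right _ _
  have hK0 : 0 ≤ K := ((abs_nonneg _).trans (hB₂ 0)).trans hK2
  have hEK : ∀ z ∈ A \ B, |z.2| ≤ K := by
    rintro z ⟨h1, h2⟩
    rw [abs_le]
    refine ⟨?_, (hB₁ z h1).trans hK1⟩
    by_contra hlt'
    apply h2
    by_cases h : z ∈ phase J
    · exact Or.inl (hR.low z h fun τ => by linarith [(abs_le.1 (hB₂ τ)).1])
    · exact Or.inr h
  obtain ⟨harea, hfin⟩ := setIntegral_unfoldBump hEm hEper hEK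
  obtain ⟨η, hη, hηc, hη1⟩ := exists_cutoff (B := K + 1) (by linarith)
  -- The vertical derivative of `unfoldBump` times g is `unfoldBump` on A \ B, which yields the
  -- area; on both curves g(ψ) = ψ, which yields the integrals of ψ dθ.
  set g : ℝ → ℝ := fun ψ => ψ * η ψ with hg
  have hgs : ContDiff ℝ ∞ g := contDiff_id.mul hη
  have hgc : HasCompactSupport g := hηc.mul_left
  have hg1 : ∀ ψ, |ψ| ≤ K → g ψ = ψ ∧ deriv g ψ = 1 := by
    intro ψ hψ
    rw [abs_le] at hψ
    have : g =ᶠ[𝓝 ψ] id := by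
      filter_upwards [Icc_mem_nhds (show -(K + 1) < ψ by linarith [hψ.1])
        (show ψ < K + 1 by linarith [hψ.2])] with y hy
      simp [hg, hη1 y hy]
    exact ⟨this.eq_of_nhds, by rw [this.deriv_eq]; simp⟩
  have hgr := gaussGreen_of_forall_tsupport hLb (isTest_unfoldBump_mul hgs hgc)
    (fun z _ => hgg z) (0, 1)
  have hlhs : ∫ z in A \ B, fderiv ℝ (fun z : ℝ × ℝ => unfoldBump z.1 * g z.2) z (0, 1)
      = ∫ z in A \ B, unfoldBump z.1 := by
    refine setIntegral_congr_fun hEm fun z hz => ?_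
    simp only [fderiv_unfoldBump_mul hgs, (hg1 z.2 (hEK z hz)).2, mul_one]
  have hwAp : Function.Periodic (weightIn Bᶜ b) 1 := by
    intro τ
    have e : b (τ + 1) ∈ Bᶜ ↔ b τ ∈ Bᶜ := by simp only [hTγ.shift τ, mem_compl_iff, hBshift]
    by_cases h : b τ ∈ Bᶜ
    · rw [weightIn_of_mem h, weightIn_of_mem (e.2 h)]
    · rw [weightIn_of_notMem h, weightIn_of_notMem (mt e.1 h)]
  have hwBp : Function.Periodic (weightIn A γ) 1 := by
    intro τ
    have e : γ (τ + 1) ∈ A ↔ γ τ ∈ A := by simp only [hγ.shift τ, hAshift]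
    by_cases h : γ τ ∈ A
    · rw [weightIn_of_mem h, weightIn_of_mem (e.2 h)]
    · rw [weightIn_of_notMem h, weightIn_of_notMem (mt e.1 h)]
  rw [hlhs, harea] at hgr
  simp only [hL] at hgr
  rw [hTγ.lineFlux_unfoldBump hwAm (abs_weightIn_le _ _) hwAp hgs.continuous,
    hγ.lineFlux_unfoldBump hwBm (abs_weightIn_le _ _) hwBp hgs.continuous] at hgr
  have hb2 : ∀ τ, g (b τ).2 = (b τ).2 := fun τ => (hg1 _ ((hB₃ τ).trans hK3)).1
  have hγ2 : ∀ τ, g (γ τ).2 = (γ τ).2 := fun τ => (hg1 _ ((hB₂ τ).trans hK2)).1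
  simp only [hb2, hγ2] at hgr
  have hib := hTγ.intervalIntegrable_snd_mul hwAm (abs_weightIn_le _ _)
  have hiγ := hγ.intervalIntegrable_snd_mul hwBm (abs_weightIn_le _ _)
  rw [← intervalIntegral.integral_sub (hib 0 1) (hiγ 0 1)] at hgr
  set I : ℝ → ℝ := fun τ => weightIn Bᶜ b τ * ((b τ).2 * (deriv b τ).1)
    - weightIn A γ τ * ((γ τ).2 * (deriv γ τ).1) with hI
  have hIi : ∀ x y, IntervalIntegrable I volume x y := fun x y => (hib x y).sub (hiγ x y)
  have hIp : Function.Periodic I 1 := by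
    intro τ
    simp only [hI, hwAp τ, hwBp τ, hTγ.deriv_shift τ, hγ.deriv_shift τ, hTγ.shift τ, hγ.shift τ,
      Prod.snd_add, add_zero]
  -- On an arc both weights equal d i, so the integrand is d i times the pullback of dP.
  have hpiece : ∀ i, ∫ τ in (t i)..(t (i + 1)), I τ
      = d i * (primitive f T (γ (t (i + 1))) - primitive f T (γ (t i))) := by
    intro i
    rw [← hT.integral_primitive hJ hγ hi, ← intervalIntegral.integral_const_mul,
      intervalIntegral.integral_of_le (hlt i).le, intervalIntegral.integral_of_le (hlt i).le,
      integral_Ioc_eq_integral_Ioo, integral_Ioc_eq_integral_Ioo]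
    refine setIntegral_congr_fun measurableSet_Ioo fun τ hτ => ?_
    simp only [hI, hd i τ hτ, he i τ hτ, hde i]
    ring
  -- The period is started at t iu, so that it consists of exactly 2m complete arcs.
  have hsum : ∫ τ in (0 : ℝ)..1, I τ = ∑ q ∈ Finset.range (2 * m),
      d (iu + q) * (primitive f T (γ (t (iu + q + 1))) - primitive f T (γ (t (iu + q)))) := by
    have h1 := hIp.intervalIntegral_add_eq 0 (t iu)
    rw [zero_add] at h1
    have h2 := intervalIntegral.sum_integral_adjacent_intervals (f := I) (μ := volume)
      (a := fun q : ℕ => t (iu + q)) (n := 2 * m) (fun q _ => hIi _ _)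
    have h3 : t (iu + ((2 * m : ℕ) : ℤ)) = t iu + 1 := by
      push_cast
      exact ht.shift iu
    simp only [Nat.cast_zero, add_zero] at h2
    rw [h1, ← h3, ← h2]
    refine Finset.sum_congr rfl fun q _ => ?_
    rw [← hpiece]
    push_cast
    rw [add_assoc]
  rw [hsum] at hgr
  have hgper : ∀ i, primitive f T (γ (t (i + 2 * m))) = primitive f T (γ (t i)) := by
    intro i
    rw [ht.shift, hγ.shift, hT.primitive_shift hJ (interior_subset (hi _))]
  have hcov : ∀ i : ℤ, (∃ j < m, ∃ q : ℤ, i = iu + 2 * n * (j : ℕ) + 2 * m * q) ∨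
      (∃ j < m, ∃ q : ℤ, i = is + 2 * n * (j : ℕ) + 2 * m * q) := by
    have key : ∀ (i : ℤ) (z : ℝ × ℝ) (iz : ℤ), γ (t iz) = z → γ (t i) ∈ orbitLifts T m z →
        ∃ j < m, ∃ q : ℤ, i = iz + 2 * n * (j : ℕ) + 2 * m * q := by
      rintro i z iz rfl ⟨j, hj, q, h⟩
      refine ⟨j, hj, q, ?_⟩
      rw [hiter, ← hγint, ← ht.shift_mul] at h
      have := ht.strictMono.injective (hγ.inj h)
      rw [this, hk2]
      ring
    intro i
    have : γ (t i) ∈ orbitLifts T m u ∪ orbitLifts T m s := ht.points ▸ ⟨i, rfl⟩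
    exact this.imp (key i u iu hiu) (key i s is his)
  have hfinal := abs_sum_alternating hm (g := fun i => primitive f T (γ (t i))) hgper hd01 halt
    hcov
  have hPs : ∀ (z : ℝ × ℝ) (iz : ℤ), z ∈ phase J → γ (t iz) = z →
      periodicSum f T m z = ∑ j ∈ Finset.range m, primitive f T (γ (t (iz + 2 * n * j))) := by
    intro z iz hz hiz
    rw [periodicSum_eq hT hz, ← hiz]
    refine Finset.sum_congr rfl fun j _ => ?_
    rw [hiter, hk2]
    congr 3
    ring
  rw [hPs u iu hu.1 hiu, hPs s is hs.1 his, ← hfinal, escapeArea, hE]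
  rw [← hgr, abs_of_nonneg ENNReal.toReal_nonneg, ENNReal.ofReal_toReal hfin]

end EscapeArea

end

/-! ### Twist maps and the action generating function. -/

noncomputable section

namespace EscapeArea

variable {J : Set ℝ} {f : ℝ → ℝ → ℝ} {T : ℝ × ℝ → ℝ × ℝ} {n : ℤ} {m : ℕ}

lemma IsGeneratedBy.continuousOn_vertical (hT : IsGeneratedBy J f T) (θ : ℝ) :
    ContinuousOn (fun ψ => T (θ, ψ)) J :=
  hT.contDiffOn.continuousOn.comp (by fun_prop) fun _ h => mem_phase.2 h

lemma IsGeneratedBy.continuousOn_mixedGenDθ (hT : IsGeneratedBy J f T) (θ : ℝ) :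
    ContinuousOn (fun p => mixedGenDθ f p θ) J := by
  have h : ContinuousOn (fun p => fderiv ℝ (mixedGenU f) (p, θ) (0, 1)) J := by
    intro p hp
    have h1 : ContinuousAt (fderiv ℝ (mixedGenU f)) (p, θ) :=
      ((hT.contDiffAt_mixedGenU hp θ).fderiv_right (m := 1) (by norm_num)).continuousAt
    have h2 : ContinuousAt (fun p : ℝ => (p, θ)) p := by fun_prop
    have h3 : ContinuousAt (fun p : ℝ => fderiv ℝ (mixedGenU f) (p, θ)) p :=
      ContinuousAt.comp (f := fun p : ℝ => (p, θ)) h1 h2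
    exact (h3.clm_apply continuousAt_const).continuousWithinAt
  exact h.congr fun p hp => hT.mixedGenDθ_eq hp θ

lemma IsGeneratedBy.mixedGenDθ_snd_map (hT : IsGeneratedBy J f T) {z : ℝ × ℝ} (hz : z.2 ∈ J) :
    mixedGenDθ f (T z).2 z.1 = z.2 := by
  rw [hT.mixedGenDθ_eq (hT.mapsTo hz), ← hT.snd_eq hz]

/-- Every pair `(ψ', θ)` in the domain of the generating function comes from a phase point. -/
lemma IsGeneratedBy.mixedGenDθ_mem (hT : IsGeneratedBy J f T) (hJ : J = univ ∨ J = Ici 0)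
    {p : ℝ} (hp : p ∈ J) (θ : ℝ) : mixedGenDθ f p θ ∈ J := by
  rcases hJ with rfl | rfl
  · trivial
  obtain ⟨C, hC⟩ := (isCompact_Icc (a := (0 : ℝ)) (b := p)).bddAbove_image
    ((hT.continuousOn_mixedGenDθ θ).mono Icc_subset_Ici_self)
  -- This ψ exceeds every value of ∂F/∂θ(·, θ) on [0, p], so its new momentum is beyond p. The new
  -- momentum of ψ = 0 is 0, and the intermediate value theorem reaches p.
  set ψ := max (C + 1) 0 with hψ
  have hψ0 : (0 : ℝ) ≤ ψ := le_max_right _ _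
  have hle : p ≤ (T (θ, ψ)).2 := by
    by_contra! h
    have h1 : mixedGenDθ f (T (θ, ψ)).2 θ ≤ C :=
      hC ⟨_, ⟨hT.mapsTo (z := (θ, ψ)) hψ0, h.le⟩, rfl⟩
    rw [hT.mixedGenDθ_snd_map (z := (θ, ψ)) hψ0] at h1
    have : C + 1 ≤ ψ := le_max_left _ _
    simp only at h1
    linarith
  have hc : ContinuousOn (fun x => (T (θ, x)).2) (Icc 0 ψ) :=
    ((continuous_snd.comp_continuousOn (hT.continuousOn_vertical θ))).mono Icc_subset_Ici_self
  obtain ⟨x, hx, hxp⟩ := intermediate_value_Icc hψ0 hc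
    ⟨(hT.snd_map_boundary θ).le.trans hp, hle⟩
  simp only at hxp
  rw [← hxp, hT.mixedGenDθ_snd_map (z := (θ, x)) hx.1]
  exact hx.1

lemma IsTwist.deriv_ne_zero (hw : IsTwist J T) {θ ψ : ℝ} (hψ : ψ ∈ interior J) :
    deriv (fun p => (T (θ, p)).1) ψ ≠ 0 := by
  have h := hw θ ψ (interior_subset hψ)
  rwa [derivWithin_of_mem_nhds (mem_interior_iff_mem_nhds.1 hψ)] at h

/-- By Rolle, two momenta with the same new angle would give an interior zero of ∂θ'/∂ψ. -/
lemma IsTwist.injOn (hw : IsTwist J T) (hT : IsGeneratedBy J f T) (hJ : J = univ ∨ J = Ici 0)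
    (θ : ℝ) : InjOn (fun ψ => (T (θ, ψ)).1) J := by
  have hconv : OrdConnected J := by
    rcases hJ with rfl | rfl
    · exact ordConnected_univ
    · exact ordConnected_Ici
  have key : ∀ a ∈ J, ∀ b ∈ J, a < b → (T (θ, a)).1 ≠ (T (θ, b)).1 := by
    intro a ha b hb hab h
    have hs : Icc a b ⊆ J := hconv.out ha hb
    obtain ⟨c, hc, hc0⟩ := exists_deriv_eq_zero (f := fun ψ => (T (θ, ψ)).1) hab
      ((continuous_fst.comp_continuousOn (hT.continuousOn_vertical θ)).mono hs) h
    refine hw.deriv_ne_zero (interior_mono hs ?_) hc0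
    rwa [interior_Icc]
  intro a ha b hb h
  rcases lt_trichotomy a b with hab | hab | hab
  · exact absurd h (key a ha b hb hab)
  · exact hab
  · exact absurd h.symm (key b hb a ha hab)

lemma newMomentum_map (hw : IsTwist J T) (hT : IsGeneratedBy J f T)
    (hJ : J = univ ∨ J = Ici 0) {z : ℝ × ℝ} (hz : z.2 ∈ J) :
    newMomentum J f z.1 (T z).1 = (T z).2 := by
  have hadm : IsAdmissible J f z.1 (T z).1 :=
    ⟨(T z).2, hT.mapsTo hz, by rw [hT.mixedGenDψ_eq (hT.mapsTo hz), ← hT.fst_eq hz]⟩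
  rw [newMomentum, dif_pos hadm]
  obtain ⟨h1, h2⟩ := hadm.choose_spec
  set p := hadm.choose
  -- The chosen solution p is the new momentum of the phase point (θ, ∂F/∂θ(p, θ)). That point has
  -- the same new angle as z, so the twist identifies the two.
  have hq := hT.mixedGenDθ_mem hJ h1 z.1
  have hTq := (hT.generated z.1 _ hq (T z).1 p h1).2 ⟨rfl, h2⟩
  have e : mixedGenDθ f p z.1 = z.2 := hw.injOn hT hJ z.1 hq hz (by simp [hTq])
  rw [e] at hTq
  exact (congrArg Prod.snd hTq).symm

/-- The link between action and flux: under twist, F_a is the primitive P read in the coordinates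
(θ, θ'). -/
lemma actionGen_map (hw : IsTwist J T) (hT : IsGeneratedBy J f T)
    (hJ : J = univ ∨ J = Ici 0) {z : ℝ × ℝ} (hz : z.2 ∈ J) :
    actionGen J f z.1 (T z).1 = primitive f T z := by
  rw [actionGen, newMomentum_map hw hT hJ hz]
  rfl

/-- `dF_a = ψ' dθ' - ψ dθ`. -/
lemma hasFDerivAt_actionGen (hw : IsTwist J T) (hT : IsGeneratedBy J f T)
    (hJ : J = univ ∨ J = Ici 0) {z : ℝ × ℝ} (hz : z.2 ∈ interior J) :
    HasFDerivAt (fun q : ℝ × ℝ => actionGen J f q.1 q.2)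
      ((T z).2 • ContinuousLinearMap.snd ℝ ℝ ℝ - z.2 • ContinuousLinearMap.fst ℝ ℝ ℝ)
      (z.1, (T z).1) := by
  -- The change of coordinates (θ, ψ) ↦ (θ, θ') has Jacobian ∂θ'/∂ψ, nonzero by twist. Locally F_a
  -- is P composed with its inverse, so dF_a is dP in the new coordinates.
  set Q : ℝ × ℝ → ℝ × ℝ := fun y => (y.1, (T y).1) with hQ
  have hQs : HasStrictFDerivAt Q ((ContinuousLinearMap.fst ℝ ℝ ℝ).prod
      ((ContinuousLinearMap.fst ℝ ℝ ℝ).comp (fderiv ℝ T z))) z :=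
    hasStrictFDerivAt_fst.prodMk
      (hasStrictFDerivAt_fst.comp z ((hT.contDiffAt hz).hasStrictFDerivAt (by simp)))
  have htw : (fderiv ℝ T z (0, 1)).1 ≠ 0 := by
    have h1 : HasDerivAt (fun p : ℝ => (z.1, p)) ((0, 1) : ℝ × ℝ) z.2 :=
      (hasDerivAt_const z.2 z.1).prodMk (hasDerivAt_id z.2)
    have h2 : HasDerivAt (fun p : ℝ => T (z.1, p)) (fderiv ℝ T z (0, 1)) z.2 :=
      (hT.hasFDerivAt hz).comp_hasDerivAt z.2 h1
    have h3 := hw.deriv_ne_zero (θ := z.1) hz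
    have h4 : HasDerivAt (fun p : ℝ => (T (z.1, p)).1) (fderiv ℝ T z (0, 1)).1 z.2 :=
      (ContinuousLinearMap.fst ℝ ℝ ℝ).hasFDerivAt.comp_hasDerivAt z.2 h2
    rwa [h4.deriv] at h3
  set A := (ContinuousLinearMap.fst ℝ ℝ ℝ).prod
      ((ContinuousLinearMap.fst ℝ ℝ ℝ).comp (fderiv ℝ T z)) with hA
  have hinj : Function.Injective A := by
    rw [injective_iff_map_eq_zero]
    rintro ⟨x, y⟩ hx
    have h1 : x = 0 := congrArg Prod.fst hx
    have h2 : (fderiv ℝ T z (x, y)).1 = 0 := congrArg Prod.snd hx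
    have h3 : ((x, y) : ℝ × ℝ) = y • (0, 1) := by simp [h1]
    rw [h3, map_smul, Prod.smul_fst, smul_eq_mul] at h2
    rw [h1, (mul_eq_zero.1 h2).resolve_right htw]
    rfl
  let e : (ℝ × ℝ) ≃L[ℝ] ℝ × ℝ :=
    (LinearEquiv.ofInjectiveEndo (A : ℝ × ℝ →ₗ[ℝ] ℝ × ℝ) hinj).toContinuousLinearEquiv
  have heA : (e : ℝ × ℝ →L[ℝ] ℝ × ℝ) = A := by ext <;> rfl
  rw [← heA] at hQs
  set g := hQs.localInverse with hg
  have hgd : HasFDerivAt g (e.symm : ℝ × ℝ →L[ℝ] ℝ × ℝ) (Q z) :=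
    hQs.to_localInverse.hasFDerivAt
  have hgz : g (Q z) = z := hQs.localInverse_apply_image
  have hP : HasFDerivAt (primitive f T) _ (g (Q z)) := hgz ▸ hT.hasFDerivAt_primitive hz
  have hcomp := hP.comp (Q z) hgd
  have hev : (fun q : ℝ × ℝ => actionGen J f q.1 q.2) =ᶠ[𝓝 (Q z)] primitive f T ∘ g := by
    have h1 : ∀ᶠ q in 𝓝 (Q z), g q ∈ phase J :=
      hgd.continuousAt.eventually_mem (hgz.symm ▸ phase_mem_nhds hz)
    filter_upwards [h1, hQs.eventually_right_inverse] with q hq hr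
    have hr : Q (g q) = q := hr
    have := actionGen_map hw hT hJ (mem_phase.1 hq)
    rw [Function.comp_apply, ← this]
    have e1 : (Q (g q)).1 = q.1 := congrArg Prod.fst hr
    have e2 : (Q (g q)).2 = q.2 := congrArg Prod.snd hr
    rw [← e1, ← e2]
  refine (hcomp.congr_of_eventuallyEq hev).congr_fderiv ?_
  refine ContinuousLinearMap.ext fun v => ?_
  obtain ⟨w, rfl⟩ := e.surjective v
  have hew : e w = A w := by rw [← heA]; rfl
  rw [ContinuousLinearMap.comp_apply, ContinuousLinearEquiv.coe_coe, e.symm_apply_apply, hgz, hew]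
  simp [hA]

lemma hasDerivAt_actionGen (hw : IsTwist J T) (hT : IsGeneratedBy J f T)
    (hJ : J = univ ∨ J = Ici 0) {z : ℝ × ℝ} (hz : z.2 ∈ interior J) :
    HasDerivAt (fun x => actionGen J f x (T z).1) (-z.2) z.1 ∧
      HasDerivAt (fun y => actionGen J f z.1 y) (T z).2 (T z).1 := by
  have h := hasFDerivAt_actionGen hw hT hJ hz
  have h1 : HasDerivAt (fun x : ℝ => (x, (T z).1)) ((1, 0) : ℝ × ℝ) z.1 :=
    (hasDerivAt_id _).prodMk (hasDerivAt_const _ _)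
  have h2 : HasDerivAt (fun y : ℝ => (z.1, y)) ((0, 1) : ℝ × ℝ) (T z).1 :=
    (hasDerivAt_const _ _).prodMk (hasDerivAt_id _)
  exact ⟨by simpa [Function.comp_def] using h.comp_hasDerivAt z.1 h1,
    by simpa [Function.comp_def] using h.comp_hasDerivAt (T z).1 h2⟩

lemma nextAngle_orbitAngles {z : ℝ × ℝ} (hz : IsPeriodicOfType J T n m z) (j : Fin m) :
    nextAngle n (orbitAngles T m z) j = (T^[j + 1] z).1 := by
  unfold nextAngle
  split_ifs with h
  · rfl
  · have e : (j : ℕ) + 1 = m := by omega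
    rw [e, hz.2]
    rfl

lemma action_orbitAngles (hw : IsTwist J T) (hT : IsGeneratedBy J f T)
    (hJ : J = univ ∨ J = Ici 0) {z : ℝ × ℝ} (hz : IsPeriodicOfType J T n m z) :
    action J f n (orbitAngles T m z) = ∑ j ∈ Finset.range m, primitive f T (T^[j] z) := by
  rw [action, Finset.sum_range]
  refine Finset.sum_congr rfl fun j _ => ?_
  rw [nextAngle_orbitAngles hz, Function.iterate_succ_apply']
  exact actionGen_map hw hT hJ (mem_phase.1 (orbit_mem_phase hT hz.1 j))

end EscapeArea

end

/-! ### The theorem. -/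

theorem mainTheorem3 (J : Set ℝ) (hJ : J = Set.univ ∨ J = Set.Ici 0)
    (f : ℝ → ℝ → ℝ) (T : ℝ × ℝ → ℝ × ℝ) (hT : EscapeArea.IsGeneratedBy J f T) :
    (EscapeArea.IsTwist J T →
      -- `F_a` generates the map: `ψ = -∂F_a/∂θ`, `ψ' = ∂F_a/∂θ'`
      (∀ θ, ∀ ψ ∈ interior J, ∀ θ' ψ', T (θ, ψ) = (θ', ψ') →
        HasDerivAt (fun x => EscapeArea.actionGen J f x θ') (-ψ) θ ∧
        HasDerivAt (fun y => EscapeArea.actionGen J f θ y) ψ' θ') ∧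
      -- `ψ' ∂f/∂ψ' - f = ψ' θ' - F = F_a(θ, θ')`
      (∀ θ, ∀ ψ ∈ J, ∀ θ' ψ', T (θ, ψ) = (θ', ψ') →
        ψ' * deriv (fun p => f p θ) ψ' - f ψ' θ = ψ' * θ' - EscapeArea.mixedGen f ψ' θ ∧
        ψ' * θ' - EscapeArea.mixedGen f ψ' θ = EscapeArea.actionGen J f θ θ') ∧
      -- the action difference and the flux
      (∀ (n : ℤ) (m : ℕ), 0 < m → ∀ u s : ℝ × ℝ,
        EscapeArea.IsExtremizingOrbit J f T n m u → EscapeArea.IsMaxminOrbit J f T n m s →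
        EscapeArea.actionDifference J f T n m u s =
          EscapeArea.periodicSum f T m u - EscapeArea.periodicSum f T m s ∧
        EscapeArea.actionDifference J f T n m u s =
          EscapeArea.mixedSum f T m u - EscapeArea.mixedSum f T m s ∧
        (∀ (γ : ℝ → ℝ × ℝ) (R : Set (ℝ × ℝ)) (t : ℤ → ℝ),
          EscapeArea.IsClosedCurve J γ → EscapeArea.IsDomainBoundedBy J γ R →
          EscapeArea.IsTurnstile T m u s γ R t →
          EscapeArea.escapeArea T R =
            ENNReal.ofReal |EscapeArea.actionDifference J f T n m u s| ∧
          EscapeArea.escapeArea T R =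
            ENNReal.ofReal |EscapeArea.periodicSum f T m u - EscapeArea.periodicSum f T m s|))) ∧
    -- the flux formula in terms of `f` needs no twist
    (∀ (n : ℤ) (m : ℕ), 0 < m → ∀ u s : ℝ × ℝ,
      EscapeArea.IsPeriodicOfType J T n m u → EscapeArea.IsPeriodicOfType J T n m s →
      ∀ (γ : ℝ → ℝ × ℝ) (R : Set (ℝ × ℝ)) (t : ℤ → ℝ),
        EscapeArea.IsClosedCurve J γ → EscapeArea.IsDomainBoundedBy J γ R →
        EscapeArea.IsTurnstile T m u s γ R t →
        EscapeArea.escapeArea T R =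
          ENNReal.ofReal |EscapeArea.periodicSum f T m u - EscapeArea.periodicSum f T m s|) := by
  have hflux {n : ℤ} {m : ℕ} (hm : 0 < m) {u s : ℝ × ℝ}
      (hu : EscapeArea.IsPeriodicOfType J T n m u) (hs : EscapeArea.IsPeriodicOfType J T n m s)
      {γ : ℝ → ℝ × ℝ} {R : Set (ℝ × ℝ)} {t : ℤ → ℝ} (hC : EscapeArea.IsClosedCurve J γ)
      (hR : EscapeArea.IsDomainBoundedBy J γ R) (ht : EscapeArea.IsTurnstile T m u s γ R t) :=
    EscapeArea.escapeArea_eq hJ hT hm hu hs hC hR ht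
  refine ⟨fun hw => ⟨?_, ?_, ?_⟩, fun n m hm u s hu hs γ R t hC hR ht => hflux hm hu hs hC hR ht⟩
  · intro θ ψ hψ θ' ψ' h
    have := EscapeArea.hasDerivAt_actionGen hw hT hJ (z := (θ, ψ)) hψ
    rwa [h] at this
  · intro θ ψ hψ θ' ψ' h
    have h1 := hT.primitive_eq (z := (θ, ψ)) hψ
    have h2 := EscapeArea.actionGen_map hw hT hJ (z := (θ, ψ)) hψ
    rw [EscapeArea.primitive, EscapeArea.mixedGenU] at h1 h2
    rw [h] at h1 h2
    exact ⟨h1.symm, h2.symm⟩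
  · intro n m hm u s hu hs
    have hA : EscapeArea.actionDifference J f T n m u s =
        EscapeArea.mixedSum f T m u - EscapeArea.mixedSum f T m s := by
      rw [EscapeArea.actionDifference, EscapeArea.action_orbitAngles hw hT hJ hu.1,
        EscapeArea.action_orbitAngles hw hT hJ hs.1, EscapeArea.mixedSum_eq,
        EscapeArea.mixedSum_eq]
    have hP : EscapeArea.actionDifference J f T n m u s =
        EscapeArea.periodicSum f T m u - EscapeArea.periodicSum f T m s := by
      rw [hA, EscapeArea.periodicSum_eq hT hu.1.1, EscapeArea.periodicSum_eq hT hs.1.1,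
        EscapeArea.mixedSum_eq, EscapeArea.mixedSum_eq]
    refine ⟨hP, hA, fun γ R t hC hR ht => ?_⟩
    have h := hflux hm hu.1 hs.1 hC hR ht
    exact ⟨hP ▸ h, h⟩
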